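/- **Setting.** Let $n\ge 2$, $s\in(0,1)$, $\lambda\ge1$, $\varrho\in(0,\infty]$, $\sigma\in\mathbb R$. Let $K_1,K_2:\mathbb R^n\setminus\{0\}\to[0,\infty)$ be even functions of class $C^2$ such that, for $i\in\{1,2\}$ and all $\zeta\ne0$, $$\frac{\chi_{B_\varrho}(\zeta)}{\lambda|\zeta|^{n+s}}\le K_i(\zeta)\le\frac{\lambda}{|\zeta|^{n+s}},\qquad |D^jK_i(\zeta)|\le\frac{\lambda}{|\zeta|^{n+s+j}}\quad(j=1,2),$$ where $B_\infty=\mathbb R^n$. Assume that for every $\zeta\neq0$ the limits $K_i^*(\zeta)=\lim_{r\to0^+}r^{n+s}K_i(r\zeta)$ exist and that $K_i^*(\zeta)=a_i(\zeta/|\zeta|)\,|\zeta|^{-n-s}$, where $a_1,a_2$ are continuous even functions on the unit sphere, bounded from above and below by positive constants. Assume that there is $\varepsilon_0\in(0,1)$ such that $$|\sigma|\,K_2(\zeta)\le(1-\varepsilon_0)\,K_1(\zeta)\qquad\text{for all }\zeta\in B_{\varepsilon_0}\setminus\{0\}.$$ Let $g\in C^1(\mathbb R^n)$ and let $\Omega\subset\mathbb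 R^n$ be a bounded open set with $C^1$ boundary. For $E\subseteq\Omega$ measurable put $I_K(E,F)=\int_E\int_FK(x-y)\,dy\,dx$ and $$\mathcal C(E)=I_{K_1}(E,E^c\cap\Omega)+\sigma\,I_{K_2}(E,\Omega^c)+\int_Eg\,dx .$$ Let $E\subseteq\Omega$ be a volume-constrained critical set of $\mathcal C$, that is, $E$ is measurable, the interactions in $\mathcal C(E)$ are finite, and $\frac{d}{dt}\big|_{t=0}\mathcal C(f_t(E))=0$ for every smooth family $\{f_t\}_{|t|<\delta}$ of diffeomorphisms of $\mathbb R^n$ with $f_0=\mathrm{Id}$ such that, for each $|t|<\delta$, $f_t-\mathrm{Id}$ has compact support, $f_t(\Omega)=\Omega$ and $|f_t(E)|=|E|$. As usual, $E$ is normalized on null sets so that $0<|E\cap B_r(x)|<|B_r(x)|$ for all $x\in\Omega\cap\partial E$ and $r>0$. Let $M=\overline{\Omega\cap\partial E}$ and let $x_0\in M\cap\partial\Omega$ be a regular contact point: for some $\rho>0$ and $\alpha\in(s,1)$, $B_\rho(x_0)\cap M$ is a hypersurface of class $C^{1,\alpha}$, possibly with boundary, and its boundary (if any) is contained in $\partial\Omega$.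 Suppose that $H,V$ are open half-spaces with $$\frac{\Omega-x_0}{r}\to H,\qquad \frac{E-x_0}{r}\to H\cap V\qquad\text{in }L^1_{\rm loc}(\mathbb R^n)\text{ as }r\to0^+,$$ and let $\vartheta\in[0,\pi]$ be the angle between $H$ and $V$, i.e. in suitable orthonormal coordinates $$H\cap V=\{x:\ (x_1,x_n)=\rho(\cos\beta,\sin\beta)\text{ for some }\rho>0,\ \beta\in(0,\vartheta)\}.$$ **Theorem.** Then $\vartheta\in(0,\pi)$ and, for every $v\in H\cap\partial V$, $$\mathbf H^{K_1^*}_{\partial(H\cap V)}(v)-\int_{H^c}K_1^*(v-z)\,dz+\sigma\int_{H^c}K_2^*(v-z)\,dz=0,$$ where $\mathbf H^{K}_{\partial F}(v)=\mathrm{p.v.}\int_{\mathbb R^n}K(v-y)\,\big(\chi_{F^c}(y)-\chi_F(y)\big)\,dy$; in particular this principal value exists and both integrals over $H^c$ are finite. -/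

import Mathlib

open Set Filter Topology MeasureTheory Metric
open scoped ENNReal ContDiff RealInnerProductSpace

noncomputable section

namespace Capillarity

/-- Euclidean space of dimension `n`. -/
abbrev Space (n : ℕ) := EuclideanSpace ℝ (Fin n)

/-! ### Interaction kernels -/

/-- The class `𝐊(n, s, lam, ϱ)` of interaction kernels: even, nonnegative functions on
`ℝⁿ ∖ {0}` with `χ_{B_ϱ}(ζ) / (lam |ζ|^{n+s}) ≤ K(ζ) ≤ lam / |ζ|^{n+s}`, where `ϱ ∈ (0, ∞]`.
The value of `K` at the origin is irrelevant. -/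
structure IsKernel (n : ℕ) (s lam : ℝ) (ϱ : ℝ≥0∞) (K : Space n → ℝ) : Prop where
  even : ∀ ζ, ζ ≠ 0 → K (-ζ) = K ζ
  nonneg : ∀ ζ, ζ ≠ 0 → 0 ≤ K ζ
  lower : ∀ ζ, ζ ≠ 0 → ‖ζ‖ₑ < ϱ → 1 / (lam * ‖ζ‖ ^ ((n : ℝ) + s)) ≤ K ζ
  upper : ∀ ζ, ζ ≠ 0 → K ζ ≤ lam / ‖ζ‖ ^ ((n : ℝ) + s)

/-- The class `𝐊^h(n, s, lam, ϱ)`: kernels in `𝐊(n, s, lam, ϱ) ∩ C^h(ℝⁿ ∖ {0})` with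
`|D^j K(ζ)| ≤ lam / |ζ|^{n+s+j}` for `1 ≤ j ≤ h`. -/
structure IsSmoothKernel (h n : ℕ) (s lam : ℝ) (ϱ : ℝ≥0∞) (K : Space n → ℝ) : Prop
    extends IsKernel n s lam ϱ K where
  contDiffOn : ContDiffOn ℝ h K {0}ᶜ
  deriv_bound : ∀ j : ℕ, 1 ≤ j → j ≤ h → ∀ ζ, ζ ≠ 0 →
    ‖iteratedFDeriv ℝ j K ζ‖ ≤ lam / ‖ζ‖ ^ ((n : ℝ) + s + j)

/-- `K` admits the blow-up limit `Kstar`: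
`Kstar(ζ) = lim_{r → 0⁺} r^{n+s} K(r ζ)` for every `ζ ≠ 0`. -/
def AdmitsBlowUpLimit {n : ℕ} (s : ℝ) (K Kstar : Space n → ℝ) : Prop :=
  ∀ ζ, ζ ≠ 0 → Tendsto (fun r : ℝ => r ^ ((n : ℝ) + s) * K (r • ζ)) (𝓝[>] 0) (𝓝 (Kstar ζ))

/-- `Kstar(ζ) = a(ζ/|ζ|) / |ζ|^{n+s}` for `ζ ≠ 0`, where `a` is a continuous even function on the
unit sphere which is bounded from above and below by two positive constants. -/
def IsAnisotropicKernel {n : ℕ} (s : ℝ) (Kstar : Space n → ℝ) : Prop :=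
  ∃ a : Space n → ℝ, ContinuousOn a (sphere 0 1) ∧
    (∃ c C : ℝ, 0 < c ∧ ∀ u ∈ sphere (0 : Space n) 1, c ≤ a u ∧ a u ≤ C) ∧
    (∀ u ∈ sphere (0 : Space n) 1, a (-u) = a u) ∧
    ∀ ζ, ζ ≠ 0 → Kstar ζ = a (‖ζ‖⁻¹ • ζ) / ‖ζ‖ ^ ((n : ℝ) + s)

/-! ### The capillarity functional -/

/-- The interaction `I_K(E, F) = ∫_E ∫_F K(x - y) dy dx`. -/
def interaction {n : ℕ} (K : Space n → ℝ) (E F : Set (Space n)) : ℝ≥0∞ :=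
  ∫⁻ x in E, ∫⁻ y in F, ENNReal.ofReal (K (x - y))

/-- The functional `𝒞(E) = I_{K₁}(E, Eᶜ ∩ Ω) + σ I_{K₂}(E, Ωᶜ) + ∫_E g`. -/
def capillarityEnergy {n : ℕ} (K₁ K₂ : Space n → ℝ) (σ : ℝ) (g : Space n → ℝ)
    (Ω E : Set (Space n)) : ℝ :=
  (interaction K₁ E (Eᶜ ∩ Ω)).toReal + σ * (interaction K₂ E Ωᶜ).toReal + ∫ x in E, g x

/-- A family `{f_t}_{|t| < δ}` of `C^∞` diffeomorphisms of `ℝⁿ`, depending smoothly on `(t, x)`, with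
`f_0 = Id`, such that `f_t - Id` has compact support, `f_t(Ω) = Ω` and `|f_t(E)| = |E|`.
Values of `f` at `|t| ≥ δ` play no role. -/
structure IsAdmissibleVariation {n : ℕ} (Ω E : Set (Space n)) (δ : ℝ)
    (f : ℝ → (Space n ≃ Space n)) : Prop where
  smooth : ContDiffOn ℝ ∞ (fun p : ℝ × Space n => f p.1 p.2) (Ioo (-δ) δ ×ˢ univ)
  smooth_symm : ∀ t ∈ Ioo (-δ) δ, ContDiff ℝ ∞ (f t).symm
  zero : ∀ x, f 0 x = x
  compactSupport : ∀ t ∈ Ioo (-δ) δ, HasCompactSupport (fun x => f t x - x)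
  image_container : ∀ t ∈ Ioo (-δ) δ, f t '' Ω = Ω
  volume_image : ∀ t ∈ Ioo (-δ) δ, volume (f t '' E) = volume E

/-- `E ⊆ Ω` is a volume-constrained critical set of `𝒞`: it is (Lebesgue) measurable, its
interaction energies are finite, and `d/dt 𝒞(f_t(E)) = 0` at `t = 0` for every admissible
family. -/
structure IsVolumeConstrainedCritical {n : ℕ} (K₁ K₂ : Space n → ℝ) (σ : ℝ) (g : Space n → ℝ)
    (Ω E : Set (Space n)) : Prop where
  subset : E ⊆ Ω
  measurable : NullMeasurableSet E volume
  finite_inner : interaction K₁ E (Eᶜ ∩ Ω) < ⊤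
  finite_outer : interaction K₂ E Ωᶜ < ⊤
  critical : ∀ δ : ℝ, 0 < δ → ∀ f : ℝ → (Space n ≃ Space n),
    IsAdmissibleVariation Ω E δ f →
      HasDerivAt (fun t => capillarityEnergy K₁ K₂ σ g Ω (f t '' E)) 0 0

/-! ### Boundaries and regular points -/

/-- `Ω` has `C¹` boundary: near every boundary point, `Ω` is the strict epigraph of a `C¹` function
defined on the hyperplane orthogonal to some unit vector `ν`. -/
def HasC1Boundary {n : ℕ} (Ω : Set (Space n)) : Prop :=
  ∀ x ∈ frontier Ω, ∃ ν : Space n, ‖ν‖ = 1 ∧ ∃ ψ : ((ℝ ∙ ν)ᗮ : Submodule ℝ (Space n)) → ℝ,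
    ContDiff ℝ 1 ψ ∧ ∃ ρ > 0, ∀ y ∈ ball x ρ,
      y ∈ Ω ↔ ψ ((ℝ ∙ ν)ᗮ.orthogonalProjectionOnto y) < ⟪ν, y⟫

/-- `E` is normalized in `Ω`: every point of `Ω ∩ ∂E` is a boundary point in the measure theoretic
sense, i.e. both `E` and its complement have positive measure in each ball around it. -/
def IsNormalizedIn {n : ℕ} (Ω E : Set (Space n)) : Prop :=
  ∀ x ∈ Ω ∩ frontier E, ∀ r > 0, 0 < volume (ball x r ∩ E) ∧ 0 < volume (ball x r \ E)

/-- `φ` is of class `C^{1,α}` on the set `U` (meant to be open). -/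
def IsC1Holder {n : ℕ} (α : ℝ) (φ : Space n → ℝ) (U : Set (Space n)) : Prop :=
  ContDiffOn ℝ 1 φ U ∧ ∃ C : ℝ, ∀ y ∈ U, ∀ z ∈ U,
    ‖fderiv ℝ φ y - fderiv ℝ φ z‖ ≤ C * ‖y - z‖ ^ α

/-- Near `p`, the set `M` is a `C^{1,α}` hypersurface without boundary: the zero set of a `C^{1,α}`
function with nonvanishing differential. -/
def IsInteriorManifoldPoint {n : ℕ} (α : ℝ) (M : Set (Space n)) (p : Space n) : Prop :=
  ∃ U : Set (Space n), IsOpen U ∧ p ∈ U ∧ ∃ φ : Space n → ℝ, IsC1Holder α φ U ∧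
    φ p = 0 ∧ fderiv ℝ φ p ≠ 0 ∧ M ∩ U = {y ∈ U | φ y = 0}

/-- Near `p`, the set `M` is a `C^{1,α}` hypersurface with boundary and `p` is one of its boundary
points: `M` is given by `φ = 0`, `η ≥ 0`, where `φ` and `η` are `C^{1,α}` functions which vanish at
`p` and have linearly independent differentials there. -/
def IsBoundaryManifoldPoint {n : ℕ} (α : ℝ) (M : Set (Space n)) (p : Space n) : Prop :=
  ∃ U : Set (Space n), IsOpen U ∧ p ∈ U ∧ ∃ φ η : Space n → ℝ,
    IsC1Holder α φ U ∧ IsC1Holder α η U ∧ φ p = 0 ∧ η p = 0 ∧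
    LinearIndependent ℝ ![fderiv ℝ φ p, fderiv ℝ η p] ∧
    M ∩ U = {y ∈ U | φ y = 0 ∧ 0 ≤ η y}

/-- The regular set `Reg_E`: the points `x₀` of `M = closure (Ω ∩ ∂E)` such that, for some `ρ > 0`
and some `α ∈ (s, 1)`, `B_ρ(x₀) ∩ M` is a hypersurface of class `C^{1,α}`, possibly with boundary,
whose boundary (if any) is contained in `∂Ω`. -/
def regularSet {n : ℕ} (s : ℝ) (Ω E : Set (Space n)) : Set (Space n) :=
  {x₀ ∈ closure (Ω ∩ frontier E) | ∃ ρ > 0, ∃ α ∈ Ioo s 1,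
    ∀ p ∈ ball x₀ ρ ∩ closure (Ω ∩ frontier E),
      IsInteriorManifoldPoint α (closure (Ω ∩ frontier E)) p ∨
      (p ∈ frontier Ω ∧ IsBoundaryManifoldPoint α (closure (Ω ∩ frontier E)) p)}

/-! ### Blow-ups and angles -/

/-- The rescaled set `F^{x₀, r} = (F - x₀) / r` (for `r ≠ 0`). -/
def blowUp {n : ℕ} (F : Set (Space n)) (x₀ : Space n) (r : ℝ) : Set (Space n) :=
  {z | x₀ + r • z ∈ F}

/-- `F^{x₀, r} → G` in `L¹_loc(ℝⁿ)` as `r → 0⁺`. -/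
def BlowUpConverges {n : ℕ} (F : Set (Space n)) (x₀ : Space n) (G : Set (Space n)) : Prop :=
  ∀ Q : Set (Space n), IsCompact Q →
    Tendsto (fun r : ℝ => volume (symmDiff (blowUp F x₀ r) G ∩ Q)) (𝓝[>] 0) (𝓝 0)

/-- `S` is an open half-space (not necessarily with the origin on its boundary). -/
def IsOpenHalfSpace {n : ℕ} (S : Set (Space n)) : Prop :=
  ∃ p : Space n, p ≠ 0 ∧ ∃ c : ℝ, S = {x | c < ⟪p, x⟫}

/-- `J_{θ₁, θ₂}`: the points `x` with `(x₁, xₙ) = ρ (cos β, sin β)` for some `β ∈ (θ₁, θ₂)` and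
some `ρ > 0`. -/
def angularSector {n : ℕ} (hn : 2 ≤ n) (θ₁ θ₂ : ℝ) : Set (Space n) :=
  {x | ∃ β ∈ Ioo θ₁ θ₂, ∃ ρ > 0,
    x ⟨0, by omega⟩ = ρ * Real.cos β ∧ x ⟨n - 1, by omega⟩ = ρ * Real.sin β}

/-- `θ ∈ [0, π]` is the angle between the half-spaces `H` and `V`: in suitable orthonormal
coordinates, `H ∩ V = J_{0, θ}`. -/
def IsAngleBetween {n : ℕ} (hn : 2 ≤ n) (H V : Set (Space n)) (θ : ℝ) : Prop :=
  θ ∈ Icc 0 Real.pi ∧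
    ∃ R : Space n ≃ₗᵢ[ℝ] Space n, R '' (H ∩ V) = angularSector hn 0 θ

/-! ### Nonlocal mean curvature -/

/-- The `K`-mean curvature `p.v. ∫ K(x - y) (χ_{Fᶜ}(y) - χ_F(y)) dy` of `∂F` at `x` exists as a
principal value and is equal to `h`. -/
def HasNonlocalMeanCurvature {n : ℕ} (K : Space n → ℝ) (F : Set (Space n)) (x : Space n)
    (h : ℝ) : Prop :=
  (∀ ε > 0, IntegrableOn
    (fun y => K (x - y) * (Fᶜ.indicator 1 y - F.indicator 1 y)) (ball x ε)ᶜ) ∧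
  Tendsto (fun ε : ℝ => ∫ y in (ball x ε)ᶜ, K (x - y) * (Fᶜ.indicator 1 y - F.indicator 1 y))
    (𝓝[>] 0) (𝓝 h)

end Capillarity

end

open Capillarity

/-!
Criticality is used in weak form only. Fix a unit vector `a` and a test function `η` supported in
`Ω`. The map `x ↦ x + t η(x) a` has Jacobian `1 + t ∂ₐη`, so it preserves the volume of `E` for all
small `t` as soon as `∫_E ∂ₐη = 0`. Differentiating the energy along these maps gives a weak
Euler-Lagrange equation (`weak_eulerLagrange`) in which `∂ₐK(z)` is always paired with a difference
`η(x) - η(x - z)`; everything converges absolutely as long as the set of `x ∈ E` with `x - z ∉ E`,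
near the support of `η`, has measure `O(|z|)` (`CrossBound`). The volume constraint produces a
Lagrange multiplier (`energyVariation_eq_mul`).

Near the contact point `x₀`, the container is `{F > 0}` and the interface lies in `{φ = 0}`, where
`F` and `φ` are strictly differentiable at `x₀` with differentials `l, m ≠ 0` (`ContactChart`).
Blow up at points `x_j → x₀` of `{φ = 0}`, at scales `r_j → 0` with `F(x_j) / r_j → b`. The
containers converge to the half-space `H = {b + l > 0}`; by connectedness and the normalization of
`E`, along a subsequence the sets `E` converge to `H ∩ {⟪a, ·⟫ > 0}` for a unit vector `a` parallel
to `m`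
(`InterfaceSequence.exists_subseq_tendsto`). The interaction terms scale like `r ^ (n - s - 1)`, the
potential and the multiplier like `r ^ (n - 1)`, so only the former survive in the limit. For the
limit wedge the first variation can be computed explicitly: truncating the kernels at the origin and
using the divergence theorem, it is a constant multiple of the integral of `η` over `H ∩ a^⊥`
against the density `flatBalance`, which therefore vanishes (`blowUp_flatBalance_eq_zero`).

This is applied twice. If `l` were a multiple of `m`, then blowing up at interface points at the
scale `F(x_j)`, comparable to their distance to `∂Ω` (`b = 1`), would give a wedge with parallel sides; there
`flatBalance` is `±∫_{Hᶜ} K₁* + σ ∫_{Hᶜ} K₂*`, which is not zero because `|σ| K₂* < K₁*`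
(`ContactChart.exists_transversal`). Hence `l` and `m` are linearly independent. Blowing up at `x₀`
itself (`b = 0`) gives `H ∩ V = H ∩ {⟪a, ·⟫ > 0}` with `l` and `a` linearly independent, so that the
angle is neither `0` nor `π`, and the vanishing of `flatBalance` on `H ∩ ∂V` is the asserted
identity, since the contribution of `{⟪a, · - v⟫ > 0}` and of its complement to the mean curvature
cancel by symmetry (`nonlocalMeanCurvature_of_flatBalance`).
-/

noncomputable section

namespace Capillarity

/-! ### Directional kernels and truncated Riesz weights -/

/-- The weight `min(|z|, 1) |z|^{-n-s}`, which is integrable on `ℝⁿ` and dominates all the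
integrands of first variations, once the inner integral has been carried out. -/
def tameWeight {n : ℕ} (s : ℝ) (z : Space n) : ℝ := min ‖z‖ 1 * ‖z‖ ^ (-((n : ℝ) + s))

lemma tameWeight_nonneg {n : ℕ} (s : ℝ) (z : Space n) : 0 ≤ tameWeight s z := by
  unfold tameWeight; positivity

lemma nontrivial_space {n : ℕ} (hn : 2 ≤ n) : Nontrivial (Space n) := by
  have : Nonempty (Fin n) := ⟨⟨0, by omega⟩⟩
  infer_instance

lemma integrable_tameWeight {n : ℕ} (hn : 2 ≤ n) {s : ℝ} (hs : s ∈ Ioo (0 : ℝ) 1) :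
    Integrable (tameWeight (n := n) s) := by
  have := nontrivial_space hn
  have h := (MeasureTheory.integrable_fun_norm_addHaar (E := Space n) volume
    (f := fun t : ℝ => min t 1 * t ^ (-((n : ℝ) + s)))).2
  refine h ?_
  have hfin : Module.finrank ℝ (Space n) = n := by simp
  rw [hfin]
  have hsplit : (Ioi (0 : ℝ)) = Ioc 0 1 ∪ Ioi 1 := by
    rw [Ioc_union_Ioi_eq_Ioi]; norm_num
  rw [hsplit]
  have key : ∀ t : ℝ, 0 < t → t ^ (n - 1) * t ^ (-((n : ℝ) + s)) = t ^ (-1 - s) := by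
    intro t ht
    rw [← Real.rpow_natCast, ← Real.rpow_add ht]
    congr 1
    rw [Nat.cast_sub (by omega)]; push_cast; ring
  refine IntegrableOn.union ?_ ?_
  · have h1 : IntegrableOn (fun t : ℝ => t ^ (-s)) (Ioc 0 1) := by
      have := (intervalIntegral.intervalIntegrable_rpow' (a := 0) (b := 1) (r := -s)
        (by linarith [hs.2]))
      rwa [intervalIntegrable_iff_integrableOn_Ioc_of_le zero_le_one] at this
    refine h1.congr_fun (fun t ht => ?_) measurableSet_Ioc
    have : min t 1 = t := min_eq_left ht.2
    simp only [this, smul_eq_mul]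
    rw [mul_left_comm, key t ht.1]
    nth_rewrite 2 [← Real.rpow_one t]
    rw [← Real.rpow_add ht.1]; congr 1; ring
  · have h1 : IntegrableOn (fun t : ℝ => t ^ (-1 - s)) (Ioi 1) :=
      integrableOn_Ioi_rpow_of_lt (by linarith [hs.1]) one_pos
    refine h1.congr_fun (fun t ht => ?_) measurableSet_Ioi
    have ht' : (1 : ℝ) < t := ht
    have : min t 1 = 1 := min_eq_right ht'.le
    simp only [this, smul_eq_mul, one_mul]
    rw [key t (by linarith)]

/-- A kernel `k` of order `-n-s` together with its derivative `k'` in the direction `a`: the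
regularity of the kernels, of their rescalings, of their blow-up limits and of their truncations
which is used for first variations along vector fields parallel to `a`. -/
structure KernelPair {n : ℕ} (s C : ℝ) (a : Space n) (k k' : Space n → ℝ) : Prop where
  even : ∀ z, k (-z) = k z
  bound : ∀ z, z ≠ 0 → |k z| ≤ C * ‖z‖ ^ (-((n : ℝ) + s))
  bound' : ∀ z, z ≠ 0 → |k' z| ≤ C * ‖z‖ ^ (-((n : ℝ) + s) - 1)
  deriv : ∀ z, z ≠ 0 → HasDerivAt (fun t : ℝ => k (z + t • a)) (k' z) 0
  cont : ContinuousOn k {0}ᶜ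
  cont' : ContinuousOn k' {0}ᶜ

lemma measurable_of_continuousOn_compl_zero {n : ℕ} {k : Space n → ℝ}
    (hk : ContinuousOn k {0}ᶜ) : Measurable k :=
  measurable_of_continuousOn_compl_singleton 0 hk

namespace KernelPair

variable {n : ℕ} {s C : ℝ} {a : Space n} {k k' : Space n → ℝ}

lemma deriv_line (h : KernelPair s C a k k') (z : Space n) (t : ℝ) (hz : z + t • a ≠ 0) :
    HasDerivAt (fun τ : ℝ => k (z + τ • a)) (k' (z + t • a)) t := by
  have h1 : HasDerivAt (fun τ : ℝ => k (z + t • a + τ • a)) (k' (z + t • a)) (t - t) := by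
    simpa using h.deriv _ hz
  have h2 := h1.comp_sub_const t t
  refine h2.congr_of_eventuallyEq (Eventually.of_forall fun τ => ?_)
  simp only [add_assoc, ← add_smul, add_sub_cancel]

lemma constant_nonneg (hn : 2 ≤ n) (h : KernelPair s C a k k') : 0 ≤ C := by
  have := nontrivial_space hn
  obtain ⟨z, hz⟩ := exists_ne (0 : Space n)
  have h1 := (abs_nonneg _).trans (h.bound z hz)
  have h2 : 0 < ‖z‖ ^ (-((n : ℝ) + s)) := Real.rpow_pos_of_pos (norm_pos_iff.2 hz) _
  exact nonneg_of_mul_nonneg_left h1 h2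

end KernelPair

/-! ### The first variation as an integral over displacements -/

/-- Pairs `(z, x)` such that `x ∈ A` and `x - z ∈ B`: the pairs of points of `A × B`, parametrized
by the displacement `z` and the first point `x`. -/
def crossPairs {n : ℕ} (A B : Set (Space n)) : Set (Space n × Space n) :=
  {p | p.2 ∈ A ∧ p.2 - p.1 ∈ B}

/-- The integrand, in the variables `(z, x) = (x - y, x)`, of the first variation of the interaction
`∫_A ∫_B k(x - y)` along the vector field `η a`. Here `k'` and `η'` are the derivatives of `k` and
`η` in the direction `a`. -/
def variationIntegrand {n : ℕ} (k k' η η' : Space n → ℝ) (p : Space n × Space n) : ℝ :=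
  k' p.1 * (η p.2 - η (p.2 - p.1)) + k p.1 * (η' p.2 + η' (p.2 - p.1))

/-- The first variation of the interaction `∫_A ∫_B k(x - y)` along the vector field `η a`. -/
def interactionVariation {n : ℕ} (k k' : Space n → ℝ) (A B : Set (Space n)) (η η' : Space n → ℝ) :
    ℝ :=
  ∫ p : Space n × Space n, (crossPairs A B).indicator (variationIntegrand k k' η η') p

/-- `A` and `B` are separated, near `S`, by an interface of locally finite area: the set of points
of `A` near `S` which the translation by `-z` takes into `B` has measure at most `M min(|z|, 1)`. -/
def CrossBound {n : ℕ} (A B S : Set (Space n)) (M : ℝ) : Prop :=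
  ∀ z : Space n, volume {x | x ∈ A ∧ x - z ∈ B ∧ (x ∈ S ∨ x - z ∈ S)} ≤
    ENNReal.ofReal (M * min ‖z‖ 1)

/-- A compactly supported `C¹` profile `η` with its derivative `η'` in the direction `a`, both
vanishing outside the compact set `S`. -/
structure Profile {n : ℕ} (a : Space n) (S : Set (Space n)) (L : ℝ) (η η' : Space n → ℝ) : Prop where
  compact : IsCompact S
  cont : Continuous η
  cont' : Continuous η'
  zero : ∀ x, x ∉ S → η x = 0
  zero' : ∀ x, x ∉ S → η' x = 0
  lip : ∀ x y, |η x - η y| ≤ L * ‖x - y‖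
  bound' : ∀ x, |η' x| ≤ L
  deriv : ∀ x, HasDerivAt (fun t : ℝ => η (x + t • a)) (η' x) 0

section variation

variable {n : ℕ} {s C M L : ℝ} {a : Space n} {k k' η η' : Space n → ℝ} {A B S : Set (Space n)}

lemma Profile.lip_nonneg (hη : Profile a S L η η') : 0 ≤ L :=
  (abs_nonneg _).trans (hη.bound' 0)

lemma measurableSet_crossPairs (hA : MeasurableSet A) (hB : MeasurableSet B) :
    MeasurableSet (crossPairs A B) :=
  (measurable_snd hA).inter ((measurable_snd.sub measurable_fst) hB)

lemma measurable_variationIntegrand (hk : Measurable k) (hk' : Measurable k')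
    (hη : Measurable η) (hη' : Measurable η') :
    Measurable (variationIntegrand k k' η η') := by
  unfold variationIntegrand
  fun_prop

/-- Points where the integrand of the first variation does not vanish are pairs for which one of the
two points belongs to the support of the profile. -/
lemma variationIntegrand_eq_zero (hη : Profile a S L η η') {p : Space n × Space n}
    (hp : p.2 ∉ S) (hp' : p.2 - p.1 ∉ S) : variationIntegrand k k' η η' p = 0 := by
  simp [variationIntegrand, hη.zero _ hp, hη.zero _ hp', hη.zero' _ hp, hη.zero' _ hp']

lemma abs_variationIntegrand_le (hn : 2 ≤ n) (hk : KernelPair s C a k k')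
    (hη : Profile a S L η η') {p : Space n × Space n} (hp : p.1 ≠ 0) :
    |variationIntegrand k k' η η' p| ≤ 3 * C * L * ‖p.1‖ ^ (-((n : ℝ) + s)) := by
  have hC := hk.constant_nonneg hn
  have hL := hη.lip_nonneg
  have hpos : 0 < ‖p.1‖ := norm_pos_iff.2 hp
  have e1 := hk.bound' _ hp
  have e2 := hk.bound _ hp
  have e3 : |η p.2 - η (p.2 - p.1)| ≤ L * ‖p.1‖ := by simpa using hη.lip p.2 (p.2 - p.1)
  have e4 : |η' p.2 + η' (p.2 - p.1)| ≤ L + L :=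
    (abs_add_le _ _).trans (add_le_add (hη.bound' _) (hη.bound' _))
  have e5 : ‖p.1‖ ^ (-((n : ℝ) + s) - 1) * ‖p.1‖ = ‖p.1‖ ^ (-((n : ℝ) + s)) := by
    rw [Real.rpow_sub_one hpos.ne']; field_simp
  calc |variationIntegrand k k' η η' p|
      ≤ |k' p.1| * |η p.2 - η (p.2 - p.1)| + |k p.1| * |η' p.2 + η' (p.2 - p.1)| := by
        unfold variationIntegrand
        rw [← abs_mul, ← abs_mul]; exact abs_add_le _ _
    _ ≤ (C * ‖p.1‖ ^ (-((n : ℝ) + s) - 1)) * (L * ‖p.1‖)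
        + (C * ‖p.1‖ ^ (-((n : ℝ) + s))) * (L + L) := by gcongr
    _ = C * L * (‖p.1‖ ^ (-((n : ℝ) + s) - 1) * ‖p.1‖)
        + 2 * C * L * ‖p.1‖ ^ (-((n : ℝ) + s)) := by ring
    _ = _ := by rw [e5]; ring

/-- The singular weight of a pair is integrable over the pairs which are close to `S`. -/
lemma lintegral_crossPairs_weight_lt_top (hn : 2 ≤ n) (hs : s ∈ Ioo (0 : ℝ) 1)
    (hA : MeasurableSet A) (hB : MeasurableSet B) (hS : MeasurableSet S) (hM : CrossBound A B S M) :
    ∫⁻ p : Space n × Space n, (crossPairs A B ∩ {p | p.2 ∈ S ∨ p.2 - p.1 ∈ S}).indicator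
      (fun p => ENNReal.ofReal (‖p.1‖ ^ (-((n : ℝ) + s)))) p < ⊤ := by
  have hS' : MeasurableSet {p : Space n × Space n | p.2 ∈ S ∨ p.2 - p.1 ∈ S} :=
    (measurable_snd hS).union ((measurable_snd.sub measurable_fst) hS)
  have hmeas := (measurableSet_crossPairs hA hB).inter hS'
  have hf : Measurable (fun p : Space n × Space n => ENNReal.ofReal (‖p.1‖ ^ (-((n : ℝ) + s)))) := by
    fun_prop
  rw [Measure.volume_eq_prod, lintegral_prod _ (hf.indicator hmeas).aemeasurable]
  have hle : ∀ z : Space n, ∫⁻ x, (crossPairs A B ∩ {p | p.2 ∈ S ∨ p.2 - p.1 ∈ S}).indicator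
      (fun p => ENNReal.ofReal (‖p.1‖ ^ (-((n : ℝ) + s)))) (z, x) ≤
      ENNReal.ofReal (|M| * tameWeight s z) := by
    intro z
    have hT : MeasurableSet {x | x ∈ A ∧ x - z ∈ B ∧ (x ∈ S ∨ x - z ∈ S)} := by
      have : Measurable fun x : Space n => x - z := by fun_prop
      exact hA.inter ((this hB).inter (hS.union (this hS)))
    calc _ = ∫⁻ x, {x | x ∈ A ∧ x - z ∈ B ∧ (x ∈ S ∨ x - z ∈ S)}.indicator
            (fun _ => ENNReal.ofReal (‖z‖ ^ (-((n : ℝ) + s)))) x := by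
          refine lintegral_congr fun x => ?_
          have hiff : (z, x) ∈ crossPairs A B ∩ {p | p.2 ∈ S ∨ p.2 - p.1 ∈ S} ↔
              x ∈ {x | x ∈ A ∧ x - z ∈ B ∧ (x ∈ S ∨ x - z ∈ S)} :=
            ⟨fun h => ⟨h.1.1, h.1.2, h.2⟩, fun h => ⟨⟨h.1, h.2.1⟩, h.2.2⟩⟩
          by_cases hx : x ∈ {x | x ∈ A ∧ x - z ∈ B ∧ (x ∈ S ∨ x - z ∈ S)}
          · rw [indicator_of_mem hx, indicator_of_mem (hiff.2 hx)]
          · rw [indicator_of_notMem hx, indicator_of_notMem (mt hiff.1 hx)]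
      _ = ENNReal.ofReal (‖z‖ ^ (-((n : ℝ) + s))) *
            volume {x | x ∈ A ∧ x - z ∈ B ∧ (x ∈ S ∨ x - z ∈ S)} := by
          rw [lintegral_indicator_const hT]
      _ ≤ ENNReal.ofReal (‖z‖ ^ (-((n : ℝ) + s))) * ENNReal.ofReal (|M| * min ‖z‖ 1) := by
          gcongr
          refine (hM z).trans (ENNReal.ofReal_le_ofReal ?_)
          gcongr
          exact le_abs_self M
      _ = _ := by
          rw [← ENNReal.ofReal_mul (by positivity)]
          congr 1; unfold tameWeight; ring
  refine (lintegral_mono hle).trans_lt ?_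
  have hint := (integrable_tameWeight hn hs).const_mul |M|
  rw [← ofReal_integral_eq_lintegral_ofReal hint
    (ae_of_all _ fun z => mul_nonneg (abs_nonneg _) (tameWeight_nonneg s z))]
  exact ENNReal.ofReal_lt_top

lemma ae_fst_ne_zero (hn : 2 ≤ n) : ∀ᵐ p : Space n × Space n, p.1 ≠ 0 := by
  have := nontrivial_space hn
  have : ∀ᵐ z : Space n, z ≠ 0 := by simp [ae_iff]
  rw [Measure.volume_eq_prod]
  exact Measure.quasiMeasurePreserving_fst.ae this

lemma integrable_variationIntegrand (hn : 2 ≤ n) (hs : s ∈ Ioo (0 : ℝ) 1)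
    (hk : KernelPair s C a k k') (hη : Profile a S L η η') (hA : MeasurableSet A)
    (hB : MeasurableSet B) (hM : CrossBound A B S M) :
    Integrable ((crossPairs A B).indicator (variationIntegrand k k' η η')) := by
  have hS := hη.compact.isClosed.measurableSet
  have hS' : MeasurableSet {p : Space n × Space n | p.2 ∈ S ∨ p.2 - p.1 ∈ S} :=
    (measurable_snd hS).union ((measurable_snd.sub measurable_fst) hS)
  have hmeas := (measurableSet_crossPairs hA hB).inter hS'
  have hw : Integrable (fun p : Space n × Space n =>
      (crossPairs A B ∩ {p | p.2 ∈ S ∨ p.2 - p.1 ∈ S}).indicator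
        (fun p => ‖p.1‖ ^ (-((n : ℝ) + s))) p) := by
    refine ⟨((by fun_prop : Measurable fun p : Space n × Space n =>
      ‖p.1‖ ^ (-((n : ℝ) + s))).indicator hmeas).aestronglyMeasurable, ?_⟩
    rw [hasFiniteIntegral_iff_enorm]
    refine lt_of_le_of_lt (lintegral_mono fun p => ?_)
      (lintegral_crossPairs_weight_lt_top hn hs hA hB hS hM)
    simp only
    by_cases hp : p ∈ crossPairs A B ∩ {p | p.2 ∈ S ∨ p.2 - p.1 ∈ S}
    · rw [indicator_of_mem hp, indicator_of_mem hp, Real.enorm_of_nonneg (by positivity)]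
    · rw [indicator_of_notMem hp, indicator_of_notMem hp]; simp
  refine (hw.const_mul (3 * C * L)).mono' ?_ ?_
  · exact ((measurable_variationIntegrand (measurable_of_continuousOn_compl_zero hk.cont)
      (measurable_of_continuousOn_compl_zero hk.cont') hη.cont.measurable
      hη.cont'.measurable).indicator (measurableSet_crossPairs hA hB)).aestronglyMeasurable
  · filter_upwards [ae_fst_ne_zero hn] with p hp
    by_cases h1 : p ∈ crossPairs A B
    · by_cases h2 : p ∈ {p : Space n × Space n | p.2 ∈ S ∨ p.2 - p.1 ∈ S}
      · have h3 : p ∈ crossPairs A B ∩ {p | p.2 ∈ S ∨ p.2 - p.1 ∈ S} := ⟨h1, h2⟩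
        rw [indicator_of_mem h1, indicator_of_mem h3]
        exact abs_variationIntegrand_le hn hk hη hp
      · rw [indicator_of_mem h1, indicator_of_notMem fun h => h2 h.2]
        simp only [mem_ofPred_eq, not_or] at h2
        rw [variationIntegrand_eq_zero hη h2.1 h2.2]; simp
    · rw [indicator_of_notMem h1, indicator_of_notMem fun h => h1 h.1]; simp

end variation

/-! ### Convergence and scaling of first variations -/

section limits

variable {n : ℕ} {s C M L : ℝ} {a : Space n} {η η' : Space n → ℝ} {S : Set (Space n)}

lemma ae_sub_of_ae {p : Space n → Prop} (h : ∀ᵐ x, p x) (z : Space n) : ∀ᵐ x, p (x - z) :=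
  (measurePreserving_sub_right volume z).quasiMeasurePreserving.ae h

/-- Interface bounds pass to almost everywhere limits, by Fatou's lemma. -/
lemma CrossBound.of_tendsto {A B : ℕ → Set (Space n)} {A₀ B₀ : Set (Space n)}
    (hA : ∀ j, MeasurableSet (A j)) (hB : ∀ j, MeasurableSet (B j)) (hS : MeasurableSet S)
    (hA₀ : MeasurableSet A₀) (hB₀ : MeasurableSet B₀)
    (hAl : ∀ᵐ x, ∀ᶠ j in atTop, (x ∈ A j ↔ x ∈ A₀))
    (hBl : ∀ᵐ x, ∀ᶠ j in atTop, (x ∈ B j ↔ x ∈ B₀))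
    (hM : ∀ᶠ j in atTop, CrossBound (A j) (B j) S M) : CrossBound A₀ B₀ S M := by
  intro z
  have hT : ∀ {A B : Set (Space n)}, MeasurableSet A → MeasurableSet B →
      MeasurableSet {x | x ∈ A ∧ x - z ∈ B ∧ (x ∈ S ∨ x - z ∈ S)} := by
    intro A B hA hB
    have : Measurable fun x : Space n => x - z := by fun_prop
    exact hA.inter ((this hB).inter (hS.union (this hS)))
  rw [← lintegral_indicator_one (hT hA₀ hB₀)]
  calc ∫⁻ x, {x | x ∈ A₀ ∧ x - z ∈ B₀ ∧ (x ∈ S ∨ x - z ∈ S)}.indicator 1 x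
      ≤ ∫⁻ x, liminf (fun j => {x | x ∈ A j ∧ x - z ∈ B j ∧ (x ∈ S ∨ x - z ∈ S)}.indicator
          (1 : Space n → ℝ≥0∞) x) atTop := by
        refine lintegral_mono_ae ?_
        filter_upwards [hAl, ae_sub_of_ae hBl z] with x h1 h2
        refine le_liminf_of_le ?_ ?_
        · isBoundedDefault
        filter_upwards [h1, h2] with j h3 h4
        by_cases hx : x ∈ {x | x ∈ A₀ ∧ x - z ∈ B₀ ∧ (x ∈ S ∨ x - z ∈ S)}
        · have hx' : x ∈ {x | x ∈ A j ∧ x - z ∈ B j ∧ (x ∈ S ∨ x - z ∈ S)} :=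
            ⟨h3.2 hx.1, h4.2 hx.2.1, hx.2.2⟩
          rw [indicator_of_mem hx, indicator_of_mem hx']
        · rw [indicator_of_notMem hx]; exact zero_le
    _ ≤ liminf (fun j => ∫⁻ x, {x | x ∈ A j ∧ x - z ∈ B j ∧ (x ∈ S ∨ x - z ∈ S)}.indicator
          (1 : Space n → ℝ≥0∞) x) atTop :=
        lintegral_liminf_le fun j => measurable_one.indicator (hT (hA j) (hB j))
    _ ≤ ENNReal.ofReal (M * min ‖z‖ 1) := by
        refine liminf_le_of_frequently_le ?_ ?_
        · refine Eventually.frequently ?_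
          filter_upwards [hM] with j hj
          rw [lintegral_indicator_one (hT (hA j) (hB j))]
          exact hj z
        · isBoundedDefault

lemma interactionVariation_eq_iterated (hn : 2 ≤ n) (hs : s ∈ Ioo (0 : ℝ) 1)
    {k k' : Space n → ℝ} {A B : Set (Space n)}
    (hk : KernelPair s C a k k') (hη : Profile a S L η η') (hA : MeasurableSet A)
    (hB : MeasurableSet B) (hM : CrossBound A B S M) :
    interactionVariation k k' A B η η' =
      ∫ z, ∫ x, (crossPairs A B).indicator (variationIntegrand k k' η η') (z, x) := by
  have h := integrable_variationIntegrand hn hs hk hη hA hB hM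
  unfold interactionVariation
  rw [Measure.volume_eq_prod] at h ⊢
  exact integral_prod _ h

/-- The inner integral, over the points whose displacement is `z`, is controlled by the weight. -/
lemma norm_inner_variation_le (hn : 2 ≤ n) {k k' : Space n → ℝ} {A B : Set (Space n)}
    (hk : KernelPair s C a k k') (hη : Profile a S L η η') (hA : MeasurableSet A)
    (hB : MeasurableSet B) (hM : CrossBound A B S M) {z : Space n} (hz : z ≠ 0) :
    ‖∫ x, (crossPairs A B).indicator (variationIntegrand k k' η η') (z, x)‖ ≤
      3 * C * L * |M| * tameWeight s z := by
  have hS := hη.compact.isClosed.measurableSet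
  have hC := hk.constant_nonneg hn
  have hL := hη.lip_nonneg
  set T := {x | x ∈ A ∧ x - z ∈ B ∧ (x ∈ S ∨ x - z ∈ S)} with hTdef
  have hT : MeasurableSet T := by
    have : Measurable fun x : Space n => x - z := by fun_prop
    exact hA.inter ((this hB).inter (hS.union (this hS)))
  have hvol : volume T ≤ ENNReal.ofReal (|M| * min ‖z‖ 1) :=
    (hM z).trans (ENNReal.ofReal_le_ofReal (by gcongr; exact le_abs_self M))
  have heq : (fun x => (crossPairs A B).indicator (variationIntegrand k k' η η') (z, x)) =
      T.indicator (fun x => variationIntegrand k k' η η' (z, x)) := by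
    funext x
    by_cases hx : (z, x) ∈ crossPairs A B
    · by_cases hx' : x ∈ S ∨ x - z ∈ S
      · have : x ∈ T := ⟨hx.1, hx.2, hx'⟩
        rw [indicator_of_mem hx, indicator_of_mem this]
      · have : x ∉ T := fun h => hx' h.2.2
        rw [indicator_of_mem hx, indicator_of_notMem this]
        exact variationIntegrand_eq_zero hη (fun h => hx' (Or.inl h)) (fun h => hx' (Or.inr h))
    · have : x ∉ T := fun h => hx ⟨h.1, h.2.1⟩
      rw [indicator_of_notMem hx, indicator_of_notMem this]
  rw [heq, integral_indicator hT]
  refine (norm_setIntegral_le_of_norm_le_const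
    (C := 3 * C * L * ‖z‖ ^ (-((n : ℝ) + s))) (hvol.trans_lt ENNReal.ofReal_lt_top)
    (fun x _ => abs_variationIntegrand_le hn hk hη (p := (z, x)) hz)).trans ?_
  have : volume.real T ≤ |M| * min ‖z‖ 1 :=
    ENNReal.toReal_le_of_le_ofReal (by positivity) hvol
  calc 3 * C * L * ‖z‖ ^ (-((n : ℝ) + s)) * volume.real T
      ≤ 3 * C * L * ‖z‖ ^ (-((n : ℝ) + s)) * (|M| * min ‖z‖ 1) := by gcongr
    _ = _ := by unfold tameWeight; ring

/-- First variations converge if the sets converge almost everywhere, with uniform interface bounds,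
and the kernels converge pointwise, with uniform bounds. -/
theorem tendsto_interactionVariation (hn : 2 ≤ n) (hs : s ∈ Ioo (0 : ℝ) 1)
    {k k' : ℕ → Space n → ℝ} {k₀ k₀' : Space n → ℝ} {A B : ℕ → Set (Space n)}
    {A₀ B₀ : Set (Space n)} (hk : ∀ j, KernelPair s C a (k j) (k' j))
    (hk₀ : KernelPair s C a k₀ k₀')
    (hkl : ∀ z, z ≠ 0 → Tendsto (fun j => k j z) atTop (𝓝 (k₀ z)))
    (hkl' : ∀ z, z ≠ 0 → Tendsto (fun j => k' j z) atTop (𝓝 (k₀' z)))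
    (hη : Profile a S L η η')
    (hA : ∀ j, MeasurableSet (A j)) (hB : ∀ j, MeasurableSet (B j))
    (hA₀ : MeasurableSet A₀) (hB₀ : MeasurableSet B₀)
    (hAl : ∀ᵐ x, ∀ᶠ j in atTop, (x ∈ A j ↔ x ∈ A₀))
    (hBl : ∀ᵐ x, ∀ᶠ j in atTop, (x ∈ B j ↔ x ∈ B₀))
    (hM : ∀ᶠ j in atTop, CrossBound (A j) (B j) S M) :
    Tendsto (fun j => interactionVariation (k j) (k' j) (A j) (B j) η η') atTop
      (𝓝 (interactionVariation k₀ k₀' A₀ B₀ η η')) := by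
  have := nontrivial_space hn
  have hz0 : ∀ᵐ z : Space n, z ≠ 0 := by simp [ae_iff]
  have hS := hη.compact.isClosed.measurableSet
  have hM₀ : CrossBound A₀ B₀ S M := CrossBound.of_tendsto hA hB hS hA₀ hB₀ hAl hBl hM
  rw [interactionVariation_eq_iterated hn hs hk₀ hη hA₀ hB₀ hM₀]
  refine Tendsto.congr' (f₁ := fun j => ∫ z, ∫ x, (crossPairs (A j) (B j)).indicator
    (variationIntegrand (k j) (k' j) η η') (z, x)) ?_ ?_
  · filter_upwards [hM] with j hj
    exact (interactionVariation_eq_iterated hn hs (hk j) hη (hA j) (hB j) hj).symm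
  refine tendsto_integral_filter_of_dominated_convergence
    (fun z => 3 * C * L * |M| * tameWeight s z) ?_ ?_
    ((integrable_tameWeight hn hs).const_mul _) ?_
  · filter_upwards [hM] with j hj
    have h := integrable_variationIntegrand hn hs (hk j) hη (hA j) (hB j) hj
    rw [Measure.volume_eq_prod] at h
    exact h.integral_prod_left.aestronglyMeasurable
  · filter_upwards [hM] with j hj
    filter_upwards [hz0] with z hz
    exact norm_inner_variation_le hn (hk j) hη (hA j) (hB j) hj hz
  filter_upwards [hz0] with z hz
  have hcomp : IsCompact (S ∪ (fun y => y + z) '' S) :=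
    hη.compact.union (hη.compact.image (by fun_prop))
  refine tendsto_integral_filter_of_dominated_convergence
    ((S ∪ (fun y => y + z) '' S).indicator
      (fun _ => 3 * C * L * ‖z‖ ^ (-((n : ℝ) + s)))) ?_ ?_ ?_ ?_
  · refine Eventually.of_forall fun j => ?_
    have hm : Measurable ((crossPairs (A j) (B j)).indicator
        (variationIntegrand (k j) (k' j) η η')) :=
      (measurable_variationIntegrand (measurable_of_continuousOn_compl_zero (hk j).cont)
        (measurable_of_continuousOn_compl_zero (hk j).cont') hη.cont.measurable
        hη.cont'.measurable).indicator (measurableSet_crossPairs (hA j) (hB j))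
    exact (hm.comp measurable_prodMk_left).aestronglyMeasurable
  · refine Eventually.of_forall fun j => Eventually.of_forall fun x => ?_
    by_cases hx : x ∈ S ∪ (fun y => y + z) '' S
    · rw [indicator_of_mem hx]
      refine (norm_indicator_le_norm_self _ _).trans ?_
      exact abs_variationIntegrand_le hn (hk j) hη (p := (z, x)) hz
    · rw [indicator_of_notMem hx]
      have h1 : x ∉ S := fun h => hx (Or.inl h)
      have h2 : x - z ∉ S := fun h => hx (Or.inr ⟨x - z, h, by simp⟩)
      refine (norm_indicator_le_norm_self _ _).trans ?_
      rw [variationIntegrand_eq_zero hη (p := (z, x)) h1 h2]; simp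
  · rw [integrable_indicator_iff hcomp.isClosed.measurableSet]
    exact integrableOn_const hcomp.measure_lt_top.ne
  · filter_upwards [hAl, ae_sub_of_ae hBl z] with x h1 h2
    have hlim : Tendsto (fun j => variationIntegrand (k j) (k' j) η η' (z, x)) atTop
        (𝓝 (variationIntegrand k₀ k₀' η η' (z, x))) :=
      ((hkl' z hz).mul_const _).add ((hkl z hz).mul_const _)
    by_cases hx : (z, x) ∈ crossPairs A₀ B₀
    · rw [indicator_of_mem hx]
      refine hlim.congr' ?_
      filter_upwards [h1, h2] with j h3 h4
      have : (z, x) ∈ crossPairs (A j) (B j) := ⟨h3.2 hx.1, h4.2 hx.2⟩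
      rw [indicator_of_mem this]
    · rw [indicator_of_notMem hx]
      refine tendsto_const_nhds.congr' ?_
      filter_upwards [h1, h2] with j h3 h4
      have : (z, x) ∉ crossPairs (A j) (B j) := fun h => hx ⟨h3.1 h.1, h4.1 h.2⟩
      rw [indicator_of_notMem this]

/-- Rescaling the profile by `r` amounts to rescaling the kernel and blowing up the sets. -/
lemma interactionVariation_rescale {k k' : Space n → ℝ} {A B : Set (Space n)} (x₀ : Space n)
    {r : ℝ} (hr : 0 < r) :
    interactionVariation k k' A B (fun x => η (r⁻¹ • (x - x₀))) (fun x => r⁻¹ * η' (r⁻¹ • (x - x₀)))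
      = r ^ ((n : ℝ) - s - 1) * interactionVariation (fun z => r ^ ((n : ℝ) + s) * k (r • z))
        (fun z => r ^ ((n : ℝ) + s + 1) * k' (r • z)) (blowUp A x₀ r) (blowUp B x₀ r) η η' := by
  have : (volume : Measure (Space n × Space n)).IsAddHaarMeasure := by
    rw [Measure.volume_eq_prod]; infer_instance
  unfold interactionVariation
  set F := (crossPairs A B).indicator (variationIntegrand k k' (fun x => η (r⁻¹ • (x - x₀)))
    (fun x => r⁻¹ * η' (r⁻¹ • (x - x₀)))) with hF
  have e1 : ∫ p, F p = r ^ (2 * n) * ∫ p, F (r • p + (0, x₀)) := by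
    have h1 : ∫ p, F p = ∫ p, F (p + (0, x₀)) := (integral_add_right_eq_self F _).symm
    have h2 := Measure.integral_comp_smul (volume : Measure (Space n × Space n))
      (fun p => F (p + (0, x₀))) r
    rw [h2, h1]
    have : Module.finrank ℝ (Space n × Space n) = 2 * n := by simp; ring
    rw [this, abs_of_pos (by positivity), smul_eq_mul, mul_inv_cancel_left₀ (by positivity)]
  have e2 : ∀ p, F (r • p + (0, x₀)) = r ^ (-((n : ℝ) + s + 1)) *
      (crossPairs (blowUp A x₀ r) (blowUp B x₀ r)).indicator
        (variationIntegrand (fun z => r ^ ((n : ℝ) + s) * k (r • z))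
        (fun z => r ^ ((n : ℝ) + s + 1) * k' (r • z)) η η') p := by
    intro p
    have hz : r • p.2 + x₀ - r • p.1 = x₀ + r • (p.2 - p.1) := by rw [smul_sub]; abel
    have hiff : r • p + (0, x₀) ∈ crossPairs A B ↔
        p ∈ crossPairs (blowUp A x₀ r) (blowUp B x₀ r) := by
      simp only [crossPairs, blowUp, mem_ofPred_eq, Prod.snd_add, Prod.smul_snd, Prod.fst_add,
        Prod.smul_fst, add_zero]
      rw [hz, add_comm]
    by_cases hp : p ∈ crossPairs (blowUp A x₀ r) (blowUp B x₀ r)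
    · rw [hF, indicator_of_mem hp, indicator_of_mem (hiff.2 hp)]
      simp only [variationIntegrand, Prod.snd_add, Prod.smul_snd, Prod.fst_add,
        Prod.smul_fst, add_zero, hz, add_sub_cancel_right, add_sub_cancel_left,
        inv_smul_smul₀ hr.ne']
      have h3 : r ^ (-((n : ℝ) + s + 1)) * r ^ ((n : ℝ) + s + 1) = 1 := by
        rw [← Real.rpow_add hr, neg_add_cancel, Real.rpow_zero]
      have h4 : r ^ (-((n : ℝ) + s + 1)) * r ^ ((n : ℝ) + s) = r⁻¹ := by
        rw [← Real.rpow_add hr, ← Real.rpow_neg_one]; congr 1; ring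
      linear_combination (-(k' (r • p.1) * (η p.2 - η (p.2 - p.1)))) * h3
        - (k (r • p.1) * (η' p.2 + η' (p.2 - p.1))) * h4
    · rw [hF, indicator_of_notMem hp, indicator_of_notMem (mt hiff.1 hp), mul_zero]
  rw [e1]
  simp_rw [e2]
  rw [integral_const_mul, ← mul_assoc]
  congr 1
  rw [← Real.rpow_natCast, ← Real.rpow_add hr]
  congr 1
  push_cast; ring

end limits

/-! ### First variation of the energy along a field of constant direction -/

/-- The derivative of `η` in the direction `a`. -/
def dirDeriv {n : ℕ} (a : Space n) (η : Space n → ℝ) (x : Space n) : ℝ := fderiv ℝ η x a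

/-- The deformation `x ↦ x + t η(x) a`. Its direction is constant, so that its Jacobian
`1 + t ∂ₐη` is affine in `t`. -/
def shear {n : ℕ} (a : Space n) (η : Space n → ℝ) (t : ℝ) (x : Space n) : Space n :=
  x + (t * η x) • a

section shear

variable {n : ℕ} {s C M L : ℝ} {a : Space n} {η : Space n → ℝ} {A B S : Set (Space n)}

lemma dirDeriv_hasDerivAt (hη : Differentiable ℝ η) (x : Space n) :
    HasDerivAt (fun t : ℝ => η (x + t • a)) (dirDeriv a η x) 0 := by
  have h1 : HasFDerivAt η (fderiv ℝ η x) (x + (0 : ℝ) • a) := by simpa using (hη x).hasFDerivAt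
  have h2 : HasDerivAt (fun t : ℝ => x + t • a) ((1 : ℝ) • a) 0 :=
    ((hasDerivAt_id (0 : ℝ)).smul_const a).const_add x
  have := h1.comp_hasDerivAt (0 : ℝ) h2
  simpa [dirDeriv, Function.comp_def] using this

lemma exists_profile (ha : ‖a‖ = 1) (hη : ContDiff ℝ ∞ η) (hc : HasCompactSupport η)
    (hS : IsCompact S) (hηS : tsupport η ⊆ S) : ∃ L, Profile a S L η (dirDeriv a η) := by
  have h1 : ContDiff ℝ 1 η := hη.of_le (by exact_mod_cast le_top)
  obtain ⟨L, hL⟩ := h1.lipschitzWith_of_hasCompactSupport hc one_ne_zero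
  refine ⟨L, hS, hη.continuous, ?_, ?_, ?_, ?_, ?_, ?_⟩
  · exact (h1.continuous_fderiv one_ne_zero).clm_apply continuous_const
  · intro x hx
    exact image_eq_zero_of_notMem_tsupport fun h => hx (hηS h)
  · intro x hx
    have : fderiv ℝ η x = 0 := by
      refine image_eq_zero_of_notMem_tsupport fun h => hx (hηS ?_)
      exact tsupport_fderiv_subset ℝ h
    simp [dirDeriv, this]
  · intro x y
    have := hL.dist_le_mul x y
    rwa [dist_eq_norm, dist_eq_norm] at this
  · intro x
    refine ((fderiv ℝ η x).le_opNorm a).trans ?_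
    rw [ha, mul_one]
    exact norm_fderiv_le_of_lipschitz ℝ hL
  · exact fun x => dirDeriv_hasDerivAt (h1.differentiable one_ne_zero) x

lemma shear_sub (t : ℝ) (x y : Space n) :
    shear a η t x - shear a η t y = (x - y) + (t * (η x - η y)) • a := by
  unfold shear; rw [mul_sub, sub_smul]; abel

lemma half_norm_le_norm_shear_sub (ha : ‖a‖ = 1) {η' : Space n → ℝ} (hη : Profile a S L η η')
    {t : ℝ} (ht : |t| * L ≤ 1 / 2) (x y : Space n) :
    ‖x - y‖ / 2 ≤ ‖shear a η t x - shear a η t y‖ := by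
  rw [shear_sub]
  have h1 : ‖(t * (η x - η y)) • a‖ ≤ ‖x - y‖ / 2 := by
    rw [norm_smul, ha, mul_one, Real.norm_eq_abs, abs_mul]
    calc |t| * |η x - η y| ≤ |t| * (L * ‖x - y‖) := by gcongr; exact hη.lip x y
      _ = |t| * L * ‖x - y‖ := by ring
      _ ≤ 1 / 2 * ‖x - y‖ := by gcongr
      _ = _ := by ring
  have h2 := norm_sub_le_norm_add (x - y) ((t * (η x - η y)) • a)
  linarith

lemma shear_injective (ha : ‖a‖ = 1) {η' : Space n → ℝ} (hη : Profile a S L η η')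
    {t : ℝ} (ht : |t| * L ≤ 1 / 2) : Function.Injective (shear a η t) := by
  intro x y hxy
  have := half_norm_le_norm_shear_sub ha hη ht x y
  rw [hxy, sub_self, norm_zero] at this
  have h2 : ‖x - y‖ ≤ 0 := by linarith
  exact sub_eq_zero.1 (norm_le_zero_iff.1 h2)

/-- The differential of the shear: the identity plus an operator of rank one. -/
def shearFDeriv (a : Space n) (η : Space n → ℝ) (t : ℝ) (x : Space n) : Space n →L[ℝ] Space n :=
  ContinuousLinearMap.id ℝ (Space n) + (t • fderiv ℝ η x).smulRight a

lemma hasFDerivAt_shear (hη : Differentiable ℝ η) (t : ℝ) (x : Space n) :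
    HasFDerivAt (shear a η t) (shearFDeriv a η t x) x :=
  (hasFDerivAt_id x).add (((hη x).hasFDerivAt.const_mul t).smul_const a)

lemma det_shearFDeriv (t : ℝ) (x : Space n) :
    (shearFDeriv a η t x).det = 1 + t * dirDeriv a η x := by
  have h := LinearMap.transvection.det (((t • fderiv ℝ η x : Space n →L[ℝ] ℝ)) : Space n →ₗ[ℝ] ℝ) a
  have h2 : ((shearFDeriv a η t x : Space n →L[ℝ] Space n) : Space n →ₗ[ℝ] Space n) =
      LinearMap.transvection (((t • fderiv ℝ η x : Space n →L[ℝ] ℝ)) : Space n →ₗ[ℝ] ℝ) a := by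
    ext y
    simp [shearFDeriv, LinearMap.transvection]
  rw [ContinuousLinearMap.det, h2, h]
  simp [dirDeriv]

lemma shear_jacobian_bounds (hη : Profile a S L η (dirDeriv a η)) {t : ℝ}
    (ht : |t| * L ≤ 1 / 2) (x : Space n) :
    0 ≤ 1 + t * dirDeriv a η x ∧ 1 + t * dirDeriv a η x ≤ 2 := by
  have h1 : |t * dirDeriv a η x| ≤ 1 / 2 := by
    rw [abs_mul]
    exact (mul_le_mul_of_nonneg_left (hη.bound' x) (abs_nonneg t)).trans ht
  rw [abs_le] at h1
  constructor <;> linarith [h1.1, h1.2]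

lemma lintegral_image_shear (ha : ‖a‖ = 1) (hd : Differentiable ℝ η)
    (hη : Profile a S L η (dirDeriv a η)) {t : ℝ} (ht : |t| * L ≤ 1 / 2) (hA : MeasurableSet A)
    (u : Space n → ℝ≥0∞) :
    ∫⁻ x in shear a η t '' A, u x =
      ∫⁻ x in A, ENNReal.ofReal (1 + t * dirDeriv a η x) * u (shear a η t x) := by
  rw [lintegral_image_eq_lintegral_abs_det_fderiv_mul volume hA
    (fun x _ => (hasFDerivAt_shear hd t x).hasFDerivWithinAt) (shear_injective ha hη ht).injOn]
  refine lintegral_congr fun x => ?_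
  rw [det_shearFDeriv, abs_of_nonneg (shear_jacobian_bounds hη ht x).1]

lemma integral_image_shear (ha : ‖a‖ = 1) (hd : Differentiable ℝ η)
    (hη : Profile a S L η (dirDeriv a η)) {t : ℝ} (ht : |t| * L ≤ 1 / 2) (hA : MeasurableSet A)
    (u : Space n → ℝ) :
    ∫ x in shear a η t '' A, u x =
      ∫ x in A, (1 + t * dirDeriv a η x) * u (shear a η t x) := by
  rw [integral_image_eq_integral_abs_det_fderiv_smul volume hA
    (fun x _ => (hasFDerivAt_shear hd t x).hasFDerivWithinAt) (shear_injective ha hη ht).injOn]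
  refine integral_congr_ae (ae_of_all _ fun x => ?_)
  simp only [det_shearFDeriv, abs_of_nonneg (shear_jacobian_bounds hη ht x).1, smul_eq_mul]

lemma continuous_shear (hη : Continuous η) (t : ℝ) : Continuous (shear a η t) := by
  unfold shear; fun_prop

/-- The interaction of two deformed sets, as an integral over displacements. -/
def shearedIntegrand (k : Space n → ℝ) (a : Space n) (η : Space n → ℝ) (t : ℝ)
    (p : Space n × Space n) : ℝ :=
  (1 + t * dirDeriv a η p.2) * (1 + t * dirDeriv a η (p.2 - p.1)) *
    k (p.1 + (t * (η p.2 - η (p.2 - p.1))) • a)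

lemma interaction_image_shear (ha : ‖a‖ = 1) (hd : Differentiable ℝ η)
    (hη : Profile a S L η (dirDeriv a η)) {t : ℝ} (ht : |t| * L ≤ 1 / 2) (hA : MeasurableSet A)
    (hB : MeasurableSet B) {k : Space n → ℝ} (hk : Measurable k) :
    interaction k (shear a η t '' A) (shear a η t '' B) =
      ∫⁻ p, (crossPairs A B).indicator
        (fun p => ENNReal.ofReal (shearedIntegrand k a η t p)) p := by
  have hm' := hη.cont'.measurable
  have hm := hη.cont.measurable
  have hmeas : Measurable fun p => ENNReal.ofReal (shearedIntegrand k a η t p) := by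
    unfold shearedIntegrand; fun_prop
  rw [Measure.volume_eq_prod, lintegral_prod_symm _
    (hmeas.indicator (measurableSet_crossPairs hA hB)).aemeasurable]
  unfold interaction
  rw [lintegral_image_shear ha hd hη ht hA, ← lintegral_indicator hA]
  refine lintegral_congr fun x => ?_
  by_cases hx : x ∈ A
  · rw [indicator_of_mem hx, lintegral_image_shear ha hd hη ht hB, ← lintegral_indicator hB,
      ← lintegral_const_mul' _ _ ENNReal.ofReal_ne_top, ← lintegral_sub_left_eq_self _ x]
    refine lintegral_congr fun z => ?_
    by_cases hz : x - z ∈ B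
    · have : (z, x) ∈ crossPairs A B := ⟨hx, hz⟩
      rw [indicator_of_mem hz, indicator_of_mem this,
        ← ENNReal.ofReal_mul (shear_jacobian_bounds hη ht _).1,
        ← ENNReal.ofReal_mul (shear_jacobian_bounds hη ht _).1, shear_sub]
      simp only [shearedIntegrand, sub_sub_cancel, mul_assoc]
    · have : (z, x) ∉ crossPairs A B := fun h => hz h.2
      rw [indicator_of_notMem hz, indicator_of_notMem this, mul_zero]
  · rw [indicator_of_notMem hx]
    have : ∀ z, (z, x) ∉ crossPairs A B := fun z h => hx h.1
    simp [indicator_of_notMem (this _)]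

/-- The derivative in `t` of the integrand `shearedIntegrand`. -/
def shearedIntegrandDeriv (k k' : Space n → ℝ) (a : Space n) (η : Space n → ℝ) (t : ℝ)
    (p : Space n × Space n) : ℝ :=
  (dirDeriv a η p.2 * (1 + t * dirDeriv a η (p.2 - p.1)) +
    (1 + t * dirDeriv a η p.2) * dirDeriv a η (p.2 - p.1)) *
      k (p.1 + (t * (η p.2 - η (p.2 - p.1))) • a) +
  (1 + t * dirDeriv a η p.2) * (1 + t * dirDeriv a η (p.2 - p.1)) *
    ((η p.2 - η (p.2 - p.1)) * k' (p.1 + (t * (η p.2 - η (p.2 - p.1))) • a))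

lemma half_norm_le_displacement (ha : ‖a‖ = 1) {η' : Space n → ℝ} (hη : Profile a S L η η')
    {t : ℝ} (ht : |t| * L ≤ 1 / 2) (p : Space n × Space n) :
    ‖p.1‖ / 2 ≤ ‖p.1 + (t * (η p.2 - η (p.2 - p.1))) • a‖ := by
  have := half_norm_le_norm_shear_sub ha hη ht p.2 (p.2 - p.1)
  rwa [shear_sub, sub_sub_cancel] at this

lemma hasDerivAt_shearedIntegrand (ha : ‖a‖ = 1) {k k' : Space n → ℝ}
    (hk : KernelPair s C a k k') (hη : Profile a S L η (dirDeriv a η)) {t : ℝ}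
    (ht : |t| * L ≤ 1 / 2) {p : Space n × Space n} (hp : p.1 ≠ 0) :
    HasDerivAt (fun t => shearedIntegrand k a η t p) (shearedIntegrandDeriv k k' a η t p) t := by
  have hne : p.1 + (t * (η p.2 - η (p.2 - p.1))) • a ≠ 0 := by
    have h1 := half_norm_le_displacement ha hη ht p
    have h2 := norm_pos_iff.2 hp
    exact norm_pos_iff.1 (by linarith)
  have h1 : ∀ c : ℝ, HasDerivAt (fun t : ℝ => 1 + t * c) c t := fun c => by
    simpa using ((hasDerivAt_id t).mul_const c).const_add 1
  have h2 : HasDerivAt (fun t : ℝ => t * (η p.2 - η (p.2 - p.1))) (η p.2 - η (p.2 - p.1)) t := by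
    simpa using (hasDerivAt_id t).mul_const (η p.2 - η (p.2 - p.1))
  have h3 := (hk.deriv_line _ _ hne).comp t h2
  have h4 := ((h1 (dirDeriv a η p.2)).mul (h1 (dirDeriv a η (p.2 - p.1)))).mul h3
  refine h4.congr_deriv ?_
  simp only [shearedIntegrandDeriv, Function.comp_apply, Pi.mul_apply]
  ring

lemma abs_shearedIntegrandDeriv_le (hn : 2 ≤ n) (hs : s ∈ Ioo (0 : ℝ) 1) (ha : ‖a‖ = 1)
    {k k' : Space n → ℝ}
    (hk : KernelPair s C a k k') (hη : Profile a S L η (dirDeriv a η)) {t : ℝ}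
    (ht : |t| * L ≤ 1 / 2) {p : Space n × Space n} (hp : p.1 ≠ 0) :
    |shearedIntegrandDeriv k k' a η t p| ≤
      12 * C * L * (1 / 2) ^ (-((n : ℝ) + s)) * ‖p.1‖ ^ (-((n : ℝ) + s)) := by
  have hC := hk.constant_nonneg hn
  have hL := hη.lip_nonneg
  have hq : 0 < (n : ℝ) + s := by have := hs.1; positivity
  have hpos : 0 < ‖p.1‖ := norm_pos_iff.2 hp
  have hw := half_norm_le_displacement ha hη ht p
  set w := p.1 + (t * (η p.2 - η (p.2 - p.1))) • a with hwdef
  have hne : w ≠ 0 := norm_pos_iff.1 (by linarith)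
  obtain ⟨j1, j2⟩ := shear_jacobian_bounds hη ht p.2
  obtain ⟨j3, j4⟩ := shear_jacobian_bounds hη ht (p.2 - p.1)
  have i1 := hη.bound' p.2
  have i2 := hη.bound' (p.2 - p.1)
  have e3 : |η p.2 - η (p.2 - p.1)| ≤ L * ‖p.1‖ := by simpa using hη.lip p.2 (p.2 - p.1)
  have r1 : ‖w‖ ^ (-((n : ℝ) + s)) ≤ (‖p.1‖ / 2) ^ (-((n : ℝ) + s)) :=
    Real.rpow_le_rpow_of_nonpos (by positivity) hw (by linarith)
  have r2 : ‖w‖ ^ (-((n : ℝ) + s) - 1) ≤ (‖p.1‖ / 2) ^ (-((n : ℝ) + s) - 1) :=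
    Real.rpow_le_rpow_of_nonpos (by positivity) hw (by linarith)
  have r3 : (‖p.1‖ / 2) ^ (-((n : ℝ) + s) - 1) * ‖p.1‖ = 2 * (‖p.1‖ / 2) ^ (-((n : ℝ) + s)) := by
    rw [Real.rpow_sub_one (by positivity)]; field_simp
  have r4 : (‖p.1‖ / 2) ^ (-((n : ℝ) + s)) =
      (1 / 2) ^ (-((n : ℝ) + s)) * ‖p.1‖ ^ (-((n : ℝ) + s)) := by
    rw [← Real.mul_rpow (by positivity) (by positivity)]; congr 1; ring
  have b1 : |k w| ≤ C * (‖p.1‖ / 2) ^ (-((n : ℝ) + s)) :=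
    (hk.bound w hne).trans (by gcongr)
  have b2 : |k' w| ≤ C * (‖p.1‖ / 2) ^ (-((n : ℝ) + s) - 1) :=
    (hk.bound' w hne).trans (by gcongr)
  have c1 : |dirDeriv a η p.2 * (1 + t * dirDeriv a η (p.2 - p.1)) +
      (1 + t * dirDeriv a η p.2) * dirDeriv a η (p.2 - p.1)| ≤ L * 2 + 2 * L := by
    refine (abs_add_le _ _).trans ?_
    rw [abs_mul, abs_mul, abs_of_nonneg j1, abs_of_nonneg j3]
    gcongr
  calc |shearedIntegrandDeriv k k' a η t p|
      ≤ (L * 2 + 2 * L) * (C * (‖p.1‖ / 2) ^ (-((n : ℝ) + s))) +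
        2 * 2 * ((L * ‖p.1‖) * (C * (‖p.1‖ / 2) ^ (-((n : ℝ) + s) - 1))) := by
        unfold shearedIntegrandDeriv
        refine (abs_add_le _ _).trans ?_
        rw [abs_mul, abs_mul ((1 + t * dirDeriv a η p.2) * (1 + t * dirDeriv a η (p.2 - p.1))),
          abs_mul (η p.2 - _), abs_mul (1 + _), abs_of_nonneg j1, abs_of_nonneg j3]
        gcongr
    _ = 4 * L * C * (‖p.1‖ / 2) ^ (-((n : ℝ) + s)) +
        4 * L * C * ((‖p.1‖ / 2) ^ (-((n : ℝ) + s) - 1) * ‖p.1‖) := by ring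
    _ = _ := by rw [r3, r4]; ring

lemma shearedIntegrandDeriv_eq_zero {k k' : Space n → ℝ} (hη : Profile a S L η (dirDeriv a η))
    {p : Space n × Space n} (hp : p.2 ∉ S) (hp' : p.2 - p.1 ∉ S) (t : ℝ) :
    shearedIntegrandDeriv k k' a η t p = 0 := by
  simp [shearedIntegrandDeriv, hη.zero _ hp, hη.zero _ hp', hη.zero' _ hp, hη.zero' _ hp']

/-- First variation of the interaction of two disjoint sets. -/
theorem hasDerivAt_interaction (hn : 2 ≤ n) (hs : s ∈ Ioo (0 : ℝ) 1) (ha : ‖a‖ = 1)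
    {k k' : Space n → ℝ} (hk : KernelPair s C a k k') (hk0 : ∀ z, z ≠ 0 → 0 ≤ k z)
    (hd : Differentiable ℝ η) (hη : Profile a S L η (dirDeriv a η)) (hA : MeasurableSet A)
    (hB : MeasurableSet B) (hfin : interaction k A B < ⊤)
    (hM : CrossBound A B S M) :
    HasDerivAt (fun t => (interaction k (shear a η t '' A) (shear a η t '' B)).toReal)
      (interactionVariation k k' A B η (dirDeriv a η)) 0 := by
  have hL := hη.lip_nonneg
  have hS := hη.compact.isClosed.measurableSet
  have hS' : MeasurableSet {p : Space n × Space n | p.2 ∈ S ∨ p.2 - p.1 ∈ S} :=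
    (measurable_snd hS).union ((measurable_snd.sub measurable_fst) hS)
  have hcross := measurableSet_crossPairs hA hB
  have hkm := measurable_of_continuousOn_compl_zero hk.cont
  have hkm' := measurable_of_continuousOn_compl_zero hk.cont'
  have hm := hη.cont.measurable
  have hm' := hη.cont'.measurable
  have hsm : ∀ t, Measurable (shearedIntegrand k a η t) := fun t => by
    unfold shearedIntegrand; fun_prop
  set δ := 1 / (2 * (L + 1)) with hδ
  have hδpos : 0 < δ := by positivity
  have hsmall : ∀ t ∈ ball (0 : ℝ) δ, |t| * L ≤ 1 / 2 := by
    intro t ht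
    rw [mem_ball_zero_iff, Real.norm_eq_abs] at ht
    calc |t| * L ≤ δ * (L + 1) := by gcongr; linarith
      _ = 1 / 2 := by rw [hδ]; field_simp
  have hnn : ∀ t ∈ ball (0 : ℝ) δ, 0 ≤ᵐ[volume] (crossPairs A B).indicator
      (shearedIntegrand k a η t) := by
    intro t ht
    filter_upwards [ae_fst_ne_zero hn] with p hp
    by_cases hpc : p ∈ crossPairs A B
    · rw [indicator_of_mem hpc]
      have h1 := half_norm_le_displacement ha hη (hsmall t ht) p
      have h2 := norm_pos_iff.2 hp
      exact mul_nonneg (mul_nonneg (shear_jacobian_bounds hη (hsmall t ht) _).1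
        (shear_jacobian_bounds hη (hsmall t ht) _).1) (hk0 _ (norm_pos_iff.1 (by linarith)))
    · rw [indicator_of_notMem hpc]; exact le_rfl
  have hofReal : ∀ t p, ENNReal.ofReal ((crossPairs A B).indicator (shearedIntegrand k a η t) p) =
      (crossPairs A B).indicator (fun p => ENNReal.ofReal (shearedIntegrand k a η t p)) p := by
    intro t p
    by_cases hpc : p ∈ crossPairs A B
    · rw [indicator_of_mem hpc, indicator_of_mem hpc]
    · rw [indicator_of_notMem hpc, indicator_of_notMem hpc, ENNReal.ofReal_zero]
  have hae : ∀ t, AEStronglyMeasurable ((crossPairs A B).indicator (shearedIntegrand k a η t)) :=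
    fun t => ((hsm t).indicator hcross).aestronglyMeasurable
  have heq : ∀ t ∈ ball (0 : ℝ) δ,
      (interaction k (shear a η t '' A) (shear a η t '' B)).toReal =
        ∫ p, (crossPairs A B).indicator (shearedIntegrand k a η t) p := by
    intro t ht
    rw [integral_eq_lintegral_of_nonneg_ae (hnn t ht) (hae t),
      interaction_image_shear ha hd hη (hsmall t ht) hA hB hkm]
    simp_rw [hofReal]
  have h0 : (0 : ℝ) ∈ ball (0 : ℝ) δ := mem_ball_self hδpos
  have hint0 : Integrable ((crossPairs A B).indicator (shearedIntegrand k a η 0)) := by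
    refine ⟨hae 0, ?_⟩
    rw [hasFiniteIntegral_iff_ofReal (hnn 0 h0)]
    rw [lintegral_congr (hofReal 0)]
    rw [← interaction_image_shear ha hd hη (hsmall 0 h0) hA hB hkm]
    have hid : shear a η 0 = id := by funext x; simp [shear]
    simpa [hid] using hfin
  set near := crossPairs A B ∩ {p : Space n × Space n | p.2 ∈ S ∨ p.2 - p.1 ∈ S} with hnear
  have hmeas : MeasurableSet near := hcross.inter hS'
  have hw : Integrable (near.indicator (fun p => ‖p.1‖ ^ (-((n : ℝ) + s)))) := by
    refine ⟨((by fun_prop : Measurable fun p : Space n × Space n =>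
      ‖p.1‖ ^ (-((n : ℝ) + s))).indicator hmeas).aestronglyMeasurable, ?_⟩
    rw [hasFiniteIntegral_iff_enorm]
    refine lt_of_le_of_lt (lintegral_mono fun p => ?_)
      (lintegral_crossPairs_weight_lt_top hn hs hA hB hS hM)
    simp only
    by_cases hp : p ∈ near
    · rw [indicator_of_mem hp, indicator_of_mem hp, Real.enorm_of_nonneg (by positivity)]
    · rw [indicator_of_notMem hp, indicator_of_notMem hp]; simp
  have hmain := (hasDerivAt_integral_of_dominated_loc_of_deriv_le (𝕜 := ℝ) (μ := volume)
    (F := fun t => (crossPairs A B).indicator (shearedIntegrand k a η t))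
    (F' := fun t => (crossPairs A B).indicator (shearedIntegrandDeriv k k' a η t))
    (bound := fun p => (12 * C * L * (1 / 2) ^ (-((n : ℝ) + s))) *
      near.indicator (fun p => ‖p.1‖ ^ (-((n : ℝ) + s))) p)
    (ball_mem_nhds (0 : ℝ) hδpos) (Eventually.of_forall hae) hint0 ?_ ?_
    (hw.const_mul _) ?_).2
  · have hzero : interactionVariation k k' A B η (dirDeriv a η) =
        ∫ p, (crossPairs A B).indicator (shearedIntegrandDeriv k k' a η 0) p := by
      have : variationIntegrand k k' η (dirDeriv a η) = shearedIntegrandDeriv k k' a η 0 := by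
        funext p
        simp only [shearedIntegrandDeriv, variationIntegrand, zero_mul, zero_smul, add_zero,
          mul_one, one_mul]
        ring
      rw [← this]; rfl
    rw [hzero]
    refine hmain.congr_of_eventuallyEq ?_
    filter_upwards [ball_mem_nhds (0 : ℝ) hδpos] with t ht using heq t ht
  · refine Measurable.aestronglyMeasurable (Measurable.indicator ?_ hcross)
    unfold shearedIntegrandDeriv; fun_prop
  · filter_upwards [ae_fst_ne_zero hn] with p hp t ht
    by_cases h1 : p ∈ crossPairs A B
    · by_cases h2 : p ∈ {p : Space n × Space n | p.2 ∈ S ∨ p.2 - p.1 ∈ S}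
      · have h3 : p ∈ near := ⟨h1, h2⟩
        rw [indicator_of_mem h1, indicator_of_mem h3]
        exact abs_shearedIntegrandDeriv_le hn hs ha hk hη (hsmall t ht) hp
      · have h3 : p ∉ near := fun h => h2 h.2
        rw [indicator_of_mem h1, indicator_of_notMem h3]
        simp only [mem_ofPred_eq, not_or] at h2
        rw [shearedIntegrandDeriv_eq_zero hη h2.1 h2.2]; simp
    · have h3 : p ∉ near := fun h => h1 h.1
      rw [indicator_of_notMem h1, indicator_of_notMem h3]; simp
  · filter_upwards [ae_fst_ne_zero hn] with p hp t ht
    by_cases h1 : p ∈ crossPairs A B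
    · refine ((hasDerivAt_shearedIntegrand ha hk hη (hsmall t ht) hp).congr_of_eventuallyEq
        (Eventually.of_forall fun t => indicator_of_mem h1 _)).congr_deriv ?_
      exact (indicator_of_mem h1 _).symm
    · refine ((hasDerivAt_const t (0 : ℝ)).congr_of_eventuallyEq
        (Eventually.of_forall fun t => indicator_of_notMem h1 _)).congr_deriv ?_
      exact (indicator_of_notMem h1 _).symm

/-- First variation of a potential energy. -/
theorem hasDerivAt_setIntegral_shear (ha : ‖a‖ = 1) (hd : Differentiable ℝ η)
    (hη : Profile a S L η (dirDeriv a η)) (hA : MeasurableSet A) (hAb : Bornology.IsBounded A)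
    {g : Space n → ℝ} (hg : ContDiff ℝ 1 g) :
    HasDerivAt (fun t => ∫ x in shear a η t '' A, g x)
      (∫ x in A, (dirDeriv a η x * g x + η x * dirDeriv a g x)) 0 := by
  have hL := hη.lip_nonneg
  set δ := 1 / (2 * (L + 1)) with hδ
  have hδpos : 0 < δ := by positivity
  have hδ1 : δ ≤ 1 := by
    rw [hδ, div_le_one (by positivity)]; linarith
  have hsmall : ∀ t ∈ ball (0 : ℝ) δ, |t| * L ≤ 1 / 2 := by
    intro t ht
    rw [mem_ball_zero_iff, Real.norm_eq_abs] at ht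
    calc |t| * L ≤ δ * (L + 1) := by gcongr; linarith
      _ = 1 / 2 := by rw [hδ]; field_simp
  have hm := hη.cont
  have hm' := hη.cont'
  have hgc := hg.continuous
  have hgc' : Continuous (dirDeriv a g) :=
    (hg.continuous_fderiv one_ne_zero).clm_apply continuous_const
  have hcs : ∀ t, Continuous (shear a η t) := fun t => continuous_shear hm t
  have hfin : volume A < ⊤ := hAb.measure_lt_top
  obtain ⟨R, hR⟩ := hAb.subset_closedBall 0
  obtain ⟨Lη, hLη⟩ := hη.compact.exists_bound_of_continuousOn hm.continuousOn
  have hLη' : ∀ x, |η x| ≤ |Lη| := by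
    intro x
    by_cases hx : x ∈ S
    · exact (hLη x hx).trans (le_abs_self _)
    · rw [hη.zero x hx]; simp
  obtain ⟨G, hG⟩ := (isCompact_closedBall (0 : Space n) (R + |Lη|)).exists_bound_of_continuousOn
    (f := fun x => ‖g x‖ + ‖dirDeriv a g x‖) (by fun_prop)
  have hin : ∀ x ∈ A, ∀ t ∈ ball (0 : ℝ) δ, shear a η t x ∈ closedBall (0 : Space n) (R + |Lη|) := by
    intro x hx t ht
    rw [mem_ball_zero_iff, Real.norm_eq_abs] at ht
    rw [mem_closedBall_zero_iff]
    refine (norm_add_le _ _).trans (add_le_add (mem_closedBall_zero_iff.1 (hR hx)) ?_)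
    rw [norm_smul, ha, mul_one, Real.norm_eq_abs, abs_mul]
    calc |t| * |η x| ≤ 1 * |Lη| :=
          mul_le_mul (ht.le.trans hδ1) (hLη' x) (abs_nonneg _) zero_le_one
      _ = _ := one_mul _
  have hG' : ∀ y ∈ closedBall (0 : Space n) (R + |Lη|), |g y| ≤ G ∧ |dirDeriv a g y| ≤ G := by
    intro y hy
    have := hG y hy
    rw [Real.norm_of_nonneg (by positivity)] at this
    simp only [Real.norm_eq_abs] at this
    constructor <;> linarith [abs_nonneg (g y), abs_nonneg (dirDeriv a g y)]
  have hmain := (hasDerivAt_integral_of_dominated_loc_of_deriv_le (𝕜 := ℝ) (μ := volume.restrict A)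
    (F := fun t x => (1 + t * dirDeriv a η x) * g (shear a η t x))
    (F' := fun t x => dirDeriv a η x * g (shear a η t x) +
      (1 + t * dirDeriv a η x) * (η x * dirDeriv a g (shear a η t x)))
    (bound := fun _ => L * G + 2 * (|Lη| * G))
    (ball_mem_nhds (0 : ℝ) hδpos) ?_ ?_ ?_ ?_
    (integrableOn_const hfin.ne) ?_).2
  · have hid : ∀ x, shear a η 0 x = x := fun x => by simp [shear]
    simp only [hid, zero_mul, add_zero, one_mul] at hmain
    refine hmain.congr_of_eventuallyEq ?_
    filter_upwards [ball_mem_nhds (0 : ℝ) hδpos] with t ht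
      using integral_image_shear ha hd hη (hsmall t ht) hA g
  · exact Eventually.of_forall fun t => Continuous.aestronglyMeasurable (by fun_prop)
  · refine Integrable.mono' (integrableOn_const (C := 2 * G) hfin.ne) ?_ ?_
    · exact Continuous.aestronglyMeasurable (by fun_prop)
    · filter_upwards [ae_restrict_mem hA] with x hx
      have h0 := mem_ball_self (x := (0 : ℝ)) hδpos
      obtain ⟨j1, j2⟩ := shear_jacobian_bounds hη (hsmall 0 h0) x
      rw [norm_mul, Real.norm_eq_abs, Real.norm_eq_abs, abs_of_nonneg j1]
      have := (hG' _ (hin x hx 0 h0)).1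
      gcongr
  · exact Continuous.aestronglyMeasurable (by fun_prop)
  · filter_upwards [ae_restrict_mem hA] with x hx t ht
    obtain ⟨j1, j2⟩ := shear_jacobian_bounds hη (hsmall t ht) x
    obtain ⟨g1, g2⟩ := hG' _ (hin x hx t ht)
    refine (norm_add_le _ _).trans ?_
    rw [norm_mul, norm_mul, norm_mul]
    simp only [Real.norm_eq_abs]
    rw [abs_of_nonneg j1]
    have i1 := hη.bound' x
    have i2 := hLη' x
    gcongr
  · refine ae_of_all _ fun x t _ => ?_
    have h1 : HasDerivAt (fun t : ℝ => 1 + t * dirDeriv a η x) (dirDeriv a η x) t := by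
      simpa using ((hasDerivAt_id t).mul_const (dirDeriv a η x)).const_add 1
    have h2 : HasDerivAt (fun t : ℝ => shear a η t x) (η x • a) t := by
      have h3 : HasDerivAt (fun t : ℝ => t * η x) (η x) t := by
        simpa using (hasDerivAt_id t).mul_const (η x)
      exact (h3.smul_const a).const_add x
    have h4 := ((hg.differentiable one_ne_zero) (shear a η t x)).hasFDerivAt.comp_hasDerivAt t h2
    refine (h1.mul h4).congr_deriv ?_
    simp [dirDeriv]

end shear

/-! ### Shears as admissible variations -/

section admissible

variable {n : ℕ} {s C L : ℝ} {a : Space n} {η : Space n → ℝ} {A B S Ω E : Set (Space n)}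

lemma approximatesLinearOn_shear (ha : ‖a‖ = 1) {η' : Space n → ℝ} (hη : Profile a S L η η')
    {t : ℝ} (ht : |t| * L ≤ 1 / 2) :
    ApproximatesLinearOn (shear a η t)
      ((ContinuousLinearEquiv.refl ℝ (Space n) : Space n ≃L[ℝ] Space n) : Space n →L[ℝ] Space n)
      univ (1 / 2) := by
  intro x _ y _
  rw [shear_sub]
  simp only [ContinuousLinearEquiv.coe_refl, ContinuousLinearMap.coe_id', id_eq,
    add_sub_cancel_left]
  rw [norm_smul, ha, mul_one, Real.norm_eq_abs, abs_mul]
  calc |t| * |η x - η y| ≤ |t| * (L * ‖x - y‖) := by gcongr; exact hη.lip x y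
    _ = |t| * L * ‖x - y‖ := by ring
    _ ≤ 1 / 2 * ‖x - y‖ := by gcongr
    _ = _ := by simp

lemma exists_shear_homeomorph (hn : 2 ≤ n) (ha : ‖a‖ = 1) {η' : Space n → ℝ}
    (hη : Profile a S L η η') {t : ℝ} (ht : |t| * L ≤ 1 / 2) :
    ∃ f : Space n ≃ₜ Space n, ∀ x, f x = shear a η t x := by
  have := nontrivial_space hn
  refine ⟨(approximatesLinearOn_shear ha hη ht).toHomeomorph _ (Or.inr ?_), fun x => rfl⟩
  have h1 : ‖((ContinuousLinearEquiv.refl ℝ (Space n)).symm : Space n →L[ℝ] Space n)‖₊ = 1 := by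
    ext; simp
  rw [h1, inv_one]
  exact NNReal.half_lt_self one_ne_zero

/-- A shear as a bijection of the space; it is the identity for the times at which the shear may
fail to be bijective. -/
def shearEquiv (a : Space n) (η : Space n → ℝ) (t : ℝ) : Space n ≃ Space n :=
  open Classical in
  if h : Function.Bijective (shear a η t) then Equiv.ofBijective _ h else Equiv.refl _

lemma shear_bijective (hn : 2 ≤ n) (ha : ‖a‖ = 1) {η' : Space n → ℝ}
    (hη : Profile a S L η η') {t : ℝ} (ht : |t| * L ≤ 1 / 2) :
    Function.Bijective (shear a η t) := by
  obtain ⟨f, hf⟩ := exists_shear_homeomorph hn ha hη ht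
  have : shear a η t = f := (funext hf).symm
  rw [this]; exact f.bijective

lemma shearEquiv_apply (hb : Function.Bijective (shear a η t)) (x : Space n) :
    shearEquiv a η t x = shear a η t x := by
  unfold shearEquiv; rw [dif_pos hb]; rfl

lemma shearEquiv_coe (hb : Function.Bijective (shear a η t)) :
    (shearEquiv a η t : Space n → Space n) = shear a η t :=
  funext (shearEquiv_apply hb)

lemma shear_apply_of_eq_zero {t : ℝ} {x : Space n} (hx : η x = 0) : shear a η t x = x := by
  simp [shear, hx]

lemma image_shear_eq_self {t : ℝ} (hb : Function.Bijective (shear a η t)) (hΩ : tsupport η ⊆ Ω) :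
    shear a η t '' Ω = Ω := by
  have hout : ∀ x, x ∉ Ω → shear a η t x = x := fun x hx =>
    shear_apply_of_eq_zero (image_eq_zero_of_notMem_tsupport fun h => hx (hΩ h))
  ext y
  constructor
  · rintro ⟨x, hx, rfl⟩
    by_contra h
    have := hb.1 (hout _ h)
    rw [this] at h
    exact h hx
  · intro hy
    obtain ⟨x, rfl⟩ := hb.2 y
    refine ⟨x, ?_, rfl⟩
    by_contra h
    rw [hout x h] at hy
    exact h hy

lemma image_shear_ae_eq (hd : Differentiable ℝ η) (t : ℝ) (hAB : A =ᵐ[volume] B) :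
    (shear a η t '' A : Set (Space n)) =ᵐ[volume] (shear a η t '' B : Set (Space n)) := by
  have hdiff : Differentiable ℝ (shear a η t) := fun x => (hasFDerivAt_shear hd t
      x).differentiableAt
  have key : ∀ {A B : Set (Space n)}, A ≤ᵐ[volume] B →
      (shear a η t '' A : Set (Space n)) ≤ᵐ[volume] (shear a η t '' B : Set (Space n)) := by
    intro A B h
    rw [ae_le_set] at h ⊢
    refine measure_mono_null (sdiff_subset_iff.2 ?_)
        (addHaar_image_eq_zero_of_differentiableOn_of_addHaar_eq_zero
      volume hdiff.differentiableOn h)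
    rw [← image_union]
    exact image_mono (by rw [union_sdiff_self]; exact subset_union_right)
  exact (key hAB.le).antisymm (key hAB.symm.le)

lemma interaction_congr {K : Space n → ℝ} {A A' B B' : Set (Space n)} (hA : A =ᵐ[volume] A')
    (hB : B =ᵐ[volume] B') : interaction K A B = interaction K A' B' := by
  unfold interaction
  rw [setLIntegral_congr hA]
  refine lintegral_congr fun x => ?_
  rw [setLIntegral_congr hB]

lemma interaction_congr_left {K : Space n → ℝ} {A A' B : Set (Space n)} (hA : A =ᵐ[volume] A') :
    interaction K A B = interaction K A' B := by
  unfold interaction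
  rw [setLIntegral_congr hA]

lemma volume_image_shear (ha : ‖a‖ = 1) (hd : Differentiable ℝ η)
    (hη : Profile a S L η (dirDeriv a η)) {t : ℝ} (ht : |t| * L ≤ 1 / 2) (hA : MeasurableSet A)
    (hAb : Bornology.IsBounded A) (h0 : ∫ x in A, dirDeriv a η x = 0) :
    volume (shear a η t '' A) = volume A := by
  have hfin : volume A < ⊤ := hAb.measure_lt_top
  have h1 := lintegral_image_shear ha hd hη ht hA (fun _ => 1)
  simp only [lintegral_const, Measure.restrict_apply MeasurableSet.univ, univ_inter, one_mul,
    mul_one] at h1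
  rw [h1]
  have hi : IntegrableOn (dirDeriv a η) A :=
    Measure.integrableOn_of_bounded (M := L) hfin.ne hη.cont'.aestronglyMeasurable
      (ae_of_all _ fun x => by rw [Real.norm_eq_abs]; exact hη.bound' x)
  have hc : IntegrableOn (fun _ : Space n => (1 : ℝ)) A := integrableOn_const hfin.ne
  rw [← ofReal_integral_eq_lintegral_ofReal (f := fun x => 1 + t * dirDeriv a η x)
    (hc.add (hi.const_mul t))
    (ae_of_all _ fun x => (shear_jacobian_bounds hη ht x).1)]
  have : ∫ x in A, (1 + t * dirDeriv a η x) = volume.real A := by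
    rw [integral_add hc (hi.const_mul t), integral_const_mul, h0]
    simp
  rw [this, Measure.real, ENNReal.ofReal_toReal hfin.ne]

theorem isAdmissibleVariation_shear (hn : 2 ≤ n) (ha : ‖a‖ = 1) (hs : ContDiff ℝ ∞ η)
    (hc : HasCompactSupport η) (hη : Profile a S L η (dirDeriv a η)) (hΩ : tsupport η ⊆ Ω)
    (hA : MeasurableSet A) (hAb : Bornology.IsBounded A) (hAE : A =ᵐ[volume] E)
    (h0 : ∫ x in A, dirDeriv a η x = 0) :
    IsAdmissibleVariation Ω E (1 / (2 * (L + 1))) (shearEquiv a η) := by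
  have hL := hη.lip_nonneg
  have hd : Differentiable ℝ η := hs.differentiable (by simp)
  have hsmall : ∀ t ∈ Ioo (-(1 / (2 * (L + 1)))) (1 / (2 * (L + 1))), |t| * L ≤ 1 / 2 := by
    intro t ht
    have : |t| ≤ 1 / (2 * (L + 1)) := (abs_lt.2 ht).le
    calc |t| * L ≤ 1 / (2 * (L + 1)) * (L + 1) := by gcongr; linarith
      _ = 1 / 2 := by field_simp
  have hbij : ∀ t ∈ Ioo (-(1 / (2 * (L + 1)))) (1 / (2 * (L + 1))),
      Function.Bijective (shear a η t) := fun t ht => shear_bijective hn ha hη (hsmall t ht)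
  have hsm : ContDiff ℝ ∞ (fun p : ℝ × Space n => shear a η p.1 p.2) := by
    unfold shear
    have : ContDiff ℝ ∞ (fun p : ℝ × Space n => η p.2) := hs.comp contDiff_snd
    fun_prop
  have hz : (0 : ℝ) ∈ Ioo (-(1 / (2 * (L + 1)))) (1 / (2 * (L + 1))) := by
    constructor <;> simp <;> positivity
  refine ⟨?_, ?_, ?_, ?_, ?_, ?_⟩
  · refine hsm.contDiffOn.congr ?_
    rintro ⟨t, x⟩ ⟨ht, -⟩
    exact shearEquiv_apply (hbij t ht) x
  · intro t ht
    obtain ⟨f, hf⟩ := exists_shear_homeomorph hn ha hη (hsmall t ht)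
    have hfs : (f : Space n → Space n) = shear a η t := funext hf
    have hsymm : ((shearEquiv a η t).symm : Space n → Space n) = f.symm := by
      funext y
      rw [Equiv.symm_apply_eq, shearEquiv_apply (hbij t ht), ← hf, Homeomorph.apply_symm_apply]
    rw [hsymm]
    have hdet : ∀ x, (shearFDeriv a η t x).det ≠ 0 := by
      intro x
      rw [det_shearFDeriv]
      have h1 : |t * dirDeriv a η x| ≤ 1 / 2 := by
        rw [abs_mul]
        exact (mul_le_mul_of_nonneg_left (hη.bound' x) (abs_nonneg t)).trans (hsmall t ht)
      have := (abs_le.1 h1).1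
      intro h; linarith
    refine f.contDiff_symm
      (f₀' := fun x => (shearFDeriv a η t x).toContinuousLinearEquivOfDetNeZero (hdet x)) ?_ ?_
    · intro x
      rw [hfs]
      exact hasFDerivAt_shear hd t x
    · rw [hfs]
      exact hsm.comp (contDiff_const.prodMk contDiff_id)
  · intro x
    rw [shearEquiv_apply (hbij 0 hz)]; simp [shear]
  · intro t ht
    have : (fun x => shearEquiv a η t x - x) = fun x => (t * η x) • a := by
      funext x; rw [shearEquiv_apply (hbij t ht)]; simp [shear]
    rw [this]
    exact (hc.mul_left (f := fun _ => t)).smul_right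
  · intro t ht
    rw [shearEquiv_coe (hbij t ht)]
    exact image_shear_eq_self (hbij t ht) hΩ
  · intro t ht
    rw [shearEquiv_coe (hbij t ht), ← measure_congr (image_shear_ae_eq hd t hAE),
      ← measure_congr hAE]
    exact volume_image_shear ha hd hη (hsmall t ht) hA hAb h0

/-- The Euler-Lagrange equation, in weak form, for profiles which preserve the volume of `E`. The
set `A` is a measurable representative of `E`. -/
theorem weak_eulerLagrange (hn : 2 ≤ n) (hs : s ∈ Ioo (0 : ℝ) 1) (ha : ‖a‖ = 1)
    {K₁ K₂ g : Space n → ℝ} {σ M₁ M₂ : ℝ}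
    (hk₁ : KernelPair s C a K₁ (dirDeriv a K₁)) (hk₂ : KernelPair s C a K₂ (dirDeriv a K₂))
    (h₁0 : ∀ z, z ≠ 0 → 0 ≤ K₁ z) (h₂0 : ∀ z, z ≠ 0 → 0 ≤ K₂ z)
    (hg : ContDiff ℝ 1 g) (hΩo : IsOpen Ω) (hΩb : Bornology.IsBounded Ω)
    (hE : IsVolumeConstrainedCritical K₁ K₂ σ g Ω E)
    (hA : MeasurableSet A) (hAE' : A ⊆ E) (hAE : A =ᵐ[volume] E)
    (hη : ContDiff ℝ ∞ η) (hc : HasCompactSupport η) (hS : IsCompact S) (hηS : tsupport η ⊆ S)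
    (hηΩ : tsupport η ⊆ Ω) (h0 : ∫ x in A, dirDeriv a η x = 0)
    (hM₁ : CrossBound A (Ω \ A) S M₁) (hM₂ : CrossBound A Ωᶜ S M₂) :
    interactionVariation K₁ (dirDeriv a K₁) A (Ω \ A) η (dirDeriv a η) +
      σ * interactionVariation K₂ (dirDeriv a K₂) A Ωᶜ η (dirDeriv a η) +
      ∫ x in A, (dirDeriv a η x * g x + η x * dirDeriv a g x) = 0 := by
  obtain ⟨L, hprof⟩ := exists_profile ha hη hc hS hηS
  have hL := hprof.lip_nonneg
  have hd : Differentiable ℝ η := hη.differentiable (by simp)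
  have hAΩ : A ⊆ Ω := hAE'.trans hE.subset
  have hAb : Bornology.IsBounded A := hΩb.subset hAΩ
  have hδ : 0 < 1 / (2 * (L + 1)) := by positivity
  have hadm := isAdmissibleVariation_shear hn ha hη hc hprof hηΩ hA hAb hAE h0
  have hcrit := hE.critical _ hδ _ hadm
  have hcompl : (Eᶜ ∩ Ω : Set (Space n)) =ᵐ[volume] (Ω \ A : Set (Space n)) := by
    rw [sdiff_eq, inter_comm]
    exact (ae_eq_refl _).inter hAE.compl.symm
  have hfin₁ : interaction K₁ A (Ω \ A) < ⊤ := by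
    rw [interaction_congr hAE hcompl.symm]; exact hE.finite_inner
  have hfin₂ : interaction K₂ A Ωᶜ < ⊤ := by
    rw [interaction_congr_left hAE]; exact hE.finite_outer
  have hder := ((hasDerivAt_interaction hn hs ha hk₁ h₁0 hd hprof hA (hΩo.measurableSet.diff hA)
    hfin₁ hM₁).add ((hasDerivAt_interaction hn hs ha hk₂ h₂0 hd hprof hA hΩo.measurableSet.compl
    hfin₂ hM₂).const_mul σ)).add (hasDerivAt_setIntegral_shear ha hd hprof hA hAb hg)
  refine hder.unique (hcrit.congr_of_eventuallyEq ?_)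
  filter_upwards [Ioo_mem_nhds (neg_lt_zero.2 hδ) hδ] with t ht
  have ht' : |t| * L ≤ 1 / 2 := by
    have : |t| ≤ 1 / (2 * (L + 1)) := (abs_lt.2 ht).le
    calc |t| * L ≤ 1 / (2 * (L + 1)) * (L + 1) := by gcongr; linarith
      _ = 1 / 2 := by field_simp
  have hb := shear_bijective hn ha hprof ht'
  have hΩ := image_shear_eq_self hb hηΩ
  have e1 : (shear a η t '' E : Set (Space n)) =ᵐ[volume] (shear a η t '' A : Set (Space n)) :=
    image_shear_ae_eq hd t hAE.symm
  have e2 : ((shear a η t '' E)ᶜ ∩ Ω : Set (Space n)) =ᵐ[volume]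
      (shear a η t '' (Ω \ A) : Set (Space n)) := by
    have : (shear a η t '' E)ᶜ ∩ Ω = shear a η t '' (Eᶜ ∩ Ω) := by
      rw [image_inter hb.1, hΩ, image_compl_eq hb]
    rw [this]
    exact image_shear_ae_eq hd t hcompl
  have e3 : shear a η t '' Ωᶜ = Ωᶜ := by rw [image_compl_eq hb, hΩ]
  unfold capillarityEnergy
  rw [shearEquiv_coe hb, interaction_congr e1 e2, interaction_congr_left e1,
    setIntegral_congr_set e1]
  simp only [Pi.add_apply]
  rw [e3]

end admissible

/-! ### Truncated kernels and their potentials -/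

/-- A bounded integrable even kernel `k` which has everywhere a derivative `k'` in the direction
`a`. -/
structure RegularKernel {n : ℕ} (s C : ℝ) (a : Space n) (k k' : Space n → ℝ) : Prop where
  even : ∀ z, k (-z) = k z
  bound : ∀ z, |k z| ≤ C * (1 + ‖z‖) ^ (-((n : ℝ) + s))
  bound' : ∀ z, |k' z| ≤ C * (1 + ‖z‖) ^ (-((n : ℝ) + s))
  deriv : ∀ z, HasDerivAt (fun t : ℝ => k (z + t • a)) (k' z) 0
  cont : Continuous k
  cont' : Continuous k'

/-- A smooth bump at the origin: equal to one on `B_{1/2}` and supported in `B_1`. -/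
def originBump (n : ℕ) : ContDiffBump (0 : Space n) := ⟨1 / 2, 1, by norm_num, by norm_num⟩

/-- A smooth even function which vanishes near the origin and equals one outside the unit ball. -/
def originCutoff {n : ℕ} (z : Space n) : ℝ := 1 - originBump n z

/-- The kernel `k`, smoothly truncated in `B_ε`. -/
def truncKernel {n : ℕ} (ε : ℝ) (k : Space n → ℝ) (z : Space n) : ℝ :=
  originCutoff (ε⁻¹ • z) * k z

/-- The derivative of the truncated kernel `truncKernel ε k` in the direction `a`. -/
def truncKernelDeriv {n : ℕ} (ε : ℝ) (a : Space n) (k k' : Space n → ℝ) (z : Space n) : ℝ :=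
  originCutoff (ε⁻¹ • z) * k' z + ε⁻¹ * dirDeriv a originCutoff (ε⁻¹ • z) * k z

section truncation

variable {n : ℕ} {s C ε : ℝ} {a : Space n} {k k' : Space n → ℝ}

lemma contDiff_originCutoff : ContDiff ℝ ∞ (originCutoff (n := n)) :=
  contDiff_const.sub (originBump n).contDiff

lemma originCutoff_neg (z : Space n) : originCutoff (-z) = originCutoff z := by
  unfold originCutoff; rw [ContDiffBump.neg]

lemma abs_originCutoff_le (z : Space n) : |originCutoff z| ≤ 1 := by
  unfold originCutoff
  rw [abs_le]
  constructor <;> linarith [(originBump n).nonneg (x := z), (originBump n).le_one (x := z)]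

lemma originCutoff_eq_one {z : Space n} (hz : 1 ≤ ‖z‖) : originCutoff z = 1 := by
  unfold originCutoff
  rw [(originBump n).zero_of_le_dist (by simpa [originBump] using hz), sub_zero]

lemma originCutoff_eq_zero {z : Space n} (hz : ‖z‖ ≤ 1 / 2) : originCutoff z = 0 := by
  unfold originCutoff
  rw [(originBump n).one_of_mem_closedBall (by simpa [originBump] using hz), sub_self]

lemma continuous_dirDeriv_originCutoff : Continuous (dirDeriv a (originCutoff (n := n))) :=
  (contDiff_originCutoff.continuous_fderiv (by simp)).clm_apply continuous_const

lemma dirDeriv_originCutoff_eq_zero {z : Space n} (hz : 1 < ‖z‖) :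
    dirDeriv a originCutoff z = 0 := by
  have : originCutoff =ᶠ[𝓝 z] fun _ => (1 : ℝ) := by
    filter_upwards [(isOpen_lt continuous_const continuous_norm).mem_nhds hz] with y hy
    exact originCutoff_eq_one (le_of_lt hy)
  unfold dirDeriv
  rw [this.fderiv_eq]; simp

lemma dirDeriv_originCutoff_eq_zero' {z : Space n} (hz : ‖z‖ < 1 / 2) :
    dirDeriv a originCutoff z = 0 := by
  have : originCutoff =ᶠ[𝓝 z] fun _ => (0 : ℝ) := by
    filter_upwards [(isOpen_lt continuous_norm continuous_const).mem_nhds hz] with y hy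
    exact originCutoff_eq_zero (le_of_lt hy)
  unfold dirDeriv
  rw [this.fderiv_eq]; simp

lemma exists_bound_dirDeriv_originCutoff (a : Space n) :
    ∃ D, 0 ≤ D ∧ ∀ z, |dirDeriv a originCutoff z| ≤ D := by
  obtain ⟨D, hD⟩ := (isCompact_closedBall (0 : Space n) 1).exists_bound_of_continuousOn
    (continuous_dirDeriv_originCutoff (a := a)).continuousOn
  refine ⟨|D|, abs_nonneg D, fun z => ?_⟩
  by_cases hz : ‖z‖ ≤ 1
  · exact (hD z (mem_closedBall_zero_iff.2 hz)).trans (le_abs_self D)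
  · rw [dirDeriv_originCutoff_eq_zero (not_le.1 hz)]; simp

lemma norm_inv_smul (hε : 0 < ε) (z : Space n) : ‖ε⁻¹ • z‖ = ‖z‖ / ε := by
  rw [norm_smul, norm_inv, Real.norm_of_nonneg hε.le]; field_simp

lemma truncKernel_eq (hε : 0 < ε) {z : Space n} (hz : ε ≤ ‖z‖) : truncKernel ε k z = k z := by
  unfold truncKernel
  rw [originCutoff_eq_one, one_mul]
  rw [norm_inv_smul hε, le_div_iff₀ hε]; linarith

lemma truncKernelDeriv_eq (hε : 0 < ε) {z : Space n} (hz : ε < ‖z‖) :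
    truncKernelDeriv ε a k k' z = k' z := by
  have h1 : 1 < ‖ε⁻¹ • z‖ := by rw [norm_inv_smul hε, lt_div_iff₀ hε]; linarith
  unfold truncKernelDeriv
  rw [originCutoff_eq_one h1.le, dirDeriv_originCutoff_eq_zero h1]; simp

lemma truncKernel_eq_zero (hε : 0 < ε) {z : Space n} (hz : ‖z‖ ≤ ε / 2) :
    truncKernel ε k z = 0 := by
  unfold truncKernel
  rw [originCutoff_eq_zero, zero_mul]
  rw [norm_inv_smul hε, div_le_iff₀ hε]; linarith

lemma truncKernelDeriv_eq_zero (hε : 0 < ε) {z : Space n} (hz : ‖z‖ < ε / 2) :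
    truncKernelDeriv ε a k k' z = 0 := by
  have h1 : ‖ε⁻¹ • z‖ < 1 / 2 := by rw [norm_inv_smul hε, div_lt_iff₀ hε]; linarith
  unfold truncKernelDeriv
  rw [originCutoff_eq_zero h1.le, dirDeriv_originCutoff_eq_zero' h1]; simp

lemma hasDerivAt_truncKernel {z : Space n}
    (hk : HasDerivAt (fun t : ℝ => k (z + t • a)) (k' z) 0) :
    HasDerivAt (fun t : ℝ => truncKernel ε k (z + t • a)) (truncKernelDeriv ε a k k' z) 0 := by
  have h1 : HasDerivAt (fun t : ℝ => originCutoff (ε⁻¹ • z + t • a))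
      (dirDeriv a originCutoff (ε⁻¹ • z)) (ε⁻¹ * 0) := by
    simpa using dirDeriv_hasDerivAt (a := a)
      (contDiff_originCutoff.differentiable (by simp)) (ε⁻¹ • z)
  have h2 : HasDerivAt (fun t : ℝ => ε⁻¹ * t) ε⁻¹ 0 := by
    simpa using (hasDerivAt_id (0 : ℝ)).const_mul ε⁻¹
  have h3 := (h1.comp (0 : ℝ) h2).mul hk
  have h4 : (fun t : ℝ => truncKernel ε k (z + t • a)) =
      ((fun t : ℝ => originCutoff (ε⁻¹ • z + t • a)) ∘ fun t : ℝ => ε⁻¹ * t) *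
        fun t => k (z + t • a) := by
    funext t
    simp [truncKernel, smul_add, smul_smul]
  rw [h4]
  refine h3.congr_deriv ?_
  simp [truncKernelDeriv]; ring

lemma originCutoff_comp_continuous : Continuous fun z : Space n => originCutoff (ε⁻¹ • z) :=
  contDiff_originCutoff.continuous.comp (by fun_prop)

/-- Truncation preserves the kernel bounds, uniformly in the truncation parameter. -/
lemma KernelPair.trunc (hn : 2 ≤ n) (hk : KernelPair s C a k k') :
    ∃ C', ∀ ε, 0 < ε → KernelPair s C' a (truncKernel ε k) (truncKernelDeriv ε a k k') := by
  obtain ⟨D, hD0, hD⟩ := exists_bound_dirDeriv_originCutoff a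
  have hC := hk.constant_nonneg hn
  refine ⟨C * (1 + D), fun ε hε => ⟨?_, ?_, ?_, ?_, ?_, ?_⟩⟩
  · intro z
    unfold truncKernel
    rw [smul_neg, originCutoff_neg, hk.even]
  · intro z hz
    have hpos := norm_pos_iff.2 hz
    unfold truncKernel
    rw [abs_mul]
    calc |originCutoff (ε⁻¹ • z)| * |k z| ≤ 1 * (C * ‖z‖ ^ (-((n : ℝ) + s))) :=
          mul_le_mul (abs_originCutoff_le _) (hk.bound z hz) (abs_nonneg _) zero_le_one
      _ ≤ C * (1 + D) * ‖z‖ ^ (-((n : ℝ) + s)) := by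
          rw [one_mul]; gcongr; nlinarith
  · intro z hz
    have hpos := norm_pos_iff.2 hz
    have h1 : |ε⁻¹ * dirDeriv a originCutoff (ε⁻¹ • z)| ≤ ‖z‖⁻¹ * D := by
      by_cases hzε : ‖z‖ ≤ ε
      · rw [abs_mul, abs_of_pos (by positivity : 0 < ε⁻¹)]
        gcongr
        exact hD _
      · rw [dirDeriv_originCutoff_eq_zero]
        · simp; positivity
        · rw [norm_inv_smul hε, lt_div_iff₀ hε]; linarith
    have h2 : ‖z‖⁻¹ * ‖z‖ ^ (-((n : ℝ) + s)) = ‖z‖ ^ (-((n : ℝ) + s) - 1) := by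
      rw [Real.rpow_sub_one hpos.ne']; field_simp
    calc |truncKernelDeriv ε a k k' z|
        ≤ |originCutoff (ε⁻¹ • z)| * |k' z|
          + |ε⁻¹ * dirDeriv a originCutoff (ε⁻¹ • z)| * |k z| := by
          unfold truncKernelDeriv
          rw [← abs_mul, ← abs_mul]; exact abs_add_le _ _
      _ ≤ 1 * (C * ‖z‖ ^ (-((n : ℝ) + s) - 1)) + (‖z‖⁻¹ * D) * (C * ‖z‖ ^ (-((n : ℝ) + s))) :=
          add_le_add
            (mul_le_mul (abs_originCutoff_le _) (hk.bound' z hz) (abs_nonneg _) zero_le_one)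
            (mul_le_mul h1 (hk.bound z hz) (abs_nonneg _) (by positivity))
      _ = C * ‖z‖ ^ (-((n : ℝ) + s) - 1) + D * C * (‖z‖⁻¹ * ‖z‖ ^ (-((n : ℝ) + s))) := by ring
      _ = _ := by rw [h2]; ring
  · intro z hz
    exact hasDerivAt_truncKernel (hk.deriv z hz)
  · exact originCutoff_comp_continuous.continuousOn.mul hk.cont
  · refine (originCutoff_comp_continuous.continuousOn.mul hk.cont').add ?_
    refine ContinuousOn.mul (Continuous.continuousOn ?_) hk.cont
    exact continuous_const.mul (continuous_dirDeriv_originCutoff.comp (by fun_prop))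

lemma continuous_of_vanishing_near_zero {f : Space n → ℝ} (hf : ContinuousOn f {0}ᶜ) {δ : ℝ}
    (hδ : 0 < δ) (h0 : ∀ z, ‖z‖ < δ → f z = 0) : Continuous f := by
  rw [continuous_iff_continuousAt]
  intro z
  by_cases hz : z = 0
  · subst hz
    have : f =ᶠ[𝓝 0] fun _ => 0 := by
      filter_upwards [ball_mem_nhds (0 : Space n) hδ] with y hy
      exact h0 y (mem_ball_zero_iff.1 hy)
    exact (continuousAt_congr this).2 continuousAt_const
  · exact hf.continuousAt (isOpen_compl_singleton.mem_nhds hz)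

lemma KernelPair.regular_trunc (hn : 2 ≤ n) (hs : s ∈ Ioo (0 : ℝ) 1) (hk : KernelPair s C a k k')
    (hε : 0 < ε) :
    ∃ C', RegularKernel s C' a (truncKernel ε k) (truncKernelDeriv ε a k k') := by
  obtain ⟨C', hC'⟩ := hk.trunc hn
  have ht := hC' ε hε
  have hC0 := ht.constant_nonneg hn
  have hq : 0 < (n : ℝ) + s := by have := hs.1; positivity
  -- for `|z| ≥ ε / 2` one has `1 + |z| ≤ (1 + 2 / ε) |z|`
  set m := (1 + 2 / ε) with hm
  have hm0 : 0 < m := by positivity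
  have hcmp : ∀ z : Space n, ε / 2 ≤ ‖z‖ →
      ‖z‖ ^ (-((n : ℝ) + s)) ≤ m ^ ((n : ℝ) + s) * (1 + ‖z‖) ^ (-((n : ℝ) + s)) := by
    intro z hz
    have hzp : 0 < ‖z‖ := by linarith
    have h1 : (1 + ‖z‖) / m ≤ ‖z‖ := by
      rw [div_le_iff₀ hm0, hm, mul_add, mul_one, add_comm]
      gcongr
      rw [mul_div_assoc', le_div_iff₀ hε]; linarith
    have h2 := Real.rpow_le_rpow_of_nonpos (by positivity) h1 (by linarith : -((n : ℝ) + s) ≤ 0)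
    refine h2.trans (le_of_eq ?_)
    rw [Real.div_rpow (by positivity) hm0.le, Real.rpow_neg hm0.le, div_inv_eq_mul, mul_comm]
  refine ⟨C' * m ^ ((n : ℝ) + s) * (1 + 2 / ε), ht.even, ?_, ?_, ?_, ?_, ?_⟩
  · intro z
    by_cases hz : ε / 2 ≤ ‖z‖
    · have hz0 : z ≠ 0 := norm_pos_iff.1 (by linarith)
      calc |truncKernel ε k z| ≤ C' * ‖z‖ ^ (-((n : ℝ) + s)) := ht.bound z hz0
        _ ≤ C' * (m ^ ((n : ℝ) + s) * (1 + ‖z‖) ^ (-((n : ℝ) + s))) := by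
            gcongr; exact hcmp z hz
        _ = C' * m ^ ((n : ℝ) + s) * 1 * (1 + ‖z‖) ^ (-((n : ℝ) + s)) := by ring
        _ ≤ _ := by gcongr; exact le_add_of_nonneg_right (by positivity)
    · rw [truncKernel_eq_zero hε (not_le.1 hz).le]; simp; positivity
  · intro z
    by_cases hz : ε / 2 ≤ ‖z‖
    · have hzp : 0 < ‖z‖ := by linarith
      have h3 : ‖z‖⁻¹ ≤ 1 + 2 / ε := by
        have : ‖z‖⁻¹ ≤ (ε / 2)⁻¹ := by gcongr
        rw [inv_div] at this; linarith
      calc |truncKernelDeriv ε a k k' z| ≤ C' * ‖z‖ ^ (-((n : ℝ) + s) - 1) :=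
            ht.bound' z (norm_pos_iff.1 hzp)
        _ = C' * ‖z‖ ^ (-((n : ℝ) + s)) * ‖z‖⁻¹ := by
            rw [Real.rpow_sub_one hzp.ne']; field_simp
        _ ≤ C' * (m ^ ((n : ℝ) + s) * (1 + ‖z‖) ^ (-((n : ℝ) + s))) * (1 + 2 / ε) := by
            gcongr; exact hcmp z hz
        _ = _ := by ring
    · rw [truncKernelDeriv_eq_zero hε (not_le.1 hz)]; simp; positivity
  · intro z
    by_cases hz : z = 0
    · subst hz
      rw [truncKernelDeriv_eq_zero hε (by simp; positivity)]
      have h1 : (fun t : ℝ => truncKernel ε k (0 + t • a)) =ᶠ[𝓝 0] fun _ => 0 := by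
        have h2 : Tendsto (fun t : ℝ => ‖t • a‖) (𝓝 0) (𝓝 ‖(0 : ℝ) • a‖) :=
          Continuous.tendsto (by fun_prop) 0
        rw [zero_smul, norm_zero] at h2
        filter_upwards [h2.eventually (gt_mem_nhds (by positivity : 0 < ε / 2))] with t ht
        rw [zero_add]
        exact truncKernel_eq_zero hε ht.le
      exact (hasDerivAt_const _ _).congr_of_eventuallyEq h1
    · exact ht.deriv z hz
  · exact continuous_of_vanishing_near_zero ht.cont (half_pos hε)
      fun z hz => truncKernel_eq_zero hε hz.le
  · exact continuous_of_vanishing_near_zero ht.cont' (half_pos hε)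
      fun z hz => truncKernelDeriv_eq_zero hε hz

end truncation

/-- The potential of the set `B`. -/
def potential {n : ℕ} (k : Space n → ℝ) (B : Set (Space n)) (x : Space n) : ℝ :=
  ∫ y in B, k (x - y)

section potential

variable {n : ℕ} {s C L : ℝ} {a : Space n} {k k' η η' : Space n → ℝ} {A B S : Set (Space n)}

lemma integrable_decay (hs : s ∈ Ioo (0 : ℝ) 1) (C : ℝ) :
    Integrable fun z : Space n => C * (1 + ‖z‖) ^ (-((n : ℝ) + s)) := by
  refine Integrable.const_mul ?_ C
  refine integrable_one_add_norm ?_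
  simp only [finrank_euclideanSpace, Fintype.card_fin]
  linarith [hs.1]

lemma decay_translate (hs : s ∈ Ioo (0 : ℝ) 1) {x y : Space n} (h : ‖y - x‖ ≤ 1) :
    (1 + ‖y‖) ^ (-((n : ℝ) + s)) ≤ 2 ^ ((n : ℝ) + s) * (1 + ‖x‖) ^ (-((n : ℝ) + s)) := by
  have hq : 0 < (n : ℝ) + s := by have := hs.1; positivity
  have h1 : (1 + ‖x‖) / 2 ≤ 1 + ‖y‖ := by
    have := norm_le_norm_add_norm_sub' x y
    rw [norm_sub_rev] at this
    linarith [norm_nonneg y]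
  refine (Real.rpow_le_rpow_of_nonpos (by positivity) h1 (by linarith)).trans (le_of_eq ?_)
  rw [Real.div_rpow (by positivity) zero_le_two, Real.rpow_neg zero_le_two, div_inv_eq_mul,
    mul_comm]

lemma integrable_of_decay (hs : s ∈ Ioo (0 : ℝ) 1) (hc : Continuous k)
    (hb : ∀ z, |k z| ≤ C * (1 + ‖z‖) ^ (-((n : ℝ) + s))) (x : Space n) :
    Integrable fun y => k (x - y) := by
  have : Integrable k := (integrable_decay hs C).mono' hc.aestronglyMeasurable
    (ae_of_all _ fun z => hb z)
  exact this.comp_sub_left x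

lemma continuous_potential (hs : s ∈ Ioo (0 : ℝ) 1) (hc : Continuous k)
    (hC : 0 ≤ C) (hb : ∀ z, |k z| ≤ C * (1 + ‖z‖) ^ (-((n : ℝ) + s))) :
    Continuous (potential k B) := by
  rw [continuous_iff_continuousAt]
  intro x
  refine continuousAt_of_dominated
    (bound := fun y => C * (2 ^ ((n : ℝ) + s) * (1 + ‖x - y‖) ^ (-((n : ℝ) + s)))) ?_ ?_ ?_ ?_
  · exact Eventually.of_forall fun x => Continuous.aestronglyMeasurable (by fun_prop)
  · filter_upwards [closedBall_mem_nhds x one_pos] with x' hx'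
    refine ae_of_all _ fun y => (hb _).trans ?_
    have h1 : ‖(x' - y) - (x - y)‖ ≤ 1 := by
      rw [sub_sub_sub_cancel_right, ← dist_eq_norm]; exact hx'
    gcongr
    exact decay_translate hs h1
  · have := (integrable_decay (n := n) hs (C * 2 ^ ((n : ℝ) + s))).comp_sub_left x
    simpa only [mul_assoc] using this.restrict
  · exact ae_of_all _ fun y => Continuous.continuousAt (by fun_prop)

lemma RegularKernel.constant_nonneg (hk : RegularKernel s C a k k') : 0 ≤ C := by
  have := (abs_nonneg _).trans (hk.bound 0)
  simpa using this

lemma RegularKernel.odd' (hk : RegularKernel s C a k k') (z : Space n) : k' (-z) = -k' z := by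
  have h1 := hk.deriv (-z)
  have h2 : HasDerivAt (fun t : ℝ => k (z + t • a)) (k' z) (-0) := by simpa using hk.deriv z
  have h3 : HasDerivAt (fun t : ℝ => k (z + (-t) • a)) (-k' z) 0 := by
    simpa [Function.comp_def] using HasDerivAt.scomp (0 : ℝ) h2 (hasDerivAt_neg 0)
  have h4 : (fun t : ℝ => k (-z + t • a)) = fun t : ℝ => k (z + (-t) • a) := by
    funext t
    rw [← hk.even]; congr 1; rw [neg_add, neg_neg, neg_smul]
  rw [h4] at h1
  exact h1.unique h3

lemma RegularKernel.deriv_line (hk : RegularKernel s C a k k') (z : Space n) (t : ℝ) :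
    HasDerivAt (fun τ : ℝ => k (z + τ • a)) (k' (z + t • a)) t := by
  have h1 : HasDerivAt (fun τ : ℝ => k (z + t • a + τ • a)) (k' (z + t • a)) (t - t) := by
    simpa using hk.deriv (z + t • a)
  refine (h1.comp_sub_const t t).congr_of_eventuallyEq (Eventually.of_forall fun τ => ?_)
  simp only [add_assoc, ← add_smul, add_sub_cancel]

lemma hasDerivAt_potential (hs : s ∈ Ioo (0 : ℝ) 1) (ha : ‖a‖ = 1)
    (hk : RegularKernel s C a k k') (x : Space n) :
    HasDerivAt (fun t : ℝ => potential k B (x + t • a)) (potential k' B x) 0 := by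
  have hC := hk.constant_nonneg
  have hkc := hk.cont
  have hkc' := hk.cont'
  have h := (hasDerivAt_integral_of_dominated_loc_of_deriv_le (𝕜 := ℝ) (μ := volume.restrict B)
    (F := fun t y => k (x + t • a - y)) (F' := fun t y => k' (x + t • a - y)) (x₀ := 0)
    (bound := fun y => C * (2 ^ ((n : ℝ) + s) * (1 + ‖x - y‖) ^ (-((n : ℝ) + s))))
    (closedBall_mem_nhds (0 : ℝ) one_pos) ?_ ?_ ?_ ?_ ?_ ?_).2
  · simpa [potential] using h
  · exact Eventually.of_forall fun t => Continuous.aestronglyMeasurable (by fun_prop)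
  · exact (integrable_of_decay hs hk.cont hk.bound _).restrict
  · exact Continuous.aestronglyMeasurable (by fun_prop)
  · refine ae_of_all _ fun y t ht => (hk.bound' _).trans ?_
    have h1 : ‖(x + t • a - y) - (x - y)‖ ≤ 1 := by
      rw [sub_sub_sub_cancel_right, add_sub_cancel_left, norm_smul, ha, mul_one]
      exact mem_closedBall_zero_iff.1 ht
    gcongr
    exact decay_translate hs h1
  · have := (integrable_decay (n := n) hs (C * 2 ^ ((n : ℝ) + s))).comp_sub_left x
    simpa only [mul_assoc] using this.restrict
  · refine ae_of_all _ fun y t _ => ?_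
    have := hk.deriv_line (x - y) t
    simpa only [sub_add_eq_add_sub] using this

/-- The half of the integrand of the first variation in which the profile is evaluated at the first
point of the pair. -/
def halfVariation (k k' η η' : Space n → ℝ) (p : Space n × Space n) : ℝ :=
  k' p.1 * η p.2 + k p.1 * η' p.2

lemma integrable_halfVariation (hs : s ∈ Ioo (0 : ℝ) 1) (hk : RegularKernel s C a k k')
    (hη : Profile a S L η η') (hA : MeasurableSet A) (hB : MeasurableSet B) :
    Integrable ((crossPairs A B).indicator (halfVariation k k' η η')) := by
  have hcs : HasCompactSupport η := HasCompactSupport.intro hη.compact hη.zero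
  have hcs' : HasCompactSupport η' := HasCompactSupport.intro hη.compact hη.zero'
  have i1 : Integrable η := hη.cont.integrable_of_hasCompactSupport hcs
  have i2 : Integrable η' := hη.cont'.integrable_of_hasCompactSupport hcs'
  have i3 : Integrable k := by
    simpa using (integrable_of_decay hs hk.cont hk.bound 0).comp_neg
  have i4 : Integrable k' := by
    simpa using (integrable_of_decay hs hk.cont' hk.bound' 0).comp_neg
  refine Integrable.indicator ?_ (measurableSet_crossPairs hA hB)
  exact (i4.mul_prod i1).add (i3.mul_prod i2)

lemma integral_halfVariation (hs : s ∈ Ioo (0 : ℝ) 1) (hk : RegularKernel s C a k k')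
    (hη : Profile a S L η η') (hA : MeasurableSet A) (hB : MeasurableSet B) :
    ∫ p, (crossPairs A B).indicator (halfVariation k k' η η') p =
      ∫ x in A, (η x * potential k' B x + η' x * potential k B x) := by
  have hi := integrable_halfVariation hs hk hη hA hB
  rw [Measure.volume_eq_prod] at hi ⊢
  rw [integral_prod_symm _ hi, ← integral_indicator hA]
  refine integral_congr_ae (ae_of_all _ fun x => ?_)
  simp only
  by_cases hx : x ∈ A
  · rw [indicator_of_mem hx]
    have j1 : IntegrableOn (fun y => k (x - y)) B := (integrable_of_decay hs hk.cont hk.bound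
        x).integrableOn
    have j2 : IntegrableOn (fun y => k' (x - y)) B :=
      (integrable_of_decay hs hk.cont' hk.bound' x).integrableOn
    unfold potential
    rw [← integral_const_mul, ← integral_const_mul, ← integral_add (j2.const_mul _) (j1.const_mul _),
      ← integral_indicator hB, ← integral_sub_left_eq_self _ volume x]
    refine integral_congr_ae (ae_of_all _ fun z => ?_)
    simp only
    by_cases hz : z ∈ B
    · have : (x - z, x) ∈ crossPairs A B := ⟨hx, by simpa using hz⟩
      rw [indicator_of_mem hz, indicator_of_mem this]
      simp only [halfVariation]; ring
    · have : (x - z, x) ∉ crossPairs A B := fun h => hz (by simpa using h.2)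
      rw [indicator_of_notMem hz, indicator_of_notMem this]
  · rw [indicator_of_notMem hx]
    have : ∀ z, (z, x) ∉ crossPairs A B := fun z h => hx h.1
    simp [indicator_of_notMem (this _)]

/-- For a regular kernel, the first variation splits into the first variations of the potential
energies of `A` and of `B` in the potentials of each other. -/
theorem interactionVariation_eq_potential (hs : s ∈ Ioo (0 : ℝ) 1) (hk : RegularKernel s C a k k')
    (hη : Profile a S L η η') (hA : MeasurableSet A) (hB : MeasurableSet B) :
    interactionVariation k k' A B η η' =
      (∫ x in A, (η x * potential k' B x + η' x * potential k B x)) +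
        ∫ x in B, (η x * potential k' A x + η' x * potential k A x) := by
  have h1 := integrable_halfVariation hs hk hη hA hB
  have h2 := integrable_halfVariation hs hk hη hB hA
  rw [← integral_halfVariation hs hk hη hA hB, ← integral_halfVariation hs hk hη hB hA]
  -- exchanging the two points of a pair is the change of variables `(z, x) ↦ (-z, x - z)`
  have hmp : MeasurePreserving (fun p : Space n × Space n => (-p.1, p.2 - p.1))
      (volume.prod volume) (volume.prod volume) := by
    have := (Measure.measurePreserving_neg (volume : Measure (Space n))).skew_product
      (g := fun z x => x - z) (μc := volume) (μd := volume) (by fun_prop)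
      (ae_of_all _ fun z => (measurePreserving_sub_right volume z).map_eq)
    exact this
  set G := (crossPairs B A).indicator (halfVariation k k' η η') with hG
  have hsum : ∀ p, (crossPairs A B).indicator (variationIntegrand k k' η η') p =
      (crossPairs A B).indicator (halfVariation k k' η η') p + G (-p.1, p.2 - p.1) := by
    intro p
    have hiff : (-p.1, p.2 - p.1) ∈ crossPairs B A ↔ p ∈ crossPairs A B := by
      simp [crossPairs, and_comm]
    by_cases hp : p ∈ crossPairs A B
    · rw [hG, indicator_of_mem hp, indicator_of_mem hp, indicator_of_mem (hiff.2 hp)]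
      simp only [variationIntegrand, halfVariation, hk.odd', hk.even]; ring
    · rw [hG, indicator_of_notMem hp, indicator_of_notMem hp, indicator_of_notMem (mt hiff.1 hp),
        add_zero]
  have hinv : MeasurableEmbedding (fun p : Space n × Space n => (-p.1, p.2 - p.1)) := by
    have : Function.Involutive (fun p : Space n × Space n => (-p.1, p.2 - p.1)) := by
      intro p; simp
    have hm : Measurable (fun p : Space n × Space n => (-p.1, p.2 - p.1)) := by fun_prop
    exact (MeasurableEquiv.mk (this.toPerm _) hm hm).measurableEmbedding
  have h3 : Integrable (fun p : Space n × Space n => G (-p.1, p.2 - p.1)) := by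
    rw [Measure.volume_eq_prod] at h2 ⊢
    exact (hmp.integrable_comp_emb hinv).2 h2
  have h4 : ∫ p : Space n × Space n, G (-p.1, p.2 - p.1) = ∫ p, G p := by
    rw [Measure.volume_eq_prod]
    exact hmp.integral_comp hinv G
  unfold interactionVariation
  simp_rw [hsum]
  rw [integral_add h1 h3, h4]

end potential

/-! ### The first variation of a flat interface -/

/-- The open half-space `{⟪a, x⟫ > 0}`. -/
def upperHalf {n : ℕ} (a : Space n) : Set (Space n) := {x | 0 < ⟪a, x⟫}

/-- The function which equals `-1` in the half-space `{⟪a, x⟫ > 0}` and `1` in its complement. -/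
def sideSign {n : ℕ} (a : Space n) (x : Space n) : ℝ :=
  (upperHalf a)ᶜ.indicator 1 x - (upperHalf a).indicator 1 x

section flat

variable {n : ℕ} {s C L : ℝ} {a : Space n} {k k' η η' : Space n → ℝ} {A B S H : Set (Space n)}

lemma isOpen_upperHalf : IsOpen (upperHalf a) := isOpen_lt continuous_const (by fun_prop)

lemma measurableSet_upperHalf : MeasurableSet (upperHalf a) := isOpen_upperHalf.measurableSet

lemma sideSign_of_mem {x : Space n} (hx : x ∈ upperHalf a) : sideSign a x = -1 := by
  have : x ∉ (upperHalf a)ᶜ := fun h => h hx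
  rw [sideSign, indicator_of_mem hx, indicator_of_notMem this]; simp

lemma sideSign_of_notMem {x : Space n} (hx : x ∉ upperHalf a) : sideSign a x = 1 := by
  have : x ∈ (upperHalf a)ᶜ := hx
  rw [sideSign, indicator_of_notMem hx, indicator_of_mem this]; simp

lemma measurable_sideSign : Measurable (sideSign a) :=
  (measurable_one.indicator measurableSet_upperHalf.compl).sub
    (measurable_one.indicator measurableSet_upperHalf)

lemma abs_sideSign (x : Space n) : |sideSign a x| = 1 := by
  by_cases hx : x ∈ upperHalf a
  · rw [sideSign_of_mem hx]; simp
  · rw [sideSign_of_notMem hx]; simp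

lemma volume_hyperplane {ℓ : Space n →L[ℝ] ℝ} (hℓ : ℓ ≠ 0) (b : ℝ) :
    volume {x | ℓ x = b} = 0 := by
  obtain ⟨e, he⟩ : ∃ e, ℓ e ≠ 0 := by
    by_contra! h
    exact hℓ (ContinuousLinearMap.ext h)
  have h1 : volume ((LinearMap.ker (ℓ : Space n →ₗ[ℝ] ℝ) : Submodule ℝ (Space n)) :
      Set (Space n)) = 0 := by
    refine Measure.addHaar_submodule volume _ fun h => he ?_
    have : e ∈ LinearMap.ker (ℓ : Space n →ₗ[ℝ] ℝ) := by rw [h]; trivial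
    simpa using this
  have h2 : {x | ℓ x = b} = (fun x => x + (-((b / ℓ e) • e))) ⁻¹'
      ((LinearMap.ker (ℓ : Space n →ₗ[ℝ] ℝ) : Submodule ℝ (Space n)) : Set (Space n)) := by
    ext x
    simp [he, ← sub_eq_add_neg, sub_eq_zero]
  rw [h2, measure_preimage_add_right, h1]

lemma ae_inner_ne_zero (ha : ‖a‖ = 1) : ∀ᵐ x : Space n, ⟪a, x⟫ ≠ 0 := by
  have h0 : innerSL ℝ a ≠ 0 := by
    intro h
    have h1 : innerSL ℝ a a = 0 := by rw [h]; rfl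
    rw [innerSL_apply_apply, real_inner_self_eq_norm_sq, ha] at h1
    norm_num at h1
  have := volume_hyperplane h0 0
  rw [ae_iff]
  simpa using this

/-- An even kernel does not feel a hyperplane through its pole. -/
lemma integral_mul_sideSign_eq_zero (ha : ‖a‖ = 1) (hk : ∀ z, k (-z) = k z) {y : Space n}
    (hy : ⟪a, y⟫ = 0) : ∫ x, k (y - x) * sideSign a x = 0 := by
  have h1 : ∫ x, k (y - x) * sideSign a x = ∫ z, k z * sideSign a (y - z) := by
    rw [← integral_sub_left_eq_self _ volume y]
    simp
  have h2 : ∫ z, k z * sideSign a (y - z) = ∫ z, k z * sideSign a (y + z) := by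
    rw [← integral_neg_eq_self]
    simp [hk]
  have h3 : ∫ z, k z * sideSign a (y + z) = -∫ z, k z * sideSign a (y - z) := by
    rw [← integral_neg]
    refine integral_congr_ae ?_
    filter_upwards [ae_inner_ne_zero ha] with z hz
    rcases lt_or_gt_of_ne hz with h | h
    · have e1 : y + z ∉ upperHalf a := by
        simp only [upperHalf, mem_ofPred_eq, inner_add_right, hy]; linarith
      have e2 : y - z ∈ upperHalf a := by
        simp only [upperHalf, mem_ofPred_eq, inner_sub_right, hy]; linarith
      rw [sideSign_of_mem e2, sideSign_of_notMem e1]; ring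
    · have e1 : y + z ∈ upperHalf a := by
        simp only [upperHalf, mem_ofPred_eq, inner_add_right, hy]; linarith
      have e2 : y - z ∉ upperHalf a := by
        simp only [upperHalf, mem_ofPred_eq, inner_sub_right, hy]; linarith
      rw [sideSign_of_mem e1, sideSign_of_notMem e2]; ring
  rw [h1]; linarith

/-- Orthogonal coordinates `(y, t) ↦ y + t a`, with `y` in the hyperplane orthogonal to `a`. -/
def sliceEquiv (a : Space n) (ha : ‖a‖ = 1) :
    (((ℝ ∙ a)ᗮ : Submodule ℝ (Space n)) × ℝ) ≃L[ℝ] Space n :=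
  LinearEquiv.toContinuousLinearEquiv
    { toFun := fun p => (p.1 : Space n) + p.2 • a
      map_add' := fun p q => by simp [add_smul]; abel
      map_smul' := fun r p => by simp [smul_smul]
      invFun := fun x => (⟨x - ⟪a, x⟫ • a, by
        rw [Submodule.mem_orthogonal_singleton_iff_inner_right, inner_sub_right, inner_smul_right,
          real_inner_self_eq_norm_sq, ha]; ring⟩, ⟪a, x⟫)
      left_inv := fun p => by
        have h1 := Submodule.mem_orthogonal_singleton_iff_inner_right.1 p.1.2
        have h2 : ⟪a, (p.1 : Space n) + p.2 • a⟫ = p.2 := by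
          rw [inner_add_right, h1, inner_smul_right, real_inner_self_eq_norm_sq, ha]; ring
        ext1
        · ext1
          simp only [h2, add_sub_cancel_right]
        · exact h2
      right_inv := fun x => by simp }

lemma sliceEquiv_apply (ha : ‖a‖ = 1) (p : ((ℝ ∙ a)ᗮ : Submodule ℝ (Space n)) × ℝ) :
    sliceEquiv a ha p = (p.1 : Space n) + p.2 • a := rfl

lemma inner_sliceEquiv (ha : ‖a‖ = 1) (p : ((ℝ ∙ a)ᗮ : Submodule ℝ (Space n)) × ℝ) :
    ⟪a, sliceEquiv a ha p⟫ = p.2 := by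
  have h1 := Submodule.mem_orthogonal_singleton_iff_inner_right.1 p.1.2
  rw [sliceEquiv_apply, inner_add_right, h1, inner_smul_right, real_inner_self_eq_norm_sq, ha]
  ring

lemma exists_slice_measure (a : Space n) (ha : ‖a‖ = 1) : ∃ c : ℝ, 0 < c ∧ ∀ f : Space n → ℝ,
    ∫ x, f x = c * ∫ p, f (sliceEquiv a ha p)
      ∂((volume : Measure ((ℝ ∙ a)ᗮ : Submodule ℝ (Space n))).prod volume) := by
  set ν := (volume : Measure ((ℝ ∙ a)ᗮ : Submodule ℝ (Space n))).prod (volume : Measure ℝ) with hν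
  have : (ν.map (sliceEquiv a ha)).IsAddHaarMeasure :=
    (sliceEquiv a ha).isAddHaarMeasure_map ν
  refine ⟨(Measure.addHaarScalarFactor (volume : Measure (Space n)) (ν.map (sliceEquiv a ha))),
    ?_, fun f => ?_⟩
  · exact_mod_cast Measure.addHaarScalarFactor_pos_of_isAddHaarMeasure _ _
  · have h := Measure.isAddLeftInvariant_eq_smul (volume : Measure (Space n))
      (ν.map (sliceEquiv a ha))
    conv_lhs => rw [h]
    have e : ∫ x, f x ∂(ν.map (sliceEquiv a ha)) = ∫ p, f (sliceEquiv a ha p) ∂ν :=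
      (sliceEquiv a ha).toHomeomorph.measurableEmbedding.integral_map f
    rw [integral_smul_nnreal_measure, e]
    rfl

/-- Divergence theorem on the two sides of a hyperplane, in the direction `a` orthogonal to it. The
constant `c` only depends on `a`; its value is not needed. -/
theorem exists_integral_deriv_halfspace (a : Space n) (ha : ‖a‖ = 1) : ∃ c : ℝ, 0 < c ∧
    ∀ (F F' : Space n → ℝ) (S : Set (Space n)), IsCompact S → Continuous F → Continuous F' →
      (∀ x, x ∉ S → F x = 0) → (∀ x, x ∉ S → F' x = 0) →
      (∀ x, HasDerivAt (fun t : ℝ => F (x + t • a)) (F' x) 0) →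
      ∫ x in upperHalf a, F' x = -(c * ∫ y : ((ℝ ∙ a)ᗮ : Submodule ℝ (Space n)), F y) ∧
      ∫ x in (upperHalf a)ᶜ, F' x = c * ∫ y : ((ℝ ∙ a)ᗮ : Submodule ℝ (Space n)), F y := by
  obtain ⟨c, hc, hslice⟩ := exists_slice_measure a ha
  refine ⟨c, hc, fun F F' S hS hF hF' h0 h0' hd => ?_⟩
  set T := sliceEquiv a ha
  have hcs' : HasCompactSupport (F' ∘ T) :=
    (HasCompactSupport.intro hS h0').comp_homeomorph T.toHomeomorph
  have hi : Integrable (F' ∘ T)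
      ((volume : Measure ((ℝ ∙ a)ᗮ : Submodule ℝ (Space n))).prod volume) :=
    (hF'.comp T.continuous).integrable_of_hasCompactSupport hcs'
  have hline : ∀ (y : Space n) (t : ℝ), HasDerivAt (fun τ : ℝ => F (y + τ • a)) (F' (y + t • a)) t := by
    intro y t
    have h1 : HasDerivAt (fun τ : ℝ => F (y + t • a + τ • a)) (F' (y + t • a)) (t - t) := by
      simpa using hd (y + t • a)
    refine (h1.comp_sub_const t t).congr_of_eventuallyEq (Eventually.of_forall fun τ => ?_)
    simp only [add_assoc, ← add_smul, add_sub_cancel]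
  obtain ⟨R, hR⟩ := hS.isBounded.subset_closedBall 0
  have hfar : ∀ (y : Space n) (t : ℝ), R + ‖y‖ < |t| → y + t • a ∉ S := by
    intro y t ht hmem
    have h1 := mem_closedBall_zero_iff.1 (hR hmem)
    have h2 : ‖t • a‖ ≤ ‖y + t • a‖ + ‖y‖ := by
      have := norm_sub_le (y + t • a) y
      rwa [add_sub_cancel_left] at this
    rw [norm_smul, ha, mul_one, Real.norm_eq_abs] at h2
    linarith
  have htop : ∀ y : Space n, Tendsto (fun t : ℝ => F (y + t • a)) atTop (𝓝 0) := by
    intro y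
    refine tendsto_const_nhds.congr' ?_
    filter_upwards [eventually_gt_atTop (R + ‖y‖)] with t ht
    exact (h0 _ (hfar y t (ht.trans_le (le_abs_self t)))).symm
  have hbot : ∀ y : Space n, Tendsto (fun t : ℝ => F (y + t • a)) atBot (𝓝 0) := by
    intro y
    refine tendsto_const_nhds.congr' ?_
    filter_upwards [eventually_lt_atBot (-(R + ‖y‖))] with t ht
    exact (h0 _ (hfar y t ((by linarith : R + ‖y‖ < -t).trans_le (neg_le_abs t)))).symm
  have hcl : ∀ y : Space n, Integrable fun t : ℝ => F' (y + t • a) := by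
    intro y
    refine Continuous.integrable_of_hasCompactSupport (by fun_prop) ?_
    refine HasCompactSupport.intro (isCompact_Icc (a := -(R + ‖y‖)) (b := R + ‖y‖)) fun t ht => ?_
    refine h0' _ (hfar y t ?_)
    by_contra! h
    exact ht (abs_le.1 h)
  have key : ∀ (U : Set (Space n)) (J : Set ℝ), MeasurableSet U → MeasurableSet J →
      (∀ p, T p ∈ U ↔ p.2 ∈ J) → ∫ x in U, F' x =
        c * ∫ y : ((ℝ ∙ a)ᗮ : Submodule ℝ (Space n)), ∫ t in J, F' ((y : Space n) + t • a) := by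
    intro U J hU hJ hUJ
    rw [← integral_indicator hU, hslice]
    congr 1
    have heq : (fun p => U.indicator F' (T p)) = (T ⁻¹' U).indicator (F' ∘ T) := by
      funext p; rfl
    have hTU : MeasurableSet (T ⁻¹' U) := T.continuous.measurable hU
    rw [heq, integral_prod _ (hi.indicator hTU)]
    refine integral_congr_ae (ae_of_all _ fun y => ?_)
    simp only
    rw [← integral_indicator hJ]
    refine integral_congr_ae (ae_of_all _ fun t => ?_)
    simp only
    by_cases ht : t ∈ J
    · have : (y, t) ∈ T ⁻¹' U := (hUJ (y, t)).2 ht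
      rw [indicator_of_mem ht, indicator_of_mem this]; rfl
    · have : (y, t) ∉ T ⁻¹' U := fun h => ht ((hUJ (y, t)).1 h)
      rw [indicator_of_notMem ht, indicator_of_notMem this]
  constructor
  · rw [key _ (Ioi 0) measurableSet_upperHalf measurableSet_Ioi, ← mul_neg, ← integral_neg]
    · congr 2
      funext y
      rw [integral_Ioi_of_hasDerivAt_of_tendsto' (fun t _ => hline y t) (hcl y).integrableOn
        (htop y)]
      simp
    · intro p
      simp only [upperHalf, mem_ofPred_eq, mem_Ioi]
      rw [inner_sliceEquiv]
  · rw [key _ (Iic 0) measurableSet_upperHalf.compl measurableSet_Iic]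
    · congr 2
      funext y
      rw [integral_Iic_of_hasDerivAt_of_tendsto' (fun t _ => hline y t) (hcl y).integrableOn
        (hbot y)]
      simp
    · intro p
      simp only [upperHalf, mem_compl_iff, mem_ofPred_eq, mem_Iic, not_lt]
      rw [inner_sliceEquiv]

end flat

/-- The density of the first variation along a flat interface: for `y` in the hyperplane
`{⟪a, y⟫ = 0}`, this is the left-hand side of the equilibrium condition at `y` for the set
`H ∩ {⟪a, x⟫ > 0}` in the container `H`. The singular part of the mean curvature has disappeared,
since the even kernel `k₁` does not feel the hyperplane. -/
def flatBalance {n : ℕ} (k₁ k₂ : Space n → ℝ) (σ : ℝ) (a : Space n) (H : Set (Space n))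
    (y : Space n) : ℝ :=
  σ * (∫ x in Hᶜ, k₂ (y - x)) - ∫ x in Hᶜ, k₁ (y - x) * sideSign a x

section balance

variable {n : ℕ} {s C L σ : ℝ} {a : Space n} {k k' k₁ k₁' k₂ k₂' η η' : Space n → ℝ}
  {A B S H : Set (Space n)}

/-- The potential difference felt by the interface, for regular kernels. -/
def regularBalance {n : ℕ} (k₁ k₂ : Space n → ℝ) (σ : ℝ) (a : Space n) (H : Set (Space n))
    (y : Space n) : ℝ :=
  potential k₁ (H \ (H ∩ upperHalf a)) y - potential k₁ (H ∩ upperHalf a) y +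
    σ * potential k₂ Hᶜ y

lemma profile_mul_potential (hs : s ∈ Ioo (0 : ℝ) 1) (ha : ‖a‖ = 1)
    (hk : RegularKernel s C a k k') (hη : Profile a S L η η') (x : Space n) :
    HasDerivAt (fun t : ℝ => η (x + t • a) * potential k B (x + t • a))
      (η x * potential k' B x + η' x * potential k B x) 0 := by
  refine ((hη.deriv x).mul (hasDerivAt_potential hs ha hk x)).congr_deriv ?_
  simp; ring

lemma setIntegral_profile_congr (hη : Profile a S L η η') {u v : Space n → ℝ}
    {U V : Set (Space n)} (hU : MeasurableSet U) (hV : MeasurableSet V)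
    (hUV : ∀ x ∈ S, x ∈ U ↔ x ∈ V) :
    ∫ x in U, (η x * u x + η' x * v x) = ∫ x in V, (η x * u x + η' x * v x) := by
  rw [← integral_indicator hU, ← integral_indicator hV]
  refine integral_congr_ae (ae_of_all _ fun x => ?_)
  by_cases hx : x ∈ S
  · by_cases hxU : x ∈ U
    · rw [indicator_of_mem hxU, indicator_of_mem ((hUV x hx).1 hxU)]
    · rw [indicator_of_notMem hxU, indicator_of_notMem (mt (hUV x hx).2 hxU)]
  · have : η x * u x + η' x * v x = 0 := by rw [hη.zero x hx, hη.zero' x hx]; ring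
    simp [indicator, this]

/-- First variation of a flat interface, for regular kernels. -/
theorem exists_flat_variation_regular (hs : s ∈ Ioo (0 : ℝ) 1) (a : Space n) (ha : ‖a‖ = 1) :
    ∃ c : ℝ, 0 < c ∧ ∀ {H S : Set (Space n)} {C₁ C₂ L σ : ℝ}
      {k₁ k₁' k₂ k₂' η η' : Space n → ℝ}, MeasurableSet H → RegularKernel s C₁ a k₁ k₁' →
      RegularKernel s C₂ a k₂ k₂' → Profile a S L η η' → S ⊆ H →
      interactionVariation k₁ k₁' (H ∩ upperHalf a) (H \ (H ∩ upperHalf a)) η η' +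
        σ * interactionVariation k₂ k₂' (H ∩ upperHalf a) Hᶜ η η' =
      -(c * ∫ y : ((ℝ ∙ a)ᗮ : Submodule ℝ (Space n)), η y * regularBalance k₁ k₂ σ a H y) := by
  obtain ⟨c, hc, hdiv⟩ := exists_integral_deriv_halfspace a ha
  refine ⟨c, hc, ?_⟩
  intro H S C₁ C₂ L σ k₁ k₁' k₂ k₂' η η' hH hk₁ hk₂ hη hSH
  have hW : MeasurableSet (H ∩ upperHalf a) := hH.inter measurableSet_upperHalf
  have hcont : ∀ {k k' : Space n → ℝ} {C : ℝ} (B : Set (Space n)), RegularKernel s C a k k' →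
      Continuous (potential k B) ∧ Continuous (potential k' B) := fun B hk =>
    ⟨continuous_potential hs hk.cont hk.constant_nonneg hk.bound,
      continuous_potential hs hk.cont' hk.constant_nonneg hk.bound'⟩
  have hη1 := hη.cont
  have hη2 := hη.cont'
  have key : ∀ {k k' : Space n → ℝ} {C : ℝ} (B : Set (Space n)), RegularKernel s C a k k' →
      ∫ x in upperHalf a, (η x * potential k' B x + η' x * potential k B x) =
        -(c * ∫ y : ((ℝ ∙ a)ᗮ : Submodule ℝ (Space n)), η y * potential k B y) ∧
      ∫ x in (upperHalf a)ᶜ, (η x * potential k' B x + η' x * potential k B x) =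
        c * ∫ y : ((ℝ ∙ a)ᗮ : Submodule ℝ (Space n)), η y * potential k B y := by
    intro k k' C B hk
    obtain ⟨h1, h2⟩ := hcont B hk
    refine hdiv (fun x => η x * potential k B x) _ S hη.compact (by fun_prop) (by fun_prop)
      ?_ ?_ (profile_mul_potential hs ha hk hη)
    · intro x hx; simp [hη.zero x hx]
    · intro x hx; simp [hη.zero x hx, hη.zero' x hx]
  have hcs : ∀ {k k' : Space n → ℝ} {C : ℝ} (B : Set (Space n)), RegularKernel s C a k k' →
      Integrable fun y : ((ℝ ∙ a)ᗮ : Submodule ℝ (Space n)) => η y * potential k B y := by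
    intro k k' C B hk
    obtain ⟨h1, h2⟩ := hcont B hk
    refine Continuous.integrable_of_hasCompactSupport (by fun_prop) ?_
    have hemb : IsClosedEmbedding (Subtype.val : ((ℝ ∙ a)ᗮ : Submodule ℝ (Space n)) → Space n) :=
      (Submodule.isClosed_orthogonal _).isClosedEmbedding_subtypeVal
    have : HasCompactSupport η := HasCompactSupport.intro hη.compact hη.zero
    exact (this.comp_isClosedEmbedding hemb).mul_right
  rw [interactionVariation_eq_potential hs hk₁ hη hW (hH.diff hW),
    interactionVariation_eq_potential hs hk₂ hη hW hH.compl,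
    setIntegral_profile_congr hη hW measurableSet_upperHalf
      (fun x hx => ⟨fun h => h.2, fun h => ⟨hSH hx, h⟩⟩),
    setIntegral_profile_congr hη (hH.diff hW) measurableSet_upperHalf.compl
      (fun x hx => ⟨fun h h' => h.2 ⟨hSH hx, h'⟩, fun h => ⟨hSH hx, fun h' => h h'.2⟩⟩),
    setIntegral_profile_congr hη hW measurableSet_upperHalf
      (fun x hx => ⟨fun h => h.2, fun h => ⟨hSH hx, h⟩⟩),
    setIntegral_profile_congr hη hH.compl MeasurableSet.empty
      (fun x hx => ⟨fun h => absurd (hSH hx) h, fun h => absurd h (notMem_empty x)⟩),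
    (key _ hk₁).1, (key _ hk₁).2, (key _ hk₂).1]
  have hsplit : ∫ y : ((ℝ ∙ a)ᗮ : Submodule ℝ (Space n)), η y * regularBalance k₁ k₂ σ a H y =
      (∫ y : ((ℝ ∙ a)ᗮ : Submodule ℝ (Space n)), η y * potential k₁ (H \ (H ∩ upperHalf a)) y) -
      (∫ y : ((ℝ ∙ a)ᗮ : Submodule ℝ (Space n)), η y * potential k₁ (H ∩ upperHalf a) y) +
      σ * ∫ y : ((ℝ ∙ a)ᗮ : Submodule ℝ (Space n)), η y * potential k₂ Hᶜ y := by
    rw [← integral_const_mul, ← integral_sub (hcs _ hk₁) (hcs _ hk₁)]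
    refine Eq.trans ?_ (integral_add ((hcs (H \ (H ∩ upperHalf a)) hk₁).sub
      (hcs (H ∩ upperHalf a) hk₁)) ((hcs Hᶜ hk₂).const_mul σ))
    refine integral_congr_ae (ae_of_all _ fun y => ?_)
    simp only [regularBalance]; ring
  rw [hsplit]
  simp only [Measure.restrict_empty, integral_zero_measure]
  ring

lemma integrable_trunc_translate (hn : 2 ≤ n) (hs : s ∈ Ioo (0 : ℝ) 1)
    (hk : KernelPair s C a k k') {ε : ℝ} (hε : 0 < ε) (y : Space n) :
    Integrable fun x => truncKernel ε k (y - x) := by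
  obtain ⟨C', hC'⟩ := hk.regular_trunc hn hs hε
  exact integrable_of_decay hs hC'.cont hC'.bound y

/-- The potential difference along the interface does not depend on the truncation. -/
lemma regularBalance_trunc (hn : 2 ≤ n) (hs : s ∈ Ioo (0 : ℝ) 1) (ha : ‖a‖ = 1)
    {C₁ : ℝ} (hk₁ : KernelPair s C₁ a k₁ k₁') (hH : MeasurableSet H)
    {ε : ℝ} (hε : 0 < ε) {y : Space n} (hy : ⟪a, y⟫ = 0) (hyH : ball y ε ⊆ H) :
    regularBalance (truncKernel ε k₁) (truncKernel ε k₂) σ a H y = flatBalance k₁ k₂ σ a H y := by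
  have hfar : ∀ x ∈ Hᶜ, ε ≤ ‖y - x‖ := by
    intro x hx
    by_contra! h
    exact hx (hyH (by rw [mem_ball, dist_comm, dist_eq_norm]; exact h))
  have hint := integrable_trunc_translate hn hs hk₁ hε y
  have hintj : Integrable fun x => truncKernel ε k₁ (y - x) * sideSign a x :=
    hint.mul_bdd (c := 1) measurable_sideSign.aestronglyMeasurable
      (ae_of_all _ fun x => by rw [Real.norm_eq_abs, abs_sideSign])
  have hW : MeasurableSet (H ∩ upperHalf a) := hH.inter measurableSet_upperHalf
  have e1 : potential (truncKernel ε k₁) (H \ (H ∩ upperHalf a)) y =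
      ∫ x in H \ (H ∩ upperHalf a), truncKernel ε k₁ (y - x) * sideSign a x := by
    refine setIntegral_congr_fun (hH.diff hW) fun x hx => ?_
    rw [sideSign_of_notMem (fun h => hx.2 ⟨hx.1, h⟩), mul_one]
  have e2 : -potential (truncKernel ε k₁) (H ∩ upperHalf a) y =
      ∫ x in H ∩ upperHalf a, truncKernel ε k₁ (y - x) * sideSign a x := by
    unfold potential
    rw [← integral_neg]
    refine setIntegral_congr_fun hW fun x hx => ?_
    rw [sideSign_of_mem hx.2, mul_neg_one]
  have e3 := integral_inter_add_sdiff (μ := volume) hW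
    (hintj.integrableOn (s := H))
  have e4 := integral_add_compl hH hintj
  have e5 : ∫ x, truncKernel ε k₁ (y - x) * sideSign a x = 0 := by
    obtain ⟨C', hC'⟩ := hk₁.trunc hn
    exact integral_mul_sideSign_eq_zero ha (hC' ε hε).even hy
  have e6 : ∫ x in Hᶜ, truncKernel ε k₁ (y - x) * sideSign a x =
      ∫ x in Hᶜ, k₁ (y - x) * sideSign a x := by
    refine setIntegral_congr_fun hH.compl fun x hx => ?_
    rw [truncKernel_eq hε (hfar x hx)]
  have e7 : potential (truncKernel ε k₂) Hᶜ y = ∫ x in Hᶜ, k₂ (y - x) := by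
    refine setIntegral_congr_fun hH.compl fun x hx => ?_
    rw [truncKernel_eq hε (hfar x hx)]
  have e8 : H ∩ (H ∩ upperHalf a) = H ∩ upperHalf a := by rw [← inter_assoc, inter_self]
  rw [e8] at e3
  unfold regularBalance flatBalance
  rw [e7, ← e6, e1]
  linarith

/-- First variation of a flat interface for singular kernels: only the values of the kernels on the
complement of the container matter. -/
theorem exists_flat_variation (hn : 2 ≤ n) (hs : s ∈ Ioo (0 : ℝ) 1) (a : Space n) (ha : ‖a‖ = 1) :
    ∃ c : ℝ, 0 < c ∧ ∀ {H S : Set (Space n)} {C L σ M₁ M₂ d : ℝ}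
      {k₁ k₁' k₂ k₂' η η' : Space n → ℝ}, MeasurableSet H → KernelPair s C a k₁ k₁' →
      KernelPair s C a k₂ k₂' → Profile a S L η η' → 0 < d → (∀ y ∈ S, ball y d ⊆ H) →
      CrossBound (H ∩ upperHalf a) (H \ (H ∩ upperHalf a)) S M₁ →
      CrossBound (H ∩ upperHalf a) Hᶜ S M₂ →
      interactionVariation k₁ k₁' (H ∩ upperHalf a) (H \ (H ∩ upperHalf a)) η η' +
        σ * interactionVariation k₂ k₂' (H ∩ upperHalf a) Hᶜ η η' =
      -(c * ∫ y : ((ℝ ∙ a)ᗮ : Submodule ℝ (Space n)), η y * flatBalance k₁ k₂ σ a H y) := by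
  obtain ⟨c, hc, hreg⟩ := exists_flat_variation_regular hs a ha
  refine ⟨c, hc, ?_⟩
  intro H S C L σ M₁ M₂ d k₁ k₁' k₂ k₂' η η' hH hk₁ hk₂ hη hd hSd hM₁ hM₂
  have hW : MeasurableSet (H ∩ upperHalf a) := hH.inter measurableSet_upperHalf
  have hSH : S ⊆ H := fun y hy => hSd y hy (mem_ball_self hd)
  set e : ℕ → ℝ := fun j => d / ((j : ℝ) + 1) with he
  have hepos : ∀ j, 0 < e j := fun j => by positivity
  have hed : ∀ j, e j ≤ d := fun j => by
    rw [he]; simp only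
    exact div_le_self hd.le (by linarith [(Nat.cast_nonneg j : (0 : ℝ) ≤ j)])
  have hel : Tendsto e atTop (𝓝 0) := tendsto_const_div_atTop_nhds_zero_nat d |>.comp
    (tendsto_add_atTop_nat 1) |>.congr fun j => by simp [he]
  have hconst : ∀ j, interactionVariation (truncKernel (e j) k₁) (truncKernelDeriv (e j) a k₁ k₁')
        (H ∩ upperHalf a) (H \ (H ∩ upperHalf a)) η η' +
        σ * interactionVariation (truncKernel (e j) k₂) (truncKernelDeriv (e j) a k₂ k₂')
        (H ∩ upperHalf a) Hᶜ η η' =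
      -(c * ∫ y : ((ℝ ∙ a)ᗮ : Submodule ℝ (Space n)), η y * flatBalance k₁ k₂ σ a H y) := by
    intro j
    obtain ⟨C₁, hC₁⟩ := hk₁.regular_trunc hn hs (hepos j)
    obtain ⟨C₂, hC₂⟩ := hk₂.regular_trunc hn hs (hepos j)
    rw [hreg hH hC₁ hC₂ hη hSH]
    congr 2
    refine integral_congr_ae (ae_of_all _ fun y => ?_)
    simp only
    by_cases hy : (y : Space n) ∈ S
    · rw [regularBalance_trunc hn hs ha hk₁ hH (hepos j)
        (Submodule.mem_orthogonal_singleton_iff_inner_right.1 y.2)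
        ((ball_subset_ball (hed j)).trans (hSd y hy))]
    · rw [hη.zero _ hy]; simp
  have hptw : ∀ {k k' : Space n → ℝ} (z : Space n), z ≠ 0 →
      (∀ᶠ j in atTop, truncKernel (e j) k z = k z) ∧
      ∀ᶠ j in atTop, truncKernelDeriv (e j) a k k' z = k' z := by
    intro k k' z hz
    have := hel.eventually (gt_mem_nhds (norm_pos_iff.2 hz))
    constructor
    · filter_upwards [this] with j hj using truncKernel_eq (hepos j) hj.le
    · filter_upwards [this] with j hj using truncKernelDeriv_eq (hepos j) hj
  have hlim : ∀ {k k' : Space n → ℝ} {B : Set (Space n)} {M : ℝ}, KernelPair s C a k k' →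
      MeasurableSet B → CrossBound (H ∩ upperHalf a) B S M →
      Tendsto (fun j => interactionVariation (truncKernel (e j) k)
        (truncKernelDeriv (e j) a k k') (H ∩ upperHalf a) B η η') atTop
        (𝓝 (interactionVariation k k' (H ∩ upperHalf a) B η η')) := by
    intro k k' B M hk hB hM
    obtain ⟨C', hC'⟩ := hk.trunc hn
    have hk' : KernelPair s (max C C') a k k' :=
      ⟨hk.even, fun z hz => (hk.bound z hz).trans (by gcongr; exact le_max_left _ _),
        fun z hz => (hk.bound' z hz).trans (by gcongr; exact le_max_left _ _),
        hk.deriv, hk.cont, hk.cont'⟩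
    have hkj : ∀ j, KernelPair s (max C C') a (truncKernel (e j) k)
        (truncKernelDeriv (e j) a k k') := fun j =>
      ⟨(hC' _ (hepos j)).even,
        fun z hz => ((hC' _ (hepos j)).bound z hz).trans (by gcongr; exact le_max_right _ _),
        fun z hz => ((hC' _ (hepos j)).bound' z hz).trans (by gcongr; exact le_max_right _ _),
        (hC' _ (hepos j)).deriv, (hC' _ (hepos j)).cont, (hC' _ (hepos j)).cont'⟩
    exact tendsto_interactionVariation hn hs hkj hk'
      (fun z hz => tendsto_const_nhds.congr' ((hptw (k' := k') z hz).1.mono fun j hj => hj.symm))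
      (fun z hz => tendsto_const_nhds.congr' ((hptw z hz).2.mono fun j hj => hj.symm))
      hη (fun _ => hW) (fun _ => hB) hW hB (ae_of_all _ fun x => Eventually.of_forall fun _ => Iff.rfl)
      (ae_of_all _ fun x => Eventually.of_forall fun _ => Iff.rfl) (Eventually.of_forall fun _ => hM)
  have htot := (hlim hk₁ (hH.diff hW) hM₁).add ((hlim hk₂ hH.compl hM₂).const_mul σ)
  simp_rw [hconst] at htot
  exact tendsto_nhds_unique htot tendsto_const_nhds

end balance

/-! ### Pointwise equilibrium of a flat interface -/

section pointwise

variable {n : ℕ} {s C L σ : ℝ} {a : Space n} {k k' k₁ k₁' k₂ k₂' η η' : Space n → ℝ}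
  {A B S H : Set (Space n)}

lemma exists_bump_in (hH : IsOpen H) {v : Space n} (hv : v ∈ H) {U : Set (Space n)} (hU : U ∈ 𝓝 v) :
    ∃ f : ContDiffBump v, closedBall v f.rOut ⊆ H ∩ U := by
  obtain ⟨r, hr, hrs⟩ := Metric.nhds_basis_closedBall.mem_iff.1
    (inter_mem (hH.mem_nhds hv) hU)
  exact ⟨⟨r / 2, r, by positivity, by linarith⟩, hrs⟩

/-- If the first variation of the flat interface vanishes for all profiles supported in the
container, then the equilibrium condition holds at each of its points. -/
theorem flatBalance_eq_zero (hn : 2 ≤ n) (hs : s ∈ Ioo (0 : ℝ) 1) (ha : ‖a‖ = 1)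
    (hH : IsOpen H) (hk₁ : KernelPair s C a k₁ k₁') (hk₂ : KernelPair s C a k₂ k₂')
    (hcrit : ∀ η : Space n → ℝ, ContDiff ℝ ∞ η → HasCompactSupport η → tsupport η ⊆ H →
      (∃ M, CrossBound (H ∩ upperHalf a) (H \ (H ∩ upperHalf a)) (tsupport η) M) ∧
      (∃ M, CrossBound (H ∩ upperHalf a) Hᶜ (tsupport η) M) ∧
      interactionVariation k₁ k₁' (H ∩ upperHalf a) (H \ (H ∩ upperHalf a)) η (dirDeriv a η) +
        σ * interactionVariation k₂ k₂' (H ∩ upperHalf a) Hᶜ η (dirDeriv a η) = 0)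
    {v : Space n} (hv : v ∈ H) (hva : ⟪a, v⟫ = 0) : flatBalance k₁ k₂ σ a H v = 0 := by
  obtain ⟨c, hc, hflat⟩ := exists_flat_variation hn hs a ha
  obtain ⟨d, hd, hdH⟩ := Metric.isOpen_iff.1 hH v hv
  obtain ⟨C₁, hC₁⟩ := hk₁.regular_trunc hn hs (half_pos hd)
  obtain ⟨C₂, hC₂⟩ := hk₂.regular_trunc hn hs (half_pos hd)
  -- near `v`, the equilibrium density coincides with a continuous function
  set q := regularBalance (truncKernel (d / 2) k₁) (truncKernel (d / 2) k₂) σ a H with hq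
  have hqc : Continuous q := by
    have p1 : ∀ B, Continuous (potential (truncKernel (d / 2) k₁) B) := fun B =>
      continuous_potential hs hC₁.cont hC₁.constant_nonneg hC₁.bound
    have p2 : Continuous (potential (truncKernel (d / 2) k₂) Hᶜ) :=
      continuous_potential hs hC₂.cont hC₂.constant_nonneg hC₂.bound
    exact ((p1 _).sub (p1 _)).add (continuous_const.mul p2)
  have hqeq : ∀ y ∈ ball v (d / 2), ⟪a, y⟫ = 0 → q y = flatBalance k₁ k₂ σ a H y := by
    intro y hy hya
    refine regularBalance_trunc hn hs ha hk₁ hH.measurableSet (half_pos hd) hya ?_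
    refine (ball_subset_ball' ?_).trans hdH
    have := mem_ball.1 hy
    linarith
  by_contra hne
  have hqv : q v ≠ 0 := by rwa [hqeq v (mem_ball_self (half_pos hd)) hva]
  -- multiplying by `q v`, one may assume that `q v` is positive
  have hpos : ∀ᶠ y in 𝓝 v, 0 < q v * q y := by
    have : Tendsto (fun y => q v * q y) (𝓝 v) (𝓝 (q v * q v)) :=
      (continuous_const.mul hqc).tendsto v
    exact this.eventually (lt_mem_nhds (mul_self_pos.2 hqv))
  obtain ⟨f, hf⟩ := exists_bump_in hH hv (inter_mem hpos (ball_mem_nhds v (by positivity : 0 < d / 4)))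
  have hts : tsupport f = closedBall v f.rOut := f.tsupport_eq
  have hcs : HasCompactSupport f := f.hasCompactSupport
  have hfs : ContDiff ℝ ∞ f := f.contDiff
  have htH : tsupport f ⊆ H := by rw [hts]; exact fun y hy => (hf hy).1
  obtain ⟨⟨M₁, hM₁⟩, ⟨M₂, hM₂⟩, h0⟩ := hcrit f hfs hcs htH
  obtain ⟨L, hprof⟩ := exists_profile ha hfs hcs hcs.isCompact subset_rfl
  have hfl := hflat (σ := σ) hH.measurableSet hk₁ hk₂ hprof (half_pos hd) ?_ hM₁ hM₂
  · rw [h0] at hfl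
    have hint : ∫ y : ((ℝ ∙ a)ᗮ : Submodule ℝ (Space n)), f y * flatBalance k₁ k₂ σ a H y = 0 := by
      have : c * ∫ y : ((ℝ ∙ a)ᗮ : Submodule ℝ (Space n)), f y * flatBalance k₁ k₂ σ a H y = 0 := by
        linarith
      exact (mul_eq_zero.1 this).resolve_left hc.ne'
    have hcongr : ∀ y : ((ℝ ∙ a)ᗮ : Submodule ℝ (Space n)),
        f y * flatBalance k₁ k₂ σ a H y = f y * q y := by
      intro y
      by_cases hy : (y : Space n) ∈ tsupport f
      · rw [hts] at hy
        rw [hqeq y (ball_subset_ball (by linarith) (hf hy).2.2)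
          (Submodule.mem_orthogonal_singleton_iff_inner_right.1 y.2)]
      · rw [image_eq_zero_of_notMem_tsupport hy]; simp
    simp_rw [hcongr] at hint
    have hemb : IsClosedEmbedding (Subtype.val : ((ℝ ∙ a)ᗮ : Submodule ℝ (Space n)) → Space n) :=
      (Submodule.isClosed_orthogonal _).isClosedEmbedding_subtypeVal
    have hcs2 : HasCompactSupport fun y : ((ℝ ∙ a)ᗮ : Submodule ℝ (Space n)) =>
        f y * (q v * q y) := (hcs.comp_isClosedEmbedding hemb).mul_right
    have hfc := f.continuous
    have hp := Continuous.integral_pos_of_hasCompactSupport_nonneg_nonzero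
      (μ := (volume : Measure ((ℝ ∙ a)ᗮ : Submodule ℝ (Space n))))
      (f := fun y : ((ℝ ∙ a)ᗮ : Submodule ℝ (Space n)) => f y * (q v * q y))
      (x := ⟨v, Submodule.mem_orthogonal_singleton_iff_inner_right.2 hva⟩) (by fun_prop) hcs2 ?_ ?_
    · have : (fun y : ((ℝ ∙ a)ᗮ : Submodule ℝ (Space n)) => f y * (q v * q y)) =
          fun y : ((ℝ ∙ a)ᗮ : Submodule ℝ (Space n)) => q v * (f y * q y) := by funext y; ring
      rw [this, integral_const_mul, hint, mul_zero] at hp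
      exact lt_irrefl _ hp
    · intro y
      by_cases hy : (y : Space n) ∈ tsupport f
      · rw [hts] at hy
        exact mul_nonneg f.nonneg (le_of_lt (hf hy).2.1)
      · simp only [Pi.zero_apply]
        rw [image_eq_zero_of_notMem_tsupport hy]; simp
    · have h1 : f v = 1 := f.one_of_mem_closedBall (mem_closedBall_self f.rIn_pos.le)
      simp only [h1, one_mul]
      exact mul_ne_zero hqv hqv
  · intro y hy
    rw [hts] at hy
    refine (ball_subset_ball' ?_).trans hdH
    have := mem_ball.1 (hf hy).2.2
    linarith

/-- There is a profile, supported in the container, which changes the volume of the set enclosed by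
the flat interface at first order. -/
theorem exists_volume_changing_profile (ha : ‖a‖ = 1) (hH : IsOpen H) {v : Space n} (hv : v ∈ H)
    (hva : ⟪a, v⟫ = 0) : ∃ η : Space n → ℝ, ContDiff ℝ ∞ η ∧ HasCompactSupport η ∧
      tsupport η ⊆ H ∧ ∫ x in H ∩ upperHalf a, dirDeriv a η x ≠ 0 := by
  obtain ⟨c, hc, hdiv⟩ := exists_integral_deriv_halfspace a ha
  obtain ⟨f, hf⟩ := exists_bump_in hH hv univ_mem
  have hts : tsupport f = closedBall v f.rOut := f.tsupport_eq
  have hcs : HasCompactSupport f := f.hasCompactSupport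
  have hfs : ContDiff ℝ ∞ f := f.contDiff
  have htH : tsupport f ⊆ H := by rw [hts]; exact fun y hy => (hf hy).1
  obtain ⟨L, hprof⟩ := exists_profile ha hfs hcs hcs.isCompact subset_rfl
  refine ⟨f, hfs, hcs, htH, ?_⟩
  have h1 := setIntegral_profile_congr hprof (u := fun _ => 0) (v := fun _ => 1)
    (hH.measurableSet.inter measurableSet_upperHalf) (measurableSet_upperHalf (a := a))
    (fun x hx => ⟨fun h => h.2, fun h => ⟨htH hx, h⟩⟩)
  simp only [mul_zero, mul_one, zero_add] at h1
  rw [h1, (hdiv f _ _ hprof.compact hprof.cont hprof.cont' hprof.zero hprof.zero' hprof.deriv).1]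
  have hemb : IsClosedEmbedding (Subtype.val : ((ℝ ∙ a)ᗮ : Submodule ℝ (Space n)) → Space n) :=
    (Submodule.isClosed_orthogonal _).isClosedEmbedding_subtypeVal
  have hfc := f.continuous
  have hp := Continuous.integral_pos_of_hasCompactSupport_nonneg_nonzero
      (μ := (volume : Measure ((ℝ ∙ a)ᗮ : Submodule ℝ (Space n))))
      (f := fun y : ((ℝ ∙ a)ᗮ : Submodule ℝ (Space n)) => f y)
      (x := ⟨v, Submodule.mem_orthogonal_singleton_iff_inner_right.2 hva⟩) (by fun_prop)
      (hcs.comp_isClosedEmbedding hemb) (fun y => f.nonneg) (by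
        have h1 : f v = 1 := f.one_of_mem_closedBall (mem_closedBall_self f.rIn_pos.le)
        simp only [h1]; exact one_ne_zero)
  exact (neg_neg_of_pos (mul_pos hc hp)).ne

lemma integrableOn_kernel_of_far (hn : 2 ≤ n) (hs : s ∈ Ioo (0 : ℝ) 1)
    (hk : KernelPair s C a k k') {v : Space n} {ε : ℝ} (hε : 0 < ε) {U : Set (Space n)}
    (hU : MeasurableSet U) (hfar : ∀ x ∈ U, ε ≤ ‖v - x‖) : IntegrableOn (fun x => k (v - x)) U := by
  refine ((integrable_trunc_translate hn hs hk hε v).integrableOn (s := U)).congr_fun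
    (fun x hx => ?_) hU
  exact truncKernel_eq hε (hfar x hx)

/-- The equilibrium condition in terms of the nonlocal mean curvature. -/
theorem nonlocalMeanCurvature_of_flatBalance (hn : 2 ≤ n) (hs : s ∈ Ioo (0 : ℝ) 1) (ha : ‖a‖ = 1)
    (hH : IsOpen H) (hk₁ : KernelPair s C a k₁ k₁') (hk₂ : KernelPair s C a k₂ k₂')
    {v : Space n} (hv : v ∈ H) (hva : ⟪a, v⟫ = 0) (h0 : flatBalance k₁ k₂ σ a H v = 0) :
    ∃ h : ℝ, HasNonlocalMeanCurvature k₁ (H ∩ upperHalf a) v h ∧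
      IntegrableOn (fun z => k₁ (v - z)) Hᶜ ∧ IntegrableOn (fun z => k₂ (v - z)) Hᶜ ∧
      h - (∫ z in Hᶜ, k₁ (v - z)) + σ * (∫ z in Hᶜ, k₂ (v - z)) = 0 := by
  obtain ⟨d, hd, hdH⟩ := Metric.isOpen_iff.1 hH v hv
  have hfarH : ∀ x ∈ Hᶜ, d ≤ ‖v - x‖ := by
    intro x hx
    by_contra! h
    exact hx (hdH (by rw [mem_ball, dist_comm, dist_eq_norm]; exact h))
  have hfarB : ∀ ε : ℝ, ∀ x ∈ (ball v ε)ᶜ, ε ≤ ‖v - x‖ := by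
    intro ε x hx
    rw [← dist_eq_norm, dist_comm]
    simpa using hx
  have hi₁ := integrableOn_kernel_of_far hn hs hk₁ hd hH.measurableSet.compl hfarH
  have hi₂ := integrableOn_kernel_of_far hn hs hk₂ hd hH.measurableSet.compl hfarH
  have hbdd : ∀ {w : Space n → ℝ} {U : Set (Space n)}, Measurable w → (∀ x, |w x| ≤ 2) →
      IntegrableOn (fun x => k₁ (v - x)) U → IntegrableOn (fun x => k₁ (v - x) * w x) U :=
    fun hw hw2 hi => Integrable.mul_bdd (c := 2) hi hw.aestronglyMeasurable (ae_of_all _ hw2)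
  have hF : MeasurableSet (H ∩ upperHalf a) := hH.measurableSet.inter measurableSet_upperHalf
  set w : Space n → ℝ := fun x => (H ∩ upperHalf a)ᶜ.indicator 1 x - (H ∩ upperHalf a).indicator 1 x
    with hw
  have hw1 : ∀ x ∈ H ∩ upperHalf a, w x = -1 := by
    intro x hx
    have : x ∉ (H ∩ upperHalf a)ᶜ := fun h => h hx
    simp only [hw]
    rw [indicator_of_mem hx, indicator_of_notMem this]; simp
  have hw2 : ∀ x, x ∉ H ∩ upperHalf a → w x = 1 := by
    intro x hx
    have : x ∈ (H ∩ upperHalf a)ᶜ := hx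
    simp only [hw]
    rw [indicator_of_notMem hx, indicator_of_mem this]; simp
  have hwm : Measurable w :=
    (measurable_one.indicator hF.compl).sub (measurable_one.indicator hF)
  have hwb : ∀ x, |w x| ≤ 2 := by
    intro x
    by_cases hx : x ∈ H ∩ upperHalf a
    · rw [hw1 x hx]; norm_num
    · rw [hw2 x hx]; norm_num
  have hjb : ∀ x, |sideSign a x| ≤ 2 := fun x => by rw [abs_sideSign]; norm_num
  have hwj : ∀ x ∈ H, w x = sideSign a x := by
    intro x hx
    by_cases hxa : x ∈ upperHalf a
    · rw [hw1 x ⟨hx, hxa⟩, sideSign_of_mem hxa]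
    · rw [hw2 x (fun h => hxa h.2), sideSign_of_notMem hxa]
  have hwHc : ∀ x ∈ Hᶜ, w x = 1 := fun x hx => hw2 x fun h => hx h.1
  refine ⟨(∫ z in Hᶜ, k₁ (v - z)) - ∫ z in Hᶜ, k₁ (v - z) * sideSign a z, ⟨?_, ?_⟩, hi₁, hi₂, ?_⟩
  · intro ε hε
    exact hbdd hwm hwb (integrableOn_kernel_of_far hn hs hk₁ hε measurableSet_ball.compl (hfarB ε))
  · refine tendsto_const_nhds.congr' ?_
    filter_upwards [Ioo_mem_nhdsGT hd] with ε hε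
    have hiB := integrableOn_kernel_of_far hn hs hk₁ hε.1 measurableSet_ball.compl (hfarB ε)
    have hcompl : Hᶜ ⊆ (ball v ε)ᶜ :=
      compl_subset_compl.2 ((ball_subset_ball hε.2.le).trans hdH)
    -- the hyperplane does not contribute
    have e1 : ∫ x in (ball v ε)ᶜ, k₁ (v - x) * sideSign a x = 0 := by
      have hodd := integral_mul_sideSign_eq_zero (k := (ball (0 : Space n) ε)ᶜ.indicator k₁) ha
        (fun z => by
          by_cases hz : z ∈ (ball (0 : Space n) ε)ᶜ
          · have : -z ∈ (ball (0 : Space n) ε)ᶜ := by simpa using hz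
            rw [indicator_of_mem hz, indicator_of_mem this, hk₁.even]
          · have : -z ∉ (ball (0 : Space n) ε)ᶜ := by simpa using hz
            rw [indicator_of_notMem hz, indicator_of_notMem this]) hva
      rw [← integral_indicator measurableSet_ball.compl, ← hodd]
      refine integral_congr_ae (ae_of_all _ fun x => ?_)
      have hiff : v - x ∈ (ball (0 : Space n) ε)ᶜ ↔ x ∈ (ball v ε)ᶜ := by
        simp [dist_eq_norm, norm_sub_rev]
      simp only
      by_cases hx : x ∈ (ball v ε)ᶜ
      · rw [indicator_of_mem hx, indicator_of_mem (hiff.2 hx)]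
      · rw [indicator_of_notMem hx, indicator_of_notMem (mt hiff.1 hx), zero_mul]
    have e2 : ∫ x in (ball v ε)ᶜ, k₁ (v - x) * (w x - sideSign a x) =
        ∫ x in Hᶜ, k₁ (v - x) * (w x - sideSign a x) := by
      refine setIntegral_eq_of_subset_of_forall_sdiff_eq_zero measurableSet_ball.compl hcompl ?_
      intro x hx
      have hxH : x ∈ H := by
        by_contra h
        exact hx.2 h
      rw [hwj x hxH]; ring
    have e3 : ∫ x in Hᶜ, k₁ (v - x) * (w x - sideSign a x) =
        (∫ z in Hᶜ, k₁ (v - z)) - ∫ z in Hᶜ, k₁ (v - z) * sideSign a z := by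
      rw [← integral_sub hi₁ (hbdd measurable_sideSign hjb hi₁)]
      refine setIntegral_congr_fun hH.measurableSet.compl fun x hx => ?_
      rw [hwHc x hx]; ring
    rw [← e3, ← e2]
    have e4 := integral_sub (hbdd hwm hwb hiB) (hbdd measurable_sideSign hjb hiB)
    rw [e1, sub_zero] at e4
    rw [← e4]
    refine integral_congr_ae (ae_of_all _ fun x => ?_)
    simp only; ring
  · unfold flatBalance at h0
    linarith

/-- If the exterior of the container lies on one side of the interface, equilibrium is impossible:
this is where the strict inequality between the kernels enters. -/
theorem flatBalance_ne_zero (hn : 2 ≤ n) (hs : s ∈ Ioo (0 : ℝ) 1)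
    (hH : IsOpen H) (hk₁ : KernelPair s C a k₁ k₁') (hk₂ : KernelPair s C a k₂ k₂')
    {v : Space n} (hv : v ∈ H) {ε₀ : ℝ} (hε₀ : 0 < ε₀)
    (hσ : ∀ z, z ≠ 0 → |σ| * k₂ z ≤ (1 - ε₀) * k₁ z) (hpos : ∀ z, z ≠ 0 → 0 < k₁ z)
    (hpos₂ : ∀ z, z ≠ 0 → 0 ≤ k₂ z)
    (hHc : 0 < volume Hᶜ)
    (hside : (∀ x ∈ Hᶜ, sideSign a x = 1) ∨ (∀ x ∈ Hᶜ, sideSign a x = -1)) :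
    flatBalance k₁ k₂ σ a H v ≠ 0 := by
  obtain ⟨d, hd, hdH⟩ := Metric.isOpen_iff.1 hH v hv
  have hfarH : ∀ x ∈ Hᶜ, d ≤ ‖v - x‖ := by
    intro x hx
    by_contra! h
    exact hx (hdH (by rw [mem_ball, dist_comm, dist_eq_norm]; exact h))
  have hne : ∀ x ∈ Hᶜ, v - x ≠ 0 := fun x hx => norm_pos_iff.1 (hd.trans_le (hfarH x hx))
  have hi₁ := integrableOn_kernel_of_far hn hs hk₁ hd hH.measurableSet.compl hfarH
  have hi₂ := integrableOn_kernel_of_far hn hs hk₂ hd hH.measurableSet.compl hfarH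
  have hI : 0 < ∫ x in Hᶜ, k₁ (v - x) := by
    rw [setIntegral_pos_iff_support_of_nonneg_ae _ hi₁]
    · refine hHc.trans_le (measure_mono fun x hx => ⟨(hpos _ (hne x hx)).ne', hx⟩)
    · filter_upwards [ae_restrict_mem hH.measurableSet.compl] with x hx
      exact (hpos _ (hne x hx)).le
  have hI2 : 0 ≤ ∫ x in Hᶜ, k₂ (v - x) :=
    setIntegral_nonneg hH.measurableSet.compl fun x hx => hpos₂ _ (hne x hx)
  have hle : |σ| * (∫ x in Hᶜ, k₂ (v - x)) ≤ (1 - ε₀) * ∫ x in Hᶜ, k₁ (v - x) := by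
    rw [← integral_const_mul, ← integral_const_mul]
    exact setIntegral_mono_on (hi₂.const_mul _) (hi₁.const_mul _) hH.measurableSet.compl
      fun x hx => hσ _ (hne x hx)
  have h1 : |σ * ∫ x in Hᶜ, k₂ (v - x)| < ∫ x in Hᶜ, k₁ (v - x) := by
    rw [abs_mul, abs_of_nonneg hI2]
    nlinarith
  rw [abs_lt] at h1
  have hsplit : ∀ τ : ℝ, (∀ x ∈ Hᶜ, sideSign a x = τ) →
      ∫ x in Hᶜ, k₁ (v - x) * sideSign a x = τ * ∫ x in Hᶜ, k₁ (v - x) := by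
    intro τ hτ
    rw [← integral_const_mul]
    refine setIntegral_congr_fun hH.measurableSet.compl fun x hx => ?_
    rw [hτ x hx]; ring
  unfold flatBalance
  rcases hside with h | h
  · rw [hsplit 1 h]; intro h2; linarith [h1.1, h1.2]
  · rw [hsplit (-1) h]; intro h2; linarith [h1.1, h1.2]

end pointwise

/-! ### Rescaled kernels and their blow-up limits -/

section kernels

variable {n : ℕ} {s C lam : ℝ} {ϱ : ℝ≥0∞} {a : Space n} {k k' K Kstar : Space n → ℝ}

lemma div_rpow_eq_mul_rpow_neg (x p : ℝ) (hx : 0 ≤ x) : lam / x ^ p = lam * x ^ (-p) := by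
  rw [Real.rpow_neg hx, div_eq_mul_inv]

lemma IsSmoothKernel.kernelPair (hK : IsSmoothKernel 2 n s lam ϱ K) (ha : ‖a‖ = 1) :
    KernelPair s lam a K (dirDeriv a K) := by
  have hd : ∀ z, z ≠ 0 → DifferentiableAt ℝ K z := fun z hz =>
    ((hK.contDiffOn.differentiableOn (by norm_num)) z hz).differentiableAt
      (isOpen_compl_singleton.mem_nhds hz)
  refine ⟨?_, ?_, ?_, ?_, hK.contDiffOn.continuousOn, ?_⟩
  · intro z
    by_cases hz : z = 0
    · rw [hz, neg_zero]
    · exact hK.even z hz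
  · intro z hz
    rw [abs_of_nonneg (hK.nonneg z hz), ← div_rpow_eq_mul_rpow_neg _ _ (norm_nonneg z)]
    exact hK.upper z hz
  · intro z hz
    have h1 := hK.deriv_bound 1 le_rfl (by norm_num) z hz
    rw [norm_iteratedFDeriv_one, div_rpow_eq_mul_rpow_neg _ _ (norm_nonneg z)] at h1
    have h2 : -((n : ℝ) + s + (1 : ℕ)) = -((n : ℝ) + s) - 1 := by push_cast; ring
    rw [h2] at h1
    refine le_trans ?_ h1
    have := (fderiv ℝ K z).le_opNorm a
    rwa [ha, mul_one] at this
  · intro z hz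
    have h1 : HasFDerivAt K (fderiv ℝ K z) (z + (0 : ℝ) • a) := by simpa using (hd z hz).hasFDerivAt
    have h2 : HasDerivAt (fun t : ℝ => z + t • a) ((1 : ℝ) • a) 0 :=
      ((hasDerivAt_id (0 : ℝ)).smul_const a).const_add z
    have := h1.comp_hasDerivAt (0 : ℝ) h2
    simpa [dirDeriv, Function.comp_def] using this
  · exact (hK.contDiffOn.continuousOn_fderiv_of_isOpen isOpen_compl_singleton
      (by norm_num)).clm_apply continuousOn_const

lemma KernelPair.rescale (hk : KernelPair s C a k k') {r : ℝ} (hr : 0 < r) :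
    KernelPair s C a (fun z => r ^ ((n : ℝ) + s) * k (r • z))
      (fun z => r ^ ((n : ℝ) + s + 1) * k' (r • z)) := by
  have hne : ∀ z : Space n, z ≠ 0 → r • z ≠ 0 := fun z hz => smul_ne_zero hr.ne' hz
  have hmaps : MapsTo (fun z : Space n => r • z) {0}ᶜ {0}ᶜ := fun z hz => hne z hz
  have hcr : ContinuousOn (fun z : Space n => r • z) {0}ᶜ :=
    (continuous_const_smul r).continuousOn
  refine ⟨?_, ?_, ?_, ?_, ?_, ?_⟩
  · intro z
    simp only [smul_neg, hk.even]
  · intro z hz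
    have h1 := hk.bound _ (hne z hz)
    rw [abs_mul, abs_of_pos (Real.rpow_pos_of_pos hr _)]
    calc r ^ ((n : ℝ) + s) * |k (r • z)|
        ≤ r ^ ((n : ℝ) + s) * (C * ‖r • z‖ ^ (-((n : ℝ) + s))) := by gcongr
      _ = C * ‖z‖ ^ (-((n : ℝ) + s)) * (r ^ ((n : ℝ) + s) * r ^ (-((n : ℝ) + s))) := by
          rw [norm_smul, Real.norm_of_nonneg hr.le, Real.mul_rpow hr.le (norm_nonneg z)]; ring
      _ = _ := by rw [← Real.rpow_add hr, add_neg_cancel, Real.rpow_zero, mul_one]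
  · intro z hz
    have h1 := hk.bound' _ (hne z hz)
    rw [abs_mul, abs_of_pos (Real.rpow_pos_of_pos hr _)]
    calc r ^ ((n : ℝ) + s + 1) * |k' (r • z)|
        ≤ r ^ ((n : ℝ) + s + 1) * (C * ‖r • z‖ ^ (-((n : ℝ) + s) - 1)) := by gcongr
      _ = C * ‖z‖ ^ (-((n : ℝ) + s) - 1) *
          (r ^ ((n : ℝ) + s + 1) * r ^ (-((n : ℝ) + s) - 1)) := by
          rw [norm_smul, Real.norm_of_nonneg hr.le, Real.mul_rpow hr.le (norm_nonneg z)]; ring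
      _ = _ := by
          rw [← Real.rpow_add hr]
          have : (n : ℝ) + s + 1 + (-((n : ℝ) + s) - 1) = 0 := by ring
          rw [this, Real.rpow_zero, mul_one]
  · intro z hz
    have h1 : HasDerivAt (fun t : ℝ => k (r • z + t • a)) (k' (r • z)) (r * 0) := by
      simpa using hk.deriv _ (hne z hz)
    have h2 : HasDerivAt (fun t : ℝ => r * t) r 0 := by
      simpa using (hasDerivAt_id (0 : ℝ)).const_mul r
    have h3 := (h1.comp (0 : ℝ) h2).const_mul (r ^ ((n : ℝ) + s))
    have h4 : (fun t : ℝ => r ^ ((n : ℝ) + s) * k (r • (z + t • a))) =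
        fun t : ℝ => r ^ ((n : ℝ) + s) * ((fun t : ℝ => k (r • z + t • a)) ∘ fun t => r * t) t := by
      funext t
      simp [smul_add, smul_smul]
    rw [h4]
    refine h3.congr_deriv ?_
    rw [Real.rpow_add_one hr.ne']; ring
  · exact continuousOn_const.mul (hk.cont.comp hcr hmaps)
  · exact continuousOn_const.mul (hk.cont'.comp hcr hmaps)

/-- The bound on second derivatives makes the rescaled directional derivatives locally Lipschitz,
uniformly in the scale. -/
lemma IsSmoothKernel.lipschitz_rescaled_deriv (hs : s ∈ Ioo (0 : ℝ) 1)
    (hlam : 1 ≤ lam) (hK : IsSmoothKernel 2 n s lam ϱ K)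
    (ha : ‖a‖ = 1) {z : Space n} (hz : z ≠ 0) {r : ℝ} (hr : 0 < r) {x y : Space n}
    (hx : x ∈ ball z (‖z‖ / 2)) (hy : y ∈ ball z (‖z‖ / 2)) :
    |r ^ ((n : ℝ) + s + 1) * dirDeriv a K (r • x) - r ^ ((n : ℝ) + s + 1) * dirDeriv a K (r • y)| ≤
      lam * (‖z‖ / 2) ^ (-((n : ℝ) + s + 2)) * ‖x - y‖ := by
  have hzp := norm_pos_iff.2 hz
  have hq : 0 < (n : ℝ) + s + 2 := by have := hs.1; positivity
  have hC2 : ContDiffOn ℝ 1 (fderiv ℝ K) {0}ᶜ :=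
    hK.contDiffOn.fderiv_of_isOpen isOpen_compl_singleton (by norm_num)
  have hbound : ∀ w ∈ ball (r • z) (r * (‖z‖ / 2)), DifferentiableAt ℝ (fderiv ℝ K) w ∧
      ‖fderiv ℝ (fderiv ℝ K) w‖ ≤ lam * (r * (‖z‖ / 2)) ^ (-((n : ℝ) + s + 2)) := by
    intro w hw
    have h1 : r * (‖z‖ / 2) ≤ ‖w‖ := by
      have h2 := mem_ball.1 hw
      rw [dist_eq_norm, norm_sub_rev] at h2
      have h3 := norm_sub_norm_le (r • z) w
      rw [norm_smul, Real.norm_of_nonneg hr.le] at h3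
      linarith
    have hw0 : w ≠ 0 := norm_pos_iff.1 (lt_of_lt_of_le (by positivity) h1)
    refine ⟨((hC2.differentiableOn one_ne_zero) w hw0).differentiableAt
      (isOpen_compl_singleton.mem_nhds hw0), ?_⟩
    have h4 := hK.deriv_bound 2 (by norm_num) le_rfl w hw0
    have h5 : ‖fderiv ℝ (fderiv ℝ K) w‖ = ‖iteratedFDeriv ℝ 2 K w‖ := by
      rw [← norm_iteratedFDeriv_one, norm_iteratedFDeriv_fderiv]
    rw [h5]
    refine h4.trans ?_
    rw [div_rpow_eq_mul_rpow_neg _ _ (norm_nonneg w)]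
    push_cast
    refine mul_le_mul_of_nonneg_left ?_ (by linarith)
    exact Real.rpow_le_rpow_of_nonpos (by positivity) h1 (by linarith)
  have hmem : ∀ x ∈ ball z (‖z‖ / 2), r • x ∈ ball (r • z) (r * (‖z‖ / 2)) := by
    intro x hx
    rw [mem_ball, dist_smul₀, Real.norm_of_nonneg hr.le]
    exact mul_lt_mul_of_pos_left hx hr
  have hmv := (convex_ball (r • z) (r * (‖z‖ / 2))).norm_image_sub_le_of_norm_fderiv_le (𝕜 := ℝ)
    (fun w hw => (hbound w hw).1) (fun w hw => (hbound w hw).2) (hmem y hy) (hmem x hx)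
  rw [← mul_sub, abs_mul, abs_of_pos (Real.rpow_pos_of_pos hr _)]
  have h6 : |dirDeriv a K (r • x) - dirDeriv a K (r • y)| ≤
      ‖fderiv ℝ K (r • x) - fderiv ℝ K (r • y)‖ := by
    have := (fderiv ℝ K (r • x) - fderiv ℝ K (r • y)).le_opNorm a
    rwa [ha, mul_one] at this
  have h7 : ‖r • x - r • y‖ = r * ‖x - y‖ := by
    rw [← smul_sub, norm_smul, Real.norm_of_nonneg hr.le]
  rw [h7] at hmv
  calc r ^ ((n : ℝ) + s + 1) * |dirDeriv a K (r • x) - dirDeriv a K (r • y)|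
      ≤ r ^ ((n : ℝ) + s + 1) *
        (lam * (r * (‖z‖ / 2)) ^ (-((n : ℝ) + s + 2)) * (r * ‖x - y‖)) := by
        gcongr; exact h6.trans hmv
    _ = lam * (‖z‖ / 2) ^ (-((n : ℝ) + s + 2)) * ‖x - y‖ *
        (r ^ ((n : ℝ) + s + 1) * r ^ (-((n : ℝ) + s + 2)) * r) := by
        rw [Real.mul_rpow hr.le (by positivity)]; ring
    _ = _ := by
        rw [← Real.rpow_add hr, ← Real.rpow_add_one hr.ne']
        have : (n : ℝ) + s + 1 + -((n : ℝ) + s + 2) + 1 = 0 := by ring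
        rw [this, Real.rpow_zero, mul_one]

/-- First order Taylor expansion of the rescaled kernels, uniform in the scale. -/
lemma IsSmoothKernel.taylor_rescaled (hs : s ∈ Ioo (0 : ℝ) 1)
    (hlam : 1 ≤ lam) (hK : IsSmoothKernel 2 n s lam ϱ K)
    (ha : ‖a‖ = 1) {z : Space n} (hz : z ≠ 0) {r : ℝ} (hr : 0 < r) {t : ℝ}
    (ht : |t| < ‖z‖ / 2) :
    |r ^ ((n : ℝ) + s) * K (r • (z + t • a)) - r ^ ((n : ℝ) + s) * K (r • z) -
      t * (r ^ ((n : ℝ) + s + 1) * dirDeriv a K (r • z))| ≤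
      lam * (‖z‖ / 2) ^ (-((n : ℝ) + s + 2)) * |t| * |t| := by
  have hzp := norm_pos_iff.2 hz
  have hkr := (hK.kernelPair ha).rescale hr
  set D := lam * (‖z‖ / 2) ^ (-((n : ℝ) + s + 2)) with hD
  have hD0 : 0 ≤ D := by have : 0 ≤ lam := by linarith
                         positivity
  set f : ℝ → ℝ := fun τ => r ^ ((n : ℝ) + s) * K (r • (z + τ • a)) -
    τ * (r ^ ((n : ℝ) + s + 1) * dirDeriv a K (r • z)) with hf
  have hmemball : ∀ τ : ℝ, |τ| ≤ |t| → z + τ • a ∈ ball z (‖z‖ / 2) := by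
    intro τ hτ
    rw [mem_ball, dist_eq_norm, add_sub_cancel_left, norm_smul, ha, mul_one, Real.norm_eq_abs]
    linarith
  have hne : ∀ τ : ℝ, |τ| ≤ |t| → z + τ • a ≠ 0 := by
    intro τ hτ h0
    have := mem_ball.1 (hmemball τ hτ)
    rw [h0, dist_zero_left] at this
    linarith
  have hder : ∀ τ ∈ Icc (-|t|) |t|, HasDerivWithinAt f
      (r ^ ((n : ℝ) + s + 1) * dirDeriv a K (r • (z + τ • a)) -
        r ^ ((n : ℝ) + s + 1) * dirDeriv a K (r • z)) (Icc (-|t|) |t|) τ := by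
    intro τ hτ
    have h1 := hkr.deriv_line z τ (hne τ (abs_le.2 hτ))
    have h2 : HasDerivAt (fun τ : ℝ => τ * (r ^ ((n : ℝ) + s + 1) * dirDeriv a K (r • z)))
        (r ^ ((n : ℝ) + s + 1) * dirDeriv a K (r • z)) τ := by
      simpa using (hasDerivAt_id τ).mul_const (r ^ ((n : ℝ) + s + 1) * dirDeriv a K (r • z))
    exact (h1.sub h2).hasDerivWithinAt
  have hb : ∀ τ ∈ Icc (-|t|) |t|, ‖r ^ ((n : ℝ) + s + 1) * dirDeriv a K (r • (z + τ • a)) -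
        r ^ ((n : ℝ) + s + 1) * dirDeriv a K (r • z)‖ ≤ D * |t| := by
    intro τ hτ
    have h1 := hK.lipschitz_rescaled_deriv hs hlam ha hz hr (hmemball τ (abs_le.2 hτ))
      (mem_ball_self (by positivity))
    rw [add_sub_cancel_left, norm_smul, ha, mul_one, Real.norm_eq_abs] at h1
    exact h1.trans (mul_le_mul_of_nonneg_left (abs_le.2 hτ) hD0)
  have h0mem : (0 : ℝ) ∈ Icc (-|t|) |t| := ⟨by linarith [abs_nonneg t], abs_nonneg t⟩
  have htmem : t ∈ Icc (-|t|) |t| := abs_le.1 le_rfl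
  have hmv := (convex_Icc (-|t|) |t|).norm_image_sub_le_of_norm_hasDerivWithin_le hder hb h0mem htmem
  simp only [hf, zero_smul, add_zero, zero_mul, sub_zero, Real.norm_eq_abs] at hmv
  have e : r ^ ((n : ℝ) + s) * K (r • (z + t • a)) - r ^ ((n : ℝ) + s) * K (r • z) -
      t * (r ^ ((n : ℝ) + s + 1) * dirDeriv a K (r • z)) =
      r ^ ((n : ℝ) + s) * K (r • (z + t • a)) -
      t * (r ^ ((n : ℝ) + s + 1) * dirDeriv a K (r • z)) - r ^ ((n : ℝ) + s) * K (r • z) := by ring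
  rw [e]
  exact hmv

lemma tendsto_rescale_nhds {z : Space n} (hz : z ≠ 0) {t : ℝ}
    (hlim : AdmitsBlowUpLimit s K Kstar) (ha : ‖a‖ = 1) (ht : |t| < ‖z‖ / 2) :
    Tendsto (fun r : ℝ => r ^ ((n : ℝ) + s) * K (r • (z + t • a))) (𝓝[>] 0)
      (𝓝 (Kstar (z + t • a))) := by
  refine hlim _ fun h0 => ?_
  have h1 : ‖z‖ = |t| := by
    rw [eq_neg_of_add_eq_zero_left h0, norm_neg, norm_smul, ha, mul_one, Real.norm_eq_abs]
  have := norm_pos_iff.2 hz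
  linarith

/-- The directional derivatives of the rescaled kernels converge: they are uniformly close to
difference quotients, which converge. -/
lemma IsSmoothKernel.exists_tendsto_rescaled_deriv (hs : s ∈ Ioo (0 : ℝ) 1)
    (hlam : 1 ≤ lam) (hK : IsSmoothKernel 2 n s lam ϱ K) (hlim : AdmitsBlowUpLimit s K Kstar)
    (ha : ‖a‖ = 1) {z : Space n} (hz : z ≠ 0) :
    ∃ l, Tendsto (fun r : ℝ => r ^ ((n : ℝ) + s + 1) * dirDeriv a K (r • z)) (𝓝[>] 0) (𝓝 l) := by
  have hzp := norm_pos_iff.2 hz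
  set D := lam * (‖z‖ / 2) ^ (-((n : ℝ) + s + 2)) with hD
  have hD0 : 0 ≤ D := by have : 0 ≤ lam := by linarith
                         positivity
  rw [← cauchy_map_iff_exists_tendsto, Metric.cauchy_iff]
  refine ⟨inferInstance, fun ε hε => ?_⟩
  obtain ⟨t, ht0, ht1, ht2⟩ : ∃ t : ℝ, 0 < t ∧ t < ‖z‖ / 2 ∧ D * t < ε / 4 := by
    refine ⟨min (‖z‖ / 4) (ε / (8 * (D + 1))), by positivity, ?_, ?_⟩
    · exact (min_le_left _ _).trans_lt (by linarith)
    · calc D * min (‖z‖ / 4) (ε / (8 * (D + 1))) ≤ (D + 1) * (ε / (8 * (D + 1))) := by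
            gcongr
            · linarith
            · exact min_le_right _ _
        _ = ε / 8 := by field_simp
        _ < ε / 4 := by linarith
  have ht' : |t| < ‖z‖ / 2 := by rwa [abs_of_pos ht0]
  have hq : Tendsto (fun r : ℝ => (r ^ ((n : ℝ) + s) * K (r • (z + t • a)) -
      r ^ ((n : ℝ) + s) * K (r • z)) / t) (𝓝[>] 0) (𝓝 ((Kstar (z + t • a) - Kstar z) / t)) :=
    ((tendsto_rescale_nhds hz hlim ha ht').sub (hlim z hz)).div_const t
  set l := (Kstar (z + t • a) - Kstar z) / t with hl
  have hclose : ∀ᶠ r : ℝ in 𝓝[>] 0,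
      |r ^ ((n : ℝ) + s + 1) * dirDeriv a K (r • z) - l| < ε / 2 := by
    filter_upwards [hq.eventually (Metric.ball_mem_nhds l (by positivity : 0 < ε / 4)),
      self_mem_nhdsWithin] with r h1 h2
    have h3 := hK.taylor_rescaled hs hlam ha hz h2 ht'
    rw [abs_of_pos ht0] at h3
    rw [Real.dist_eq] at h1
    set u := r ^ ((n : ℝ) + s + 1) * dirDeriv a K (r • z)
    set w := r ^ ((n : ℝ) + s) * K (r • (z + t • a)) - r ^ ((n : ℝ) + s) * K (r • z)
    have h4 : |w / t - u| ≤ D * t := by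
      have : w / t - u = (w - t * u) / t := by field_simp
      rw [this, abs_div, abs_of_pos ht0, div_le_iff₀ ht0]
      exact h3
    have h5 : u - l = -(w / t - u) + (w / t - l) := by ring
    rw [h5]
    refine (abs_add_le _ _).trans_lt ?_
    rw [abs_neg]
    linarith
  refine ⟨_, image_mem_map hclose, ?_⟩
  rintro _ ⟨r, hr, rfl⟩ _ ⟨r', hr', rfl⟩
  rw [mem_ofPred_eq] at hr hr'
  rw [Real.dist_eq]
  have := abs_sub_le (r ^ ((n : ℝ) + s + 1) * dirDeriv a K (r • z)) l
    (r' ^ ((n : ℝ) + s + 1) * dirDeriv a K (r' • z))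
  rw [abs_sub_comm l] at this
  linarith

lemma IsAnisotropicKernel.continuousOn (h : IsAnisotropicKernel s Kstar) :
    ContinuousOn Kstar {0}ᶜ := by
  obtain ⟨b, hb, -, -, hK⟩ := h
  have h1 : ContinuousOn (fun ζ : Space n => b (‖ζ‖⁻¹ • ζ) / ‖ζ‖ ^ ((n : ℝ) + s)) {0}ᶜ := by
    have hn : ∀ ζ ∈ ({0}ᶜ : Set (Space n)), ‖ζ‖ ≠ 0 := fun ζ hζ => norm_ne_zero_iff.2 hζ
    refine ContinuousOn.div ?_ ?_ ?_
    · refine hb.comp ((continuous_norm.continuousOn.inv₀ hn).smul continuousOn_id) fun ζ hζ => ?_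
      rw [mem_sphere_zero_iff_norm, norm_smul, norm_inv, norm_norm]
      exact inv_mul_cancel₀ (hn ζ hζ)
    · exact continuous_norm.continuousOn.rpow_const fun ζ hζ => Or.inl (hn ζ hζ)
    · exact fun ζ hζ => (Real.rpow_pos_of_pos (norm_pos_iff.2 hζ) _).ne'
  exact h1.congr fun ζ hζ => hK ζ hζ

lemma IsAnisotropicKernel.pos (h : IsAnisotropicKernel s Kstar) {ζ : Space n} (hζ : ζ ≠ 0) :
    0 < Kstar ζ := by
  obtain ⟨b, -, ⟨c, C, hc, hcC⟩, -, hK⟩ := h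
  rw [hK ζ hζ]
  have h1 : ‖ζ‖⁻¹ • ζ ∈ sphere (0 : Space n) 1 := by
    rw [mem_sphere_zero_iff_norm, norm_smul, norm_inv, norm_norm]
    exact inv_mul_cancel₀ (norm_ne_zero_iff.2 hζ)
  exact div_pos (hc.trans_le (hcC _ h1).1) (Real.rpow_pos_of_pos (norm_pos_iff.2 hζ) _)

/-- The blow-up limit of a kernel is again a kernel with a derivative in the direction `a`, to which
the rescaled derivatives converge. -/
theorem IsSmoothKernel.exists_limit_pair (hs : s ∈ Ioo (0 : ℝ) 1)
    (hlam : 1 ≤ lam) (hK : IsSmoothKernel 2 n s lam ϱ K) (hlim : AdmitsBlowUpLimit s K Kstar)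
    (hstar : IsAnisotropicKernel s Kstar) (ha : ‖a‖ = 1) :
    ∃ k', KernelPair s lam a Kstar k' ∧ ∀ z, z ≠ 0 →
      Tendsto (fun r : ℝ => r ^ ((n : ℝ) + s + 1) * dirDeriv a K (r • z)) (𝓝[>] 0) (𝓝 (k' z)) := by
  have hex : ∀ z : Space n, ∃ l, z ≠ 0 →
      Tendsto (fun r : ℝ => r ^ ((n : ℝ) + s + 1) * dirDeriv a K (r • z)) (𝓝[>] 0) (𝓝 l) := by
    intro z
    by_cases hz : z = 0
    · exact ⟨0, fun h => absurd hz h⟩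
    · obtain ⟨l, hl⟩ := hK.exists_tendsto_rescaled_deriv hs hlam hlim ha hz
      exact ⟨l, fun _ => hl⟩
  choose k' hk' using hex
  have hpair := hK.kernelPair (a := a) ha
  have hpos : ∀ᶠ r : ℝ in 𝓝[>] 0, 0 < r := self_mem_nhdsWithin
  refine ⟨k', ⟨?_, ?_, ?_, ?_, hstar.continuousOn, ?_⟩, hk'⟩
  · intro z
    by_cases hz : z = 0
    · rw [hz, neg_zero]
    · refine tendsto_nhds_unique (hlim (-z) (neg_ne_zero.2 hz)) ?_
      simpa only [smul_neg, hpair.even] using hlim z hz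
  · intro z hz
    refine le_of_tendsto (hlim z hz).abs ?_
    filter_upwards [hpos] with r hr using (hpair.rescale hr).bound z hz
  · intro z hz
    refine le_of_tendsto (hk' z hz).abs ?_
    filter_upwards [hpos] with r hr using (hpair.rescale hr).bound' z hz
  · intro z hz
    have hzp := norm_pos_iff.2 hz
    set D := lam * (‖z‖ / 2) ^ (-((n : ℝ) + s + 2)) with hD
    have htay : ∀ t : ℝ, |t| < ‖z‖ / 2 →
        |Kstar (z + t • a) - Kstar z - t * k' z| ≤ D * |t| * |t| := by
      intro t ht
      refine le_of_tendsto (((tendsto_rescale_nhds hz hlim ha ht).sub (hlim z hz)).sub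
        ((hk' z hz).const_mul t)).abs ?_
      filter_upwards [hpos] with r hr using hK.taylor_rescaled hs hlam ha hz hr ht
    rw [hasDerivAt_iff_isLittleO_nhds_zero]
    have hbig : (fun t : ℝ => Kstar (z + (0 + t) • a) - Kstar (z + (0 : ℝ) • a) - t • k' z)
        =O[𝓝 0] fun t : ℝ => t * t := by
      refine Asymptotics.IsBigO.of_bound D ?_
      have : ∀ᶠ t : ℝ in 𝓝 0, |t| < ‖z‖ / 2 := by
        filter_upwards [Metric.ball_mem_nhds (0 : ℝ) (by positivity : 0 < ‖z‖ / 2)] with t ht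
        simpa using ht
      filter_upwards [this] with t ht
      rw [norm_mul, ← mul_assoc]
      simpa using htay t ht
    refine hbig.trans_isLittleO ?_
    have : (fun t : ℝ => t * t) =o[𝓝 0] fun t : ℝ => t * 1 := by
      refine (Asymptotics.isBigO_refl _ _).mul_isLittleO ?_
      exact (Asymptotics.isLittleO_one_iff ℝ).2 tendsto_id
    simpa using this
  · intro z hz
    have hzp := norm_pos_iff.2 (show z ≠ 0 from hz)
    refine ContinuousAt.continuousWithinAt ?_
    set D := lam * (‖z‖ / 2) ^ (-((n : ℝ) + s + 2)) with hD
    have hlip : ∀ x ∈ ball z (‖z‖ / 2), |k' x - k' z| ≤ D * ‖x - z‖ := by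
      intro x hx
      have hx0 : x ≠ 0 := by
        rintro rfl
        rw [mem_ball, dist_zero_left] at hx
        linarith
      refine le_of_tendsto ((hk' x hx0).sub (hk' z hz)).abs ?_
      filter_upwards [hpos] with r hr using
        hK.lipschitz_rescaled_deriv hs hlam ha hz hr hx (mem_ball_self (by positivity))
    rw [ContinuousAt, tendsto_iff_norm_sub_tendsto_zero]
    have hto : Tendsto (fun x : Space n => D * ‖x - z‖) (𝓝 z) (𝓝 0) := by
      have : Continuous fun x : Space n => D * ‖x - z‖ := by fun_prop
      simpa using this.tendsto z
    refine tendsto_of_tendsto_of_tendsto_of_le_of_le' tendsto_const_nhds hto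
      (Eventually.of_forall fun x => norm_nonneg _) ?_
    filter_upwards [ball_mem_nhds z (by positivity : 0 < ‖z‖ / 2)] with x hx using hlip x hx

/-- The strict inequality between the kernels passes to the blow-up limits. -/
lemma limit_kernel_le {K₁ K₂ K₁star K₂star : Space n → ℝ} {σ ε₀ : ℝ} (hε₀ : 0 < ε₀)
    (hlim₁ : AdmitsBlowUpLimit s K₁ K₁star) (hlim₂ : AdmitsBlowUpLimit s K₂ K₂star)
    (hσ : ∀ ζ ∈ ball (0 : Space n) ε₀ \ {0}, |σ| * K₂ ζ ≤ (1 - ε₀) * K₁ ζ) {z : Space n}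
    (hz : z ≠ 0) : |σ| * K₂star z ≤ (1 - ε₀) * K₁star z := by
  refine le_of_tendsto_of_tendsto ((hlim₂ z hz).const_mul |σ|) ((hlim₁ z hz).const_mul (1 - ε₀)) ?_
  have hsmall : ∀ᶠ r : ℝ in 𝓝[>] 0, r < ε₀ / ‖z‖ := by
    have : 0 < ε₀ / ‖z‖ := div_pos hε₀ (norm_pos_iff.2 hz)
    exact (gt_mem_nhds this).filter_mono nhdsWithin_le_nhds
  filter_upwards [hsmall, self_mem_nhdsWithin] with r h1 h2
  have h2' : (0 : ℝ) < r := h2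
  have hmem : r • z ∈ ball (0 : Space n) ε₀ \ {0} := by
    refine ⟨?_, smul_ne_zero h2'.ne' hz⟩
    rw [mem_ball_zero_iff, norm_smul, Real.norm_of_nonneg h2'.le]
    exact (lt_div_iff₀ (norm_pos_iff.2 hz)).1 h1
  have h3 := hσ _ hmem
  have h4 : 0 < r ^ ((n : ℝ) + s) := Real.rpow_pos_of_pos h2' _
  nlinarith

end kernels

/-! ### Sequences of functions which become affine -/

section affine

variable {n : ℕ} {c R ε ρ : ℝ} {ℓ : Space n →L[ℝ] ℝ} {G : ℕ → Space n → ℝ}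

/-- The functions `G j` converge to the affine function `c + ℓ`, locally in the Lipschitz
seminorm. -/
structure AsymptoticallyAffine {n : ℕ} (G : ℕ → Space n → ℝ) (c : ℝ) (ℓ : Space n →L[ℝ] ℝ) :
    Prop where
  oscillation : ∀ R > 0, ∀ ε > 0, ∀ᶠ j in atTop, ∀ y ∈ ball (0 : Space n) R,
    ∀ y' ∈ ball (0 : Space n) R, |G j y - G j y' - ℓ (y - y')| ≤ ε * ‖y - y'‖
  base : Tendsto (fun j => G j 0) atTop (𝓝 c)

/-- Rescalings of a strictly differentiable function become affine. -/
lemma asymptoticallyAffine_of_hasStrictFDerivAt {f : Space n → ℝ} {x₀ : Space n} {x : ℕ → Space n}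
    {r : ℕ → ℝ} (hf : HasStrictFDerivAt f ℓ x₀) (hx : Tendsto x atTop (𝓝 x₀))
    (hr : Tendsto r atTop (𝓝 0)) (hr0 : ∀ j, 0 < r j)
    (hc : Tendsto (fun j => f (x j) / r j) atTop (𝓝 c)) :
    AsymptoticallyAffine (fun j y => f (x j + r j • y) / r j) c ℓ := by
  refine ⟨fun R hR ε hε => ?_, by simpa using hc⟩
  have h1 := hf.isLittleO.def hε
  obtain ⟨δ, hδ, h2⟩ := Metric.eventually_nhds_iff_ball.1 h1
  have h3 : ∀ᶠ j in atTop, ‖x j - x₀‖ + r j * R < δ := by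
    have h4 : Tendsto (fun j => ‖x j - x₀‖ + r j * R) atTop (𝓝 (‖x₀ - x₀‖ + 0 * R)) :=
      ((hx.sub_const x₀).norm).add (hr.mul_const R)
    rw [sub_self, norm_zero, zero_mul, add_zero] at h4
    exact h4.eventually_lt_const hδ
  filter_upwards [h3] with j hj y hy y' hy'
  have hmem : ∀ w ∈ ball (0 : Space n) R, dist (x j + r j • w) x₀ < δ := by
    intro w hw
    rw [mem_ball_zero_iff] at hw
    rw [dist_eq_norm, add_sub_right_comm]
    refine (norm_add_le _ _).trans_lt ?_
    rw [norm_smul, Real.norm_eq_abs, abs_of_pos (hr0 j)]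
    nlinarith [mul_lt_mul_of_pos_left hw (hr0 j)]
  have h5 := h2 (x j + r j • y, x j + r j • y') (by
    rw [mem_ball, Prod.dist_eq]
    exact max_lt (hmem y hy) (hmem y' hy'))
  simp only [add_sub_add_left_eq_sub, ← smul_sub, map_smul, smul_eq_mul, norm_smul,
    Real.norm_eq_abs, abs_of_pos (hr0 j)] at h5
  have h6 : f (x j + r j • y) / r j - f (x j + r j • y') / r j - ℓ (y - y') =
      (f (x j + r j • y) - f (x j + r j • y') - r j * ℓ (y - y')) / r j := by
    have := (hr0 j).ne'
    field_simp
  rw [h6, abs_div, abs_of_pos (hr0 j), div_le_iff₀ (hr0 j)]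
  linarith

namespace AsymptoticallyAffine

lemma neg (hG : AsymptoticallyAffine G c ℓ) : AsymptoticallyAffine (fun j y => -G j y) (-c) (-ℓ) := by
  refine ⟨fun R hR ε hε => ?_, hG.base.neg⟩
  filter_upwards [hG.oscillation R hR ε hε] with j hj y hy y' hy'
  rw [← abs_neg]
  convert hj y hy y' hy' using 2
  simp only [neg_apply]
  ring

lemma comp (hG : AsymptoticallyAffine G c ℓ) {k : ℕ → ℕ} (hk : StrictMono k) :
    AsymptoticallyAffine (fun i => G (k i)) c ℓ :=
  ⟨fun R hR ε hε => hk.tendsto_atTop.eventually (hG.oscillation R hR ε hε),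
    hG.base.comp hk.tendsto_atTop⟩

lemma uniform (hG : AsymptoticallyAffine G c ℓ) (hR : 0 < R) (hε : 0 < ε) :
    ∀ᶠ j in atTop, ∀ y ∈ ball (0 : Space n) R, |G j y - (c + ℓ y)| ≤ ε := by
  filter_upwards [hG.oscillation R hR (ε / (2 * R)) (by positivity),
    hG.base.eventually (Metric.closedBall_mem_nhds c (half_pos hε))] with j h1 h2 y hy
  have h3 := h1 y hy 0 (mem_ball_self hR)
  rw [sub_zero] at h3
  rw [Real.dist_eq] at h2
  have h4 : ε / (2 * R) * ‖y‖ ≤ ε / 2 := by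
    rw [div_mul_eq_mul_div, div_le_div_iff₀ (by positivity) two_pos]
    nlinarith [mem_ball_zero_iff.1 hy]
  have h5 : G j y - (c + ℓ y) = (G j y - G j 0 - ℓ y) + (G j 0 - c) := by ring
  rw [h5]
  exact (abs_add_le _ _).trans (by linarith)

lemma lipschitz (hG : AsymptoticallyAffine G c ℓ) (hR : 0 < R) :
    ∀ᶠ j in atTop, ∀ y ∈ ball (0 : Space n) R, ∀ y' ∈ ball (0 : Space n) R,
      |G j y - G j y'| ≤ (‖ℓ‖ + 1) * ‖y - y'‖ := by
  filter_upwards [hG.oscillation R hR 1 one_pos] with j h1 y hy y' hy'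
  have h2 := h1 y hy y' hy'
  have h3 : |ℓ (y - y')| ≤ ‖ℓ‖ * ‖y - y'‖ := ℓ.le_opNorm _
  have h5 : G j y - G j y' = (G j y - G j y' - ℓ (y - y')) + ℓ (y - y') := by ring
  rw [h5]
  exact (abs_add_le _ _).trans (by linarith)

end AsymptoticallyAffine

/-- A bounded set which meets every line `t ↦ y + t e` in a set of times of diameter at most `ρ` has
measure of order `ρ`: it has about `1 / ρ` disjoint translates in a fixed ball. -/
lemma volume_le_of_thin {T : Set (Space n)} (hT : MeasurableSet T) (hTR : T ⊆ ball 0 R)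
    (e : Space n) (hρ : 0 < ρ) (hthin : ∀ y t, y ∈ T → y + t • e ∈ T → |t| ≤ ρ) :
    volume T ≤ ENNReal.ofReal (2 * ρ) * volume (ball (0 : Space n) (R + ‖e‖)) := by
  set N := ⌊1 / (2 * ρ)⌋₊ with hN
  set T' : ℕ → Set (Space n) := fun i => (fun x => x - (2 * ρ * i) • e) ⁻¹' T with hT'
  have hdisj : PairwiseDisjoint (↑(Finset.range (N + 1))) T' := by
    intro i _ i' _ hne
    refine Set.disjoint_left.2 fun x hx hx' => ?_
    have h1 := hthin (x - (2 * ρ * i) • e) (2 * ρ * i - 2 * ρ * i') hx (by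
      have : x - (2 * ρ * i) • e + (2 * ρ * i - 2 * ρ * i') • e = x - (2 * ρ * i') • e := by
        rw [sub_smul]; abel
      rw [this]; exact hx')
    rw [← mul_sub, abs_mul, abs_of_pos (by positivity : 0 < 2 * ρ)] at h1
    have h2 : (1 : ℝ) ≤ |(i : ℝ) - i'| := by
      have : (1 : ℤ) ≤ |(i : ℤ) - i'| := Int.one_le_abs (sub_ne_zero.2 (by exact_mod_cast hne))
      exact_mod_cast this
    nlinarith
  have hmeas : ∀ i ∈ Finset.range (N + 1), MeasurableSet (T' i) := fun i _ =>
    (measurable_id.sub_const _) hT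
  have h1 := measure_biUnion_finset (μ := volume) hdisj hmeas
  have h2 : ∀ i, volume (T' i) = volume T := fun i =>
    (measurePreserving_sub_right volume ((2 * ρ * i) • e)).measure_preimage hT.nullMeasurableSet
  simp only [h2, Finset.sum_const, Finset.card_range, nsmul_eq_mul] at h1
  have h3 : (⋃ i ∈ Finset.range (N + 1), T' i) ⊆ ball (0 : Space n) (R + ‖e‖) := by
    refine iUnion₂_subset fun i hi x hx => ?_
    have h4 := mem_ball_zero_iff.1 (hTR hx)
    have h5 : (2 * ρ * i : ℝ) ≤ 1 := by
      have h6 : (i : ℝ) ≤ N := by exact_mod_cast Nat.lt_succ_iff.1 (Finset.mem_range.1 hi)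
      have h7 : (N : ℝ) ≤ 1 / (2 * ρ) := Nat.floor_le (by positivity)
      have h8 := h6.trans h7
      rw [le_div_iff₀ (by positivity)] at h8
      linarith
    have h6 : ‖(2 * ρ * i : ℝ) • e‖ ≤ ‖e‖ := by
      rw [norm_smul, Real.norm_eq_abs, abs_of_nonneg (by positivity)]
      exact mul_le_of_le_one_left (norm_nonneg _) h5
    rw [mem_ball_zero_iff]
    calc ‖x‖ = ‖(x - (2 * ρ * i : ℝ) • e) + (2 * ρ * i : ℝ) • e‖ := by rw [sub_add_cancel]
      _ ≤ _ := norm_add_le _ _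
      _ < R + ‖e‖ := by linarith
  have h4 : ((N + 1 : ℕ) : ℝ≥0∞) * volume T ≤ volume (ball (0 : Space n) (R + ‖e‖)) := by
    rw [← h1]; exact measure_mono h3
  calc volume T = ENNReal.ofReal (2 * ρ * (1 / (2 * ρ))) * volume T := by
        rw [mul_one_div_cancel (by positivity), ENNReal.ofReal_one, one_mul]
    _ = ENNReal.ofReal (2 * ρ) * (ENNReal.ofReal (1 / (2 * ρ)) * volume T) := by
        rw [ENNReal.ofReal_mul (by positivity), mul_assoc]
    _ ≤ ENNReal.ofReal (2 * ρ) * (((N + 1 : ℕ) : ℝ≥0∞) * volume T) := by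
        gcongr
        rw [← ENNReal.ofReal_natCast]
        refine ENNReal.ofReal_le_ofReal ?_
        push_cast
        exact (Nat.lt_floor_add_one _).le
    _ ≤ _ := by gcongr

/-- The slabs `{|G j| ≤ ρ}` have measure of order `ρ`. -/
lemma AsymptoticallyAffine.exists_slab_bound (hG : AsymptoticallyAffine G c ℓ) (hℓ : ℓ ≠ 0)
    (hR : 0 < R) : ∃ D : ℝ, 0 ≤ D ∧ ∀ᶠ j in atTop, ∀ ρ > 0,
      volume {y | y ∈ ball (0 : Space n) R ∧ |G j y| ≤ ρ} ≤ ENNReal.ofReal (D * ρ) := by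
  obtain ⟨e, he⟩ : ∃ e, ℓ e = 1 := by
    obtain ⟨e, he⟩ : ∃ e, ℓ e ≠ 0 := by
      by_contra! h
      exact hℓ (ContinuousLinearMap.ext h)
    exact ⟨(ℓ e)⁻¹ • e, by simp [he]⟩
  set V := volume (ball (0 : Space n) (R + ‖e‖)) with hV
  have hVf : V ≠ ⊤ := measure_ball_lt_top.ne
  refine ⟨8 * V.toReal, by positivity, ?_⟩
  filter_upwards [hG.lipschitz hR, hG.oscillation R hR (1 / (2 * (‖e‖ + 1))) (by positivity)]
    with j h1 h2 ρ hρ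
  have hcont : ContinuousOn (G j) (ball 0 R) := by
    refine LipschitzOnWith.continuousOn (K := (‖ℓ‖ + 1).toNNReal) ?_
    refine LipschitzOnWith.of_dist_le_mul fun y hy y' hy' => ?_
    rw [Real.dist_eq, dist_eq_norm, Real.coe_toNNReal _ (by positivity)]
    exact h1 y hy y' hy'
  have hmeas : MeasurableSet {y | y ∈ ball (0 : Space n) R ∧ |G j y| ≤ ρ} := by
    have h3 : IsOpen (ball (0 : Space n) R ∩ G j ⁻¹' {t | ρ < |t|}) :=
      hcont.isOpen_inter_preimage isOpen_ball (isOpen_lt continuous_const continuous_abs)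
    have h4 : {y | y ∈ ball (0 : Space n) R ∧ |G j y| ≤ ρ} =
        ball (0 : Space n) R \ (ball (0 : Space n) R ∩ G j ⁻¹' {t | ρ < |t|}) := by
      ext y
      constructor
      · rintro ⟨hy, hy'⟩
        exact ⟨hy, fun h => not_lt.2 hy' h.2⟩
      · rintro ⟨hy, hy'⟩
        exact ⟨hy, not_lt.1 fun h => hy' ⟨hy, h⟩⟩
    rw [h4]
    exact isOpen_ball.measurableSet.diff h3.measurableSet
  have hthin : ∀ y t, y ∈ {y | y ∈ ball (0 : Space n) R ∧ |G j y| ≤ ρ} →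
      y + t • e ∈ {y | y ∈ ball (0 : Space n) R ∧ |G j y| ≤ ρ} → |t| ≤ 4 * ρ := by
    rintro y t ⟨hy, hy1⟩ ⟨hy', hy1'⟩
    have h3 := h2 _ hy' _ hy
    rw [add_sub_cancel_left, map_smul, he, smul_eq_mul, mul_one, norm_smul, Real.norm_eq_abs] at h3
    have h4 : 1 / (2 * (‖e‖ + 1)) * (|t| * ‖e‖) ≤ |t| / 2 := by
      rw [div_mul_eq_mul_div, div_le_div_iff₀ (by positivity) two_pos]
      nlinarith [abs_nonneg t, norm_nonneg e]
    have h5 : |t| ≤ |G j (y + t • e)| + |G j y| + |G j (y + t • e) - G j y - t| := by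
      have h6 : t = G j (y + t • e) - G j y - (G j (y + t • e) - G j y - t) := by ring
      calc |t| = |G j (y + t • e) - G j y - (G j (y + t • e) - G j y - t)| := by rw [← h6]
        _ ≤ |G j (y + t • e) - G j y| + |G j (y + t • e) - G j y - t| := abs_sub _ _
        _ ≤ _ := by gcongr; exact abs_sub _ _
    linarith
  refine (volume_le_of_thin hmeas (fun y hy => hy.1) e (by positivity : 0 < 4 * ρ) hthin).trans ?_
  rw [← hV, ← ENNReal.ofReal_toReal hVf, ← ENNReal.ofReal_mul (by positivity)]
  refine ENNReal.ofReal_le_ofReal (le_of_eq ?_)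
  rw [ENNReal.toReal_ofReal ENNReal.toReal_nonneg]
  ring

lemma AsymptoticallyAffine.volume_zero_set (hG : AsymptoticallyAffine G c ℓ) (hℓ : ℓ ≠ 0)
    (hR : 0 < R) : ∀ᶠ j in atTop, volume {y | y ∈ ball (0 : Space n) R ∧ G j y = 0} = 0 := by
  obtain ⟨D, hD, h⟩ := hG.exists_slab_bound hℓ hR
  filter_upwards [h] with j hj
  refine le_antisymm (ge_of_tendsto (x := 𝓝[>] (0 : ℝ)) (f := fun ρ => ENNReal.ofReal (D * ρ)) ?_ ?_)
    zero_le
  · have : Tendsto (fun ρ : ℝ => ENNReal.ofReal (D * ρ)) (𝓝 0) (𝓝 (ENNReal.ofReal (D * 0))) :=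
      (ENNReal.continuous_ofReal.comp (by fun_prop : Continuous fun ρ : ℝ => D * ρ)).tendsto 0
    rw [mul_zero, ENNReal.ofReal_zero] at this
    exact this.mono_left nhdsWithin_le_nhds
  · filter_upwards [self_mem_nhdsWithin] with ρ hρ
    refine (measure_mono ?_).trans (hj ρ hρ)
    rintro y ⟨hy, hy0⟩
    exact ⟨hy, by rw [hy0, abs_zero]; exact (mem_Ioi.1 hρ).le⟩

end affine

/-! ### Sequences of sets with an asymptotically flat interface -/

section interface

variable {n : ℕ} {b : ℝ} {l m : Space n →L[ℝ] ℝ} {Ω E E' : ℕ → Set (Space n)}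
  {F φ : ℕ → Space n → ℝ} {S : Set (Space n)}

lemma _root_.IsPreconnected.inter_frontier_nonempty {X : Type*} [TopologicalSpace X] {t u : Set X}
    (ht : IsPreconnected t) (h1 : (t ∩ u).Nonempty) (h2 : (t \ u).Nonempty) :
    (t ∩ frontier u).Nonempty := by
  by_contra h
  have hno : ∀ x ∈ t, x ∉ frontier u := fun x hx hx' => h ⟨x, hx, hx'⟩
  have hint : ∀ x ∈ t, x ∈ closure u → x ∈ interior u := fun x hx hx' => by
    by_contra h3
    exact hno x hx ⟨hx', h3⟩
  obtain ⟨x, hx, hxu⟩ := h1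
  obtain ⟨y, hy, hyu⟩ := h2
  obtain ⟨z, -, hz1, hz2⟩ := ht (interior u) (closure u)ᶜ isOpen_interior
      isClosed_closure.isOpen_compl
    (fun w hw => by
      by_cases h3 : w ∈ closure u
      · exact Or.inl (hint w hw h3)
      · exact Or.inr h3)
    ⟨x, hx, hint x hx (subset_closure hxu)⟩
    ⟨y, hy, fun h3 => hyu (interior_subset (hint y hy h3))⟩
  exact hz2 (subset_closure (interior_subset hz1))

lemma AsymptoticallyAffine.eventually_pos {G : ℕ → Space n → ℝ} {c : ℝ} {ℓ : Space n →L[ℝ] ℝ}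
    (hG : AsymptoticallyAffine G c ℓ) {K : Set (Space n)} (hK : IsCompact K)
    (hpos : ∀ y ∈ K, 0 < c + ℓ y) : ∀ᶠ j in atTop, ∀ y ∈ K, 0 < G j y := by
  rcases K.eq_empty_or_nonempty with rfl | hne
  · exact Eventually.of_forall fun j y hy => absurd hy (notMem_empty y)
  obtain ⟨y₀, hy₀, hmin⟩ := hK.exists_isMinOn hne (f := fun y => c + ℓ y)
    (by fun_prop : Continuous fun y => c + ℓ y).continuousOn
  obtain ⟨R, hR⟩ := hK.isBounded.subset_ball_lt 0 0
  filter_upwards [hG.uniform hR.1 (half_pos (hpos y₀ hy₀))] with j hj y hy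
  have h1 := abs_le.1 (hj y (hR.2 hy))
  have h2 : c + ℓ y₀ ≤ c + ℓ y := hmin hy
  have h3 := hpos y₀ hy₀
  linarith

/-- Sets `E j ⊆ Ω j` such that, on bounded sets and for large `j`, the container is `{F j > 0}` and
the interface `Ω j ∩ ∂(E j)` is contained in `{φ j = 0}`, where `F j` and `φ j` converge to the
affine functions `b + l` and `m`. -/
structure InterfaceSequence {n : ℕ} (Ω E : ℕ → Set (Space n)) (F φ : ℕ → Space n → ℝ) (b : ℝ)
    (l m : Space n →L[ℝ] ℝ) : Prop where
  container_affine : AsymptoticallyAffine F b l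
  interface_affine : AsymptoticallyAffine φ 0 m
  isOpen : ∀ j, IsOpen (Ω j)
  subset : ∀ j, E j ⊆ Ω j
  mem_iff : ∀ R > 0, ∀ᶠ j in atTop, ∀ y ∈ ball (0 : Space n) R, (y ∈ Ω j ↔ 0 < F j y)
  interface : ∀ R > 0, ∀ᶠ j in atTop, ∀ y ∈ ball (0 : Space n) R,
    y ∈ Ω j ∩ frontier (E j) → φ j y = 0
  normalized : ∀ j, IsNormalizedIn (Ω j) (E j)
  container_ne : l ≠ 0
  interface_ne : m ≠ 0

namespace InterfaceSequence

lemma neg (h : InterfaceSequence Ω E F φ b l m) :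
    InterfaceSequence Ω E F (fun j y => -φ j y) b l (-m) :=
  { h with
    interface_affine := by simpa using h.interface_affine.neg
    interface := fun R hR => by
      filter_upwards [h.interface R hR] with j hj y hy hy'
      rw [hj y hy hy', neg_zero]
    interface_ne := neg_ne_zero.2 h.interface_ne }

lemma eventually_subset (h : InterfaceSequence Ω E F φ b l m) {K : Set (Space n)}
    (hK : IsCompact K) (hpos : ∀ y ∈ K, 0 < b + l y) : ∀ᶠ j in atTop, K ⊆ Ω j := by
  obtain ⟨R, hR⟩ := hK.isBounded.subset_ball_lt 0 0
  filter_upwards [h.container_affine.eventually_pos hK hpos, h.mem_iff R hR.1] with j h1 h2 y hy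
  exact (h2 y (hR.2 hy)).2 (h1 y hy)

lemma eventually_notMem (h : InterfaceSequence Ω E F φ b l m) {y : Space n}
    (hy : b + l y < 0) : ∀ᶠ j in atTop, y ∉ Ω j := by
  have h1 := h.container_affine.neg.eventually_pos (isCompact_singleton (x := y)) (by
    rintro z rfl
    simp only [neg_apply]
    linarith)
  filter_upwards [h1, h.mem_iff (‖y‖ + 1) (by positivity)] with j h1 h2 h3
  have h4 := (h2 y (mem_ball_zero_iff.2 (lt_add_one _))).1 h3
  have h5 := h1 y rfl
  linarith

lemma ae_container_ne_zero (h : InterfaceSequence Ω E F φ b l m) :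
    ∀ᵐ y : Space n, b + l y ≠ 0 := by
  have := volume_hyperplane h.container_ne (-b)
  rw [ae_iff]
  convert this using 2
  ext y
  constructor
  · intro hy
    have hy' : b + l y = 0 := not_not.1 hy
    change l y = -b
    linarith
  · intro hy
    have hy' : l y = -b := hy
    exact not_not.2 (by linarith : b + l y = 0)

/-- The containers converge to the half-space `{b + l > 0}`. -/
lemma ae_eventually_mem_container (h : InterfaceSequence Ω E F φ b l m) :
    ∀ᵐ y : Space n, ∀ᶠ j in atTop, (y ∈ Ω j ↔ 0 < b + l y) := by
  filter_upwards [h.ae_container_ne_zero] with y hy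
  rcases lt_or_gt_of_ne hy with hy | hy
  · filter_upwards [h.eventually_notMem hy] with j hj
    exact ⟨fun h1 => absurd h1 hj, fun h1 => absurd h1 hy.not_gt⟩
  · filter_upwards [h.eventually_subset (isCompact_singleton (x := y))
      (by rintro z rfl; exact hy)] with j hj
    exact ⟨fun _ => hy, fun _ => hj rfl⟩

/-- A compact subset of the limit container has a compact neighbourhood in it. -/
lemma exists_cthickening (l : Space n →L[ℝ] ℝ) (hS : IsCompact S) (hSH : ∀ y ∈ S, 0 < b + l y) :
    ∃ δ, 0 < δ ∧ δ ≤ 1 ∧ ∀ y ∈ cthickening δ S, 0 < b + l y := by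
  have hopen : IsOpen {y | 0 < b + l y} := isOpen_lt continuous_const (by fun_prop)
  obtain ⟨δ, hδ, h1⟩ := hS.exists_cthickening_subset_open hopen hSH
  exact ⟨min δ 1, lt_min hδ one_pos, min_le_right _ _,
    fun y hy => h1 (cthickening_mono (min_le_left _ _) S hy)⟩

lemma volume_near_le (hS : IsCompact S) {A B : Set (Space n)} (z : Space n) :
    volume {x | x ∈ A ∧ x - z ∈ B ∧ (x ∈ S ∨ x - z ∈ S)} ≤
      ENNReal.ofReal (2 * (volume S).toReal) := by
  have h1 : {x | x ∈ A ∧ x - z ∈ B ∧ (x ∈ S ∨ x - z ∈ S)} ⊆ S ∪ (fun x => x - z) ⁻¹' S := by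
    rintro x ⟨-, -, hx⟩
    exact hx
  refine (measure_mono h1).trans ((measure_union_le _ _).trans ?_)
  rw [(measurePreserving_sub_right volume z).measure_preimage
    hS.isClosed.measurableSet.nullMeasurableSet, ← two_mul, ENNReal.ofReal_mul two_pos.le,
    ENNReal.ofReal_toReal hS.measure_lt_top.ne]
  simp

lemma mem_cthickening_of_near {δ : ℝ} {x z : Space n} (hz : ‖z‖ ≤ δ) {t : ℝ}
    (ht : t ∈ Icc (0 : ℝ) 1) (hx : x ∈ S ∨ x - z ∈ S) : x - t • z ∈ cthickening δ S := by
  rcases hx with hx | hx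
  · refine mem_cthickening_of_dist_le _ _ _ _ hx ?_
    rw [dist_eq_norm, sub_sub_cancel_left, norm_neg, norm_smul, Real.norm_eq_abs, abs_of_nonneg ht.1]
    exact (mul_le_of_le_one_left (norm_nonneg _) ht.2).trans hz
  · refine mem_cthickening_of_dist_le _ _ _ _ hx ?_
    rw [dist_eq_norm, sub_sub_sub_cancel_left, show z - t • z = (1 - t) • z by rw [sub_smul, one_smul],
      norm_smul, Real.norm_eq_abs, abs_of_nonneg (by linarith [ht.2])]
    exact (mul_le_of_le_one_left (norm_nonneg _) (by linarith [ht.1])).trans hz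

/-- Uniform bound for the interface between `E j` and `Ω j \ E j`: a short segment between these two
sets meets `∂(E j)`, hence stays in a thin slab around `{φ j = 0}`. -/
lemma exists_crossBound_inner (h : InterfaceSequence Ω E F φ b l m) (hS : IsCompact S)
    (hSH : ∀ y ∈ S, 0 < b + l y) :
    ∃ M, 0 ≤ M ∧ ∀ᶠ j in atTop, CrossBound (E j) (Ω j \ E j) S M := by
  obtain ⟨δ, hδ, hδ1, hδS⟩ := exists_cthickening l hS hSH
  have hK : IsCompact (cthickening δ S) := hS.cthickening
  obtain ⟨R, hR⟩ := hK.isBounded.subset_ball_lt 0 0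
  obtain ⟨D, hD, hslab⟩ := h.interface_affine.exists_slab_bound h.interface_ne hR.1
  refine ⟨D * (‖m‖ + 1) + 2 * (volume S).toReal / δ, by positivity, ?_⟩
  filter_upwards [hslab, h.interface R hR.1, h.interface_affine.lipschitz hR.1,
    h.eventually_subset hK hδS] with j h1 h2 h3 h4 z
  have hv : 0 ≤ (volume S).toReal := ENNReal.toReal_nonneg
  rcases eq_or_ne z 0 with rfl | hz0
  · have : {x | x ∈ E j ∧ x - 0 ∈ Ω j \ E j ∧ (x ∈ S ∨ x - 0 ∈ S)} = ∅ := by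
      refine eq_empty_of_forall_notMem ?_
      rintro x ⟨hx1, hx2, -⟩
      rw [sub_zero] at hx2
      exact hx2.2 hx1
    rw [this, measure_empty]
    exact zero_le
  have hz : 0 < ‖z‖ := norm_pos_iff.2 hz0
  rcases le_or_gt ‖z‖ δ with hzδ | hzδ
  · rw [min_eq_left (hzδ.trans hδ1)]
    refine (measure_mono (t := {y | y ∈ ball (0 : Space n) R ∧ |φ j y| ≤ (‖m‖ + 1) * ‖z‖}) ?_).trans
      ((h1 _ (by positivity)).trans (ENNReal.ofReal_le_ofReal ?_))
    · rintro x ⟨hxE, hxz, hxS⟩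
      have hseg : ∀ t ∈ Icc (0 : ℝ) 1, x - t • z ∈ cthickening δ S := fun t ht =>
        mem_cthickening_of_near hzδ ht hxS
      have hx0 : x ∈ cthickening δ S := by simpa using hseg 0 ⟨le_rfl, zero_le_one⟩
      have hpre : IsPreconnected ((fun t : ℝ => x - t • z) '' Icc 0 1) :=
        isPreconnected_Icc.image _ (by fun_prop)
      obtain ⟨p, ⟨t, ht, rfl⟩, hp⟩ := hpre.inter_frontier_nonempty (u := E j)
        ⟨x, ⟨0, ⟨le_rfl, zero_le_one⟩, by simp⟩, hxE⟩
        ⟨x - z, ⟨1, ⟨zero_le_one, le_rfl⟩, by simp⟩, hxz.2⟩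
      have hp0 := h2 _ (hR.2 (hseg t ht)) ⟨h4 (hseg t ht), hp⟩
      refine ⟨hR.2 hx0, ?_⟩
      have h5 := h3 _ (hR.2 hx0) _ (hR.2 (hseg t ht))
      rw [hp0, sub_zero, sub_sub_cancel, norm_smul, Real.norm_eq_abs, abs_of_nonneg ht.1] at h5
      exact h5.trans (mul_le_mul_of_nonneg_left (mul_le_of_le_one_left hz.le ht.2) (by positivity))
    · have : 0 ≤ 2 * (volume S).toReal / δ * ‖z‖ := by positivity
      nlinarith
  · refine (volume_near_le hS z).trans (ENNReal.ofReal_le_ofReal ?_)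
    have h5 : δ ≤ min ‖z‖ 1 := le_min hzδ.le hδ1
    have h6 : 2 * (volume S).toReal = 2 * (volume S).toReal / δ * δ := by field_simp
    have h7 : 2 * (volume S).toReal / δ * δ ≤ 2 * (volume S).toReal / δ * min ‖z‖ 1 := by gcongr
    have h8 : 0 ≤ D * (‖m‖ + 1) * min ‖z‖ 1 := by positivity
    linarith

/-- Points of `E j` near a compact subset of the limit container have a definite distance from the
exterior of `Ω j`. -/
lemma exists_crossBound_outer (h : InterfaceSequence Ω E F φ b l m) (hS : IsCompact S)
    (hSH : ∀ y ∈ S, 0 < b + l y) :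
    ∃ M, 0 ≤ M ∧ ∀ᶠ j in atTop, CrossBound (E j) (Ω j)ᶜ S M := by
  obtain ⟨δ, hδ, hδ1, hδS⟩ := exists_cthickening l hS hSH
  have hK : IsCompact (cthickening δ S) := hS.cthickening
  refine ⟨2 * (volume S).toReal / δ, by positivity, ?_⟩
  filter_upwards [h.eventually_subset hK hδS] with j h4 z
  rcases le_or_gt ‖z‖ δ with hzδ | hzδ
  · have : {x | x ∈ E j ∧ x - z ∈ (Ω j)ᶜ ∧ (x ∈ S ∨ x - z ∈ S)} = ∅ := by
      refine eq_empty_of_forall_notMem ?_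
      rintro x ⟨-, hx2, hx3⟩
      refine hx2 (h4 ?_)
      simpa using mem_cthickening_of_near hzδ (t := 1) ⟨zero_le_one, le_rfl⟩ hx3
    rw [this, measure_empty]
    exact zero_le
  · refine (volume_near_le hS z).trans (ENNReal.ofReal_le_ofReal ?_)
    have h5 : δ ≤ min ‖z‖ 1 := le_min hzδ.le hδ1
    have h6 : 2 * (volume S).toReal = 2 * (volume S).toReal / δ * δ := by field_simp
    have h7 : 2 * (volume S).toReal / δ * δ ≤ 2 * (volume S).toReal / δ * min ‖z‖ 1 := by gcongr
    linarith

end InterfaceSequence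

/-- Interface bounds are not affected by null sets. -/
lemma CrossBound.mono_ae {A B A' B' : Set (Space n)} {M : ℝ} (h : CrossBound A B S M)
    (hA : A' ≤ᵐ[volume] A) (hB : B' ≤ᵐ[volume] B) : CrossBound A' B' S M := by
  intro z
  refine (measure_mono_ae ?_).trans (h z)
  have hB' : ∀ᵐ x : Space n, x ∈ B' → x ∈ B := hB
  filter_upwards [hA, ae_sub_of_ae hB' z] with x h1 h2
  rintro ⟨hx1, hx2, hx3⟩
  exact ⟨h1 hx1, h2 hx2, hx3⟩

lemma CrossBound.mono_const {A B : Set (Space n)} {M M' : ℝ} (h : CrossBound A B S M)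
    (hM : M ≤ M') : CrossBound A B S M' := fun z =>
  (h z).trans (ENNReal.ofReal_le_ofReal (by gcongr))

end interface

/-! ### The side of the interface occupied by the critical set -/

section sides

variable {n : ℕ} {b R δ : ℝ} {l m : Space n →L[ℝ] ℝ} {Ω E : ℕ → Set (Space n)}
  {F φ : ℕ → Space n → ℝ} {y : ℕ → Space n} {u : Space n}

/-- The points of `closedBall 0 R` at which the affine functions `b + l` and `m` are at least
`δ`. -/
def sideRegion {n : ℕ} (b : ℝ) (l m : Space n →L[ℝ] ℝ) (R δ : ℝ) : Set (Space n) :=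
  {y | ‖y‖ ≤ R ∧ δ ≤ b + l y ∧ δ ≤ m y}

lemma sideRegion_mono {R' δ' : ℝ} (hR : R ≤ R') (hδ : δ' ≤ δ) :
    sideRegion b l m R δ ⊆ sideRegion b l m R' δ' :=
  fun _ hy => ⟨hy.1.trans hR, hδ.trans hy.2.1, hδ.trans hy.2.2⟩

lemma isCompact_sideRegion : IsCompact (sideRegion b l m R δ) := by
  refine (isCompact_closedBall (0 : Space n) R).of_isClosed_subset ?_ fun y hy =>
    mem_closedBall_zero_iff.2 hy.1
  have h1 : IsClosed {y : Space n | ‖y‖ ≤ R} := isClosed_le continuous_norm continuous_const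
  have h2 : IsClosed {y : Space n | δ ≤ b + l y} := isClosed_le continuous_const (by fun_prop)
  have h3 : IsClosed {y : Space n | δ ≤ m y} := isClosed_le continuous_const (by fun_prop)
  exact h1.inter (h2.inter h3)

lemma isPreconnected_sideRegion : IsPreconnected (sideRegion b l m R δ) := by
  have h1 : sideRegion b l m R δ = closedBall (0 : Space n) R ∩ ({y | δ - b ≤ l y} ∩ {y | δ ≤ m y}) := by
    ext y
    constructor
    · rintro ⟨h1, h2, h3⟩
      exact ⟨mem_closedBall_zero_iff.2 h1, by change δ - b ≤ l y; linarith, h3⟩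
    · rintro ⟨h1, h2, h3⟩
      have h2' : δ - b ≤ l y := h2
      exact ⟨mem_closedBall_zero_iff.1 h1, by linarith, h3⟩
  rw [h1]
  exact ((convex_closedBall 0 R).inter ((convex_halfSpace_ge l.toLinearMap.isLinear _).inter
    (convex_halfSpace_ge m.toLinearMap.isLinear _))).isPreconnected

namespace InterfaceSequence

lemma comp (h : InterfaceSequence Ω E F φ b l m) {k : ℕ → ℕ} (hk : StrictMono k) :
    InterfaceSequence (fun i => Ω (k i)) (fun i => E (k i)) (fun i => F (k i)) (fun i => φ (k i))
      b l m where
  container_affine := h.container_affine.comp hk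
  interface_affine := h.interface_affine.comp hk
  isOpen i := h.isOpen (k i)
  subset i := h.subset (k i)
  mem_iff R hR := hk.tendsto_atTop.eventually (h.mem_iff R hR)
  interface R hR := hk.tendsto_atTop.eventually (h.interface R hR)
  normalized i := h.normalized (k i)
  container_ne := h.container_ne
  interface_ne := h.interface_ne

/-- For large `j`, each compact connected region of the limit container on one side of the limit
interface is either contained in `E j` or disjoint from it. -/
lemma sideRegion_dichotomy (h : InterfaceSequence Ω E F φ b l m) (hδ : 0 < δ) :
    ∀ᶠ j in atTop, sideRegion b l m R δ ⊆ E j ∨ ∀ y ∈ sideRegion b l m R δ, y ∉ E j := by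
  filter_upwards [h.eventually_subset isCompact_sideRegion
      (fun y hy => hδ.trans_le hy.2.1 : ∀ y ∈ sideRegion b l m R δ, 0 < b + l y),
    h.interface_affine.eventually_pos isCompact_sideRegion
      (fun y hy => by rw [zero_add]; exact hδ.trans_le hy.2.2 :
        ∀ y ∈ sideRegion b l m R δ, 0 < 0 + m y),
    h.interface (|R| + 1) (by positivity)] with j h1 h2 h3
  by_contra! hcon
  obtain ⟨hne, y, hy, hyE⟩ := hcon
  obtain ⟨x, hx, hxE⟩ := not_subset.1 hne
  obtain ⟨p, hp, hpf⟩ := isPreconnected_sideRegion.inter_frontier_nonempty (u := E j)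
    ⟨y, hy, hyE⟩ ⟨x, hx, hxE⟩
  have h4 := h3 p (mem_ball_zero_iff.2 (by linarith [hp.1, le_abs_self R])) ⟨h1 hp, hpf⟩
  exact (h2 p hp).ne' h4

/-- Near a point `y j` of the interface, the points with `φ j > 0` can be moved along `u` inside
`Ω j`, without crossing the interface, to a fixed region on the positive side of `m`. -/
lemma exists_transport (h : InterfaceSequence Ω E F φ b l m) (hy1 : ∀ j, ‖y j‖ ≤ 1)
    (hy : ∀ j, y j ∈ Ω j ∩ frontier (E j)) (hu : 0 < m u) (hδ : 0 < δ)
    (hpath : ∀ᶠ j in atTop, ∀ t ∈ Icc (0 : ℝ) 1, y j + t • u ∈ Ω j)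
    (hend : ∀ᶠ j in atTop, δ ≤ b + l (y j + u)) :
    ∃ R δ', 0 < δ' ∧ ∀ᶠ j in atTop, ∀ᶠ x in 𝓝 (y j), 0 < φ j x →
      x + u ∈ sideRegion b l m R δ' ∧ (x ∈ E j ↔ x + u ∈ E j) := by
  refine ⟨‖u‖ + 2, min (δ / 2) (m u / 2), lt_min (half_pos hδ) (half_pos hu), ?_⟩
  have hR : 0 < ‖u‖ + 3 := by positivity
  filter_upwards [hpath, hend, h.interface _ hR, h.interface_affine.uniform hR
      (by positivity : 0 < m u / 4),
    h.interface_affine.oscillation _ hR (m u / (2 * (‖u‖ + 1))) (by positivity)]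
    with j h1 h2 h3 h4 h5
  have hyR : y j ∈ ball (0 : Space n) (‖u‖ + 3) :=
    mem_ball_zero_iff.2 (by linarith [hy1 j, norm_nonneg u])
  have h6 := h4 _ hyR
  rw [h3 _ hyR (hy j), zero_add, zero_sub, abs_neg] at h6
  have e1 : ∀ᶠ x in 𝓝 (y j), ∀ t ∈ Icc (0 : ℝ) 1, x + t • u ∈ Ω j := by
    refine isCompact_Icc.eventually_forall_of_forall_eventually fun t ht => ?_
    have : Continuous fun p : Space n × ℝ => p.1 + p.2 • u := by fun_prop
    exact this.continuousAt.eventually ((h.isOpen j).mem_nhds (h1 t ht))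
  have e2 : ∀ᶠ x in 𝓝 (y j), ‖x‖ < 2 :=
    continuous_norm.continuousAt.eventually_lt_const (by linarith [hy1 j])
  have e3 : ∀ᶠ x in 𝓝 (y j), δ / 2 < b + l (x + u) :=
    (by fun_prop : Continuous fun x => b + l (x + u)).continuousAt.eventually_const_lt (by linarith)
  have e4 : ∀ᶠ x in 𝓝 (y j), m u / 2 < m (x + u) := by
    refine (by fun_prop : Continuous fun x => m (x + u)).continuousAt.eventually_const_lt ?_
    change m u / 2 < m (y j + u)
    rw [map_add]
    linarith [(abs_le.1 h6).1]
  filter_upwards [e1, e2, e3, e4] with x hx1 hx2 hx3 hx4 hφ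
  have hball : ∀ t ∈ Icc (0 : ℝ) 1, ‖x + t • u‖ < ‖u‖ + 2 := by
    intro t ht
    have : ‖t • u‖ ≤ ‖u‖ := by
      rw [norm_smul, Real.norm_eq_abs, abs_of_nonneg ht.1]
      exact mul_le_of_le_one_left (norm_nonneg _) ht.2
    linarith [norm_add_le x (t • u)]
  have hball' : ∀ t ∈ Icc (0 : ℝ) 1, x + t • u ∈ ball (0 : Space n) (‖u‖ + 3) := fun t ht =>
    mem_ball_zero_iff.2 (by linarith [hball t ht])
  have hpos : ∀ t ∈ Icc (0 : ℝ) 1, 0 < φ j (x + t • u) := by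
    intro t ht
    have h7 := h5 _ (hball' t ht) _ (by simpa using hball' 0 ⟨le_rfl, zero_le_one⟩)
    rw [add_sub_cancel_left, map_smul, smul_eq_mul, norm_smul, Real.norm_eq_abs,
      abs_of_nonneg ht.1] at h7
    have h8 : m u / (2 * (‖u‖ + 1)) * (t * ‖u‖) ≤ t * m u := by
      rw [div_mul_eq_mul_div, div_le_iff₀ (by positivity)]
      nlinarith [mul_nonneg hu.le ht.1, mul_nonneg (mul_nonneg hu.le ht.1) (norm_nonneg u)]
    linarith [(abs_le.1 h7).1]
  have hno : ∀ t ∈ Icc (0 : ℝ) 1, x + t • u ∉ frontier (E j) := fun t ht hf =>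
    (hpos t ht).ne' (h3 _ (hball' t ht) ⟨hx1 t ht, hf⟩)
  have hpre : IsPreconnected ((fun t : ℝ => x + t • u) '' Icc 0 1) :=
    isPreconnected_Icc.image _ (by fun_prop)
  have hm0 : x ∈ (fun t : ℝ => x + t • u) '' Icc 0 1 := ⟨0, ⟨le_rfl, zero_le_one⟩, by simp⟩
  have hm1 : x + u ∈ (fun t : ℝ => x + t • u) '' Icc 0 1 := ⟨1, ⟨zero_le_one, le_rfl⟩, by simp⟩
  refine ⟨⟨by simpa using (hball 1 ⟨zero_le_one, le_rfl⟩).le, (min_le_left _ _).trans hx3.le,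
    (min_le_right _ _).trans hx4.le⟩, ?_⟩
  by_contra hcon
  obtain ⟨p, ⟨t, ht, rfl⟩, hp⟩ : (((fun t : ℝ => x + t • u) '' Icc 0 1) ∩ frontier (E j)).Nonempty := by
    by_cases hxE : x ∈ E j
    · exact hpre.inter_frontier_nonempty ⟨x, hm0, hxE⟩ ⟨x + u, hm1, fun h9 => hcon ⟨fun _ => h9, fun _ => hxE⟩⟩
    · exact hpre.inter_frontier_nonempty
        ⟨x + u, hm1, by by_contra h9; exact hcon ⟨fun h => absurd h hxE, fun h => absurd h h9⟩⟩ ⟨x, hm0, hxE⟩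
  exact hno t ht hp

/-- The set `E j` occupies exactly one of the two sides of the interface, because both `E j` and its
complement have positive measure near the point `y j` of the interface. -/
lemma exists_side (h : InterfaceSequence Ω E F φ b l m) (hy1 : ∀ j, ‖y j‖ ≤ 1)
    (hy : ∀ j, y j ∈ Ω j ∩ frontier (E j)) {u u' : Space n} (hu : 0 < m u) (hu' : m u' < 0)
    (hδ : 0 < δ)
    (hpath : ∀ᶠ j in atTop, ∀ t ∈ Icc (0 : ℝ) 1, y j + t • u ∈ Ω j)
    (hpath' : ∀ᶠ j in atTop, ∀ t ∈ Icc (0 : ℝ) 1, y j + t • u' ∈ Ω j)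
    (hend : ∀ᶠ j in atTop, δ ≤ b + l (y j + u)) (hend' : ∀ᶠ j in atTop, δ ≤ b + l (y j + u')) :
    ∃ R δ', 0 < δ' ∧ ∀ᶠ j in atTop,
      ((sideRegion b l m R δ' ∩ E j).Nonempty ∧ (sideRegion b l (-m) R δ' \ E j).Nonempty) ∨
      ((sideRegion b l m R δ' \ E j).Nonempty ∧ (sideRegion b l (-m) R δ' ∩ E j).Nonempty) := by
  obtain ⟨R₁, δ₁, hδ₁, h1⟩ := h.exists_transport hy1 hy hu hδ hpath hend
  obtain ⟨R₂, δ₂, hδ₂, h2⟩ := h.neg.exists_transport hy1 hy (u := u')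
    (by simpa using hu') hδ hpath' hend'
  have hδ' : 0 < min δ₁ δ₂ := lt_min hδ₁ hδ₂
  refine ⟨max R₁ R₂, min δ₁ δ₂, hδ', ?_⟩
  have s1 : sideRegion b l m R₁ δ₁ ⊆ sideRegion b l m (max R₁ R₂) (min δ₁ δ₂) :=
    sideRegion_mono (le_max_left _ _) (min_le_left _ _)
  have s2 : sideRegion b l (-m) R₂ δ₂ ⊆ sideRegion b l (-m) (max R₁ R₂) (min δ₁ δ₂) :=
    sideRegion_mono (le_max_right _ _) (min_le_right _ _)
  filter_upwards [h1, h2, h.sideRegion_dichotomy (R := max R₁ R₂) hδ',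
    h.neg.sideRegion_dichotomy (R := max R₁ R₂) hδ',
    h.interface_affine.volume_zero_set h.interface_ne two_pos] with j h1 h2 h3 h4 h5
  obtain ⟨r, hr, h6⟩ := Metric.eventually_nhds_iff_ball.1 (h1.and h2)
  set r' := min r 1
  have hr' : 0 < r' := lt_min hr one_pos
  have hsub : ball (y j) r' ⊆ ball (0 : Space n) 2 := by
    intro x hx
    have h7 := mem_ball_iff_norm.1 hx
    have h8 : r' ≤ 1 := min_le_right _ _
    rw [mem_ball_zero_iff]
    have := norm_add_le (x - y j) (y j)
    rw [sub_add_cancel] at this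
    linarith [hy1 j]
  have hex : ∀ T : Set (Space n), T ⊆ ball (y j) r' → 0 < volume T → ∃ x ∈ T, φ j x ≠ 0 := by
    intro T hT hpos
    by_contra! hcon
    have hsub' : T ⊆ {y | y ∈ ball (0 : Space n) 2 ∧ φ j y = 0} := fun x hx =>
      ⟨hsub (hT hx), hcon x hx⟩
    exact hpos.ne' (measure_mono_null hsub' h5)
  obtain ⟨hpos1, hpos2⟩ := h.normalized j (y j) (hy j) r' hr'
  obtain ⟨x, ⟨hxb, hxE⟩, hx0⟩ := hex (ball (y j) r' ∩ E j) inter_subset_left hpos1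
  obtain ⟨x', ⟨hxb', hxE'⟩, hx0'⟩ := hex (ball (y j) r' \ E j) sdiff_subset hpos2
  have h7 := h6 x (ball_subset_ball (min_le_left _ _) hxb)
  have h8 := h6 x' (ball_subset_ball (min_le_left _ _) hxb')
  rcases lt_or_gt_of_ne hx0 with hx0 | hx0
  · obtain ⟨g1, g2⟩ := h7.2 (by linarith)
    have g3 : x + u' ∈ E j := g2.1 hxE
    have g4 : sideRegion b l (-m) (max R₁ R₂) (min δ₁ δ₂) ⊆ E j :=
      h4.resolve_right fun h9 => h9 _ (s2 g1) g3
    rcases lt_or_gt_of_ne hx0' with hx0' | hx0'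
    · obtain ⟨k1, k2⟩ := h8.2 (by linarith)
      exact absurd (k2.2 (g4 (s2 k1))) hxE'
    · obtain ⟨k1, k2⟩ := h8.1 hx0'
      exact Or.inr ⟨⟨_, s1 k1, fun h9 => hxE' (k2.2 h9)⟩, ⟨_, s2 g1, g3⟩⟩
  · obtain ⟨g1, g2⟩ := h7.1 hx0
    have g3 : x + u ∈ E j := g2.1 hxE
    have g4 : sideRegion b l m (max R₁ R₂) (min δ₁ δ₂) ⊆ E j :=
      h3.resolve_right fun h9 => h9 _ (s1 g1) g3
    rcases lt_or_gt_of_ne hx0' with hx0' | hx0'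
    · obtain ⟨k1, k2⟩ := h8.2 (by linarith)
      exact Or.inl ⟨⟨_, s1 g1, g3⟩, ⟨_, s2 k1, fun h9 => hxE' (k2.2 h9)⟩⟩
    · obtain ⟨k1, k2⟩ := h8.1 hx0'
      exact absurd (k2.2 (g4 (s1 k1))) hxE'

lemma ae_interface_ne_zero (h : InterfaceSequence Ω E F φ b l m) : ∀ᵐ y : Space n, m y ≠ 0 := by
  have := volume_hyperplane h.interface_ne 0
  rw [ae_iff]
  convert this using 2
  ext y
  exact not_not

lemma ae_eventually_mem_iff (h : InterfaceSequence Ω E F φ b l m) (hδ : 0 < δ)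
    (hin : ∀ j, (sideRegion b l m R δ ∩ E j).Nonempty)
    (hout : ∀ j, (sideRegion b l (-m) R δ \ E j).Nonempty) :
    ∀ᵐ y : Space n, ∀ᶠ j in atTop, (y ∈ E j ↔ 0 < b + l y ∧ 0 < m y) := by
  filter_upwards [h.ae_container_ne_zero, h.ae_interface_ne_zero] with y hly hmy
  rcases lt_or_gt_of_ne hly with hly | hly
  · filter_upwards [h.eventually_notMem hly] with j hj
    exact ⟨fun h1 => absurd (h.subset j h1) hj, fun h1 => absurd h1.1 hly.not_gt⟩
  rcases lt_or_gt_of_ne hmy with hmy | hmy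
  · have hδ' : 0 < min δ (min (b + l y) (-m y)) := lt_min hδ (lt_min hly (by linarith))
    filter_upwards [h.neg.sideRegion_dichotomy (R := max R ‖y‖) hδ'] with j hj
    have hy : y ∈ sideRegion b l (-m) (max R ‖y‖) (min δ (min (b + l y) (-m y))) :=
      ⟨le_max_right _ _, (min_le_right _ _).trans (min_le_left _ _),
        (min_le_right _ _).trans (min_le_right _ _)⟩
    obtain ⟨x, hx, hxE⟩ := hout j
    have h1 := hj.resolve_left fun h2 =>
      hxE (h2 (sideRegion_mono (le_max_left _ _) (min_le_left _ _) hx))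
    exact ⟨fun h2 => absurd h2 (h1 y hy), fun h2 => absurd h2.2 hmy.not_gt⟩
  · have hδ' : 0 < min δ (min (b + l y) (m y)) := lt_min hδ (lt_min hly hmy)
    filter_upwards [h.sideRegion_dichotomy (R := max R ‖y‖) hδ'] with j hj
    have hy : y ∈ sideRegion b l m (max R ‖y‖) (min δ (min (b + l y) (m y))) :=
      ⟨le_max_right _ _, (min_le_right _ _).trans (min_le_left _ _),
        (min_le_right _ _).trans (min_le_right _ _)⟩
    obtain ⟨x, hx, hxE⟩ := hin j
    have h1 := hj.resolve_right fun h2 =>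
      h2 x (sideRegion_mono (le_max_left _ _) (min_le_left _ _) hx) hxE
    exact ⟨fun _ => ⟨hly, hmy⟩, fun _ => h1 hy⟩

/-- Along a subsequence, the sets `E j` converge to one of the two wedges cut out of the limit
container by the limit interface. -/
theorem exists_subseq_tendsto (h : InterfaceSequence Ω E F φ b l m) (hy1 : ∀ j, ‖y j‖ ≤ 1)
    (hy : ∀ j, y j ∈ Ω j ∩ frontier (E j)) {u u' : Space n} (hu : 0 < m u) (hu' : m u' < 0)
    (hδ : 0 < δ)
    (hpath : ∀ᶠ j in atTop, ∀ t ∈ Icc (0 : ℝ) 1, y j + t • u ∈ Ω j)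
    (hpath' : ∀ᶠ j in atTop, ∀ t ∈ Icc (0 : ℝ) 1, y j + t • u' ∈ Ω j)
    (hend : ∀ᶠ j in atTop, δ ≤ b + l (y j + u)) (hend' : ∀ᶠ j in atTop, δ ≤ b + l (y j + u')) :
    ∃ m' : Space n →L[ℝ] ℝ, (m' = m ∨ m' = -m) ∧ ∃ k : ℕ → ℕ, StrictMono k ∧
      ∀ᵐ x : Space n, ∀ᶠ i in atTop, (x ∈ E (k i) ↔ 0 < b + l x ∧ 0 < m' x) := by
  obtain ⟨R, δ', hδ', h1⟩ := h.exists_side hy1 hy hu hu' hδ hpath hpath' hend hend'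
  rcases Filter.frequently_or_distrib.1 h1.frequently with h2 | h2
  · obtain ⟨k, hk, h3⟩ := extraction_of_frequently_atTop h2
    exact ⟨m, Or.inl rfl, k, hk,
      (h.comp hk).ae_eventually_mem_iff hδ' (fun i => (h3 i).1) fun i => (h3 i).2⟩
  · obtain ⟨k, hk, h3⟩ := extraction_of_frequently_atTop h2
    refine ⟨-m, Or.inr rfl, k, hk, (h.neg.comp hk).ae_eventually_mem_iff hδ' (fun i => (h3 i).2)
      fun i => ?_⟩
    rw [neg_neg]
    exact (h3 i).1

end InterfaceSequence

end sides

/-! ### Local description of the contact point and its blow-ups -/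

section blowup

variable {n : ℕ} {b r M : ℝ} {x x₀ : Space n} {A B S Ω E : Set (Space n)}

lemma blowUp_eq_preimage (A : Set (Space n)) (x : Space n) (hr : r ≠ 0) :
    blowUp A x r = ((Homeomorph.smulOfNeZero r hr).trans (Homeomorph.addLeft x)) ⁻¹' A := rfl

lemma frontier_blowUp (A : Set (Space n)) (x : Space n) (hr : r ≠ 0) :
    frontier (blowUp A x r) = blowUp (frontier A) x r := by
  rw [blowUp_eq_preimage _ _ hr, blowUp_eq_preimage _ _ hr, Homeomorph.preimage_frontier]

lemma IsOpen.blowUp (hA : IsOpen A) (x : Space n) (r : ℝ) : IsOpen (blowUp A x r) :=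
  hA.preimage (by fun_prop : Continuous fun z : Space n => x + r • z)

lemma MeasurableSet.blowUp (hA : MeasurableSet A) (x : Space n) (r : ℝ) :
    MeasurableSet (blowUp A x r) :=
  (by fun_prop : Measurable fun z : Space n => x + r • z) hA

lemma volume_eq_mul_volume_blowUp (A : Set (Space n)) (x : Space n) (hr : 0 < r) :
    volume A = ENNReal.ofReal (r ^ n) * volume (blowUp A x r) := by
  have h1 : blowUp A x r = (fun z : Space n => r • z) ⁻¹' ((fun z => x + z) ⁻¹' A) := rfl
  rw [h1, Measure.addHaar_preimage_smul volume hr.ne', measure_preimage_add, ← mul_assoc,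
    ← ENNReal.ofReal_mul (by positivity)]
  have h2 : Module.finrank ℝ (Space n) = n := by simp
  rw [h2, abs_of_pos (by positivity), mul_inv_cancel₀ (by positivity), ENNReal.ofReal_one, one_mul]

lemma blowUp_ae_eq (h : A =ᵐ[volume] B) (x : Space n) (hr : 0 < r) :
    blowUp A x r =ᵐ[volume] blowUp B x r := by
  rw [ae_eq_set] at h ⊢
  have h1 : ∀ A B : Set (Space n), volume (A \ B) = 0 → volume (blowUp A x r \ blowUp B x r) = 0 := by
    intro A B hAB
    rw [volume_eq_mul_volume_blowUp _ x hr, mul_eq_zero] at hAB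
    refine hAB.resolve_left ?_
    have : 0 < r ^ n := by positivity
    simpa using this
  exact ⟨h1 _ _ h.1, h1 _ _ h.2⟩

lemma IsNormalizedIn.blowUp (h : IsNormalizedIn Ω E) (x : Space n) (hr : 0 < r) :
    IsNormalizedIn (blowUp Ω x r) (blowUp E x r) := by
  rintro y ⟨hy, hy'⟩ t ht
  rw [frontier_blowUp _ _ hr.ne'] at hy'
  obtain ⟨h1, h2⟩ := h (x + r • y) ⟨hy, hy'⟩ (r * t) (by positivity)
  have hball : ball y t = Capillarity.blowUp (ball (x + r • y) (r * t)) x r := by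
    ext z
    change _ ↔ x + r • z ∈ ball (x + r • y) (r * t)
    rw [mem_ball, mem_ball, dist_add_left, dist_smul₀, Real.norm_eq_abs, abs_of_pos hr,
      mul_lt_mul_iff_right₀ hr]
  rw [volume_eq_mul_volume_blowUp _ x hr] at h1 h2
  rw [hball]
  exact ⟨pos_of_mul_pos_right h1 zero_le, pos_of_mul_pos_right h2 zero_le⟩

/-- Interface bounds of a blow-up give interface bounds at the original scale. -/
lemma CrossBound.of_blowUp (x : Space n) (hr : 0 < r) (hM : 0 ≤ M)
    (h : CrossBound (blowUp A x r) (blowUp B x r) (blowUp S x r) M) :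
    ∃ M', CrossBound A B S M' := by
  refine ⟨r ^ n * (M * max r⁻¹ 1), fun z => ?_⟩
  rw [volume_eq_mul_volume_blowUp _ x hr, mul_assoc, ENNReal.ofReal_mul (by positivity)]
  gcongr
  have h1 : blowUp {y | y ∈ A ∧ y - z ∈ B ∧ (y ∈ S ∨ y - z ∈ S)} x r =
      {y | y ∈ blowUp A x r ∧ y - r⁻¹ • z ∈ blowUp B x r ∧
        (y ∈ blowUp S x r ∨ y - r⁻¹ • z ∈ blowUp S x r)} := by
    ext y
    have h2 : x + r • (y - r⁻¹ • z) = x + r • y - z := by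
      rw [smul_sub, smul_inv_smul₀ hr.ne', add_sub_assoc]
    have h3 : ∀ T : Set (Space n), y - r⁻¹ • z ∈ blowUp T x r ↔ x + r • y - z ∈ T := fun T => by
      rw [← h2]; rfl
    change (x + r • y ∈ A ∧ x + r • y - z ∈ B ∧ (x + r • y ∈ S ∨ x + r • y - z ∈ S)) ↔
      (x + r • y ∈ A ∧ y - r⁻¹ • z ∈ blowUp B x r ∧ (x + r • y ∈ S ∨ y - r⁻¹ • z ∈ blowUp S x r))
    rw [h3, h3]
  rw [h1]
  refine (h (r⁻¹ • z)).trans (ENNReal.ofReal_le_ofReal ?_)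
  rw [mul_assoc]
  refine mul_le_mul_of_nonneg_left ?_ hM
  have hr' : 0 < r⁻¹ := inv_pos.2 hr
  rw [norm_smul, Real.norm_eq_abs, abs_of_pos hr']
  rcases le_total ‖z‖ 1 with hz | hz
  · rw [min_eq_left hz]
    exact (min_le_left _ _).trans (mul_le_mul_of_nonneg_right (le_max_left _ _) (norm_nonneg _))
  · rw [min_eq_right hz, mul_one]
    exact (min_le_right _ _).trans (le_max_right _ _)

end blowup

section chart

variable {n : ℕ} {b s : ℝ} {x₀ : Space n} {Ω E : Set (Space n)} {F φ : Space n → ℝ}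
  {l m : Space n →L[ℝ] ℝ}

/-- Near the boundary point `x₀`, the container `Ω` is `{F > 0}` and the interface `Ω ∩ ∂E` is
contained in `{φ = 0}`, where `F` and `φ` are strictly differentiable at `x₀` with nonzero
differentials `l` and `m`. -/
structure ContactChart {n : ℕ} (Ω E : Set (Space n)) (x₀ : Space n) (F φ : Space n → ℝ)
    (l m : Space n →L[ℝ] ℝ) : Prop where
  container_deriv : HasStrictFDerivAt F l x₀
  interface_deriv : HasStrictFDerivAt φ m x₀
  container_zero : F x₀ = 0
  interface_zero : φ x₀ = 0
  container_ne : l ≠ 0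
  interface_ne : m ≠ 0
  mem_iff : ∀ᶠ y in 𝓝 x₀, (y ∈ Ω ↔ 0 < F y)
  interface : ∀ᶠ y in 𝓝 x₀, y ∈ Ω ∩ frontier E → φ y = 0

lemma exists_container_chart (hΩ : IsOpen Ω) (hΩ1 : HasC1Boundary Ω) (hx₀ : x₀ ∈ frontier Ω) :
    ∃ (F : Space n → ℝ) (l : Space n →L[ℝ] ℝ), HasStrictFDerivAt F l x₀ ∧ F x₀ = 0 ∧ l ≠ 0 ∧
      ∀ᶠ y in 𝓝 x₀, (y ∈ Ω ↔ 0 < F y) := by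
  obtain ⟨ν, hν, ψ, hψ, ρ, hρ, hiff⟩ := hΩ1 x₀ hx₀
  set F : Space n → ℝ := fun y => ⟪ν, y⟫ - ψ ((ℝ ∙ ν)ᗮ.orthogonalProjectionOnto y) with hF
  have hFc : ContDiff ℝ 1 F :=
    (contDiff_const.inner ℝ contDiff_id).sub
      (hψ.comp ((ℝ ∙ ν)ᗮ.orthogonalProjectionOnto).contDiff)
  have hiff' : ∀ᶠ y in 𝓝 x₀, (y ∈ Ω ↔ 0 < F y) := by
    filter_upwards [ball_mem_nhds x₀ hρ] with y hy
    rw [hiff y hy, hF, sub_pos]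
  have hstrict := hFc.contDiffAt.hasStrictFDerivAt (x := x₀) one_ne_zero
  refine ⟨F, fderiv ℝ F x₀, hstrict, ?_, ?_, hiff'⟩
  · have hx₀Ω : x₀ ∉ Ω := by
      rw [hΩ.frontier_eq] at hx₀
      exact hx₀.2
    refine le_antisymm (not_lt.1 fun h => hx₀Ω (hiff'.self_of_nhds.2 h)) (not_lt.1 fun h => ?_)
    have h1 : ∀ᶠ y in 𝓝 x₀, y ∉ Ω := by
      filter_upwards [hiff', hFc.continuous.continuousAt.eventually_lt_const h] with y hy hy' hyΩ
      exact (hy.1 hyΩ).not_gt hy'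
    exact mem_closure_iff_frequently.1 (frontier_subset_closure hx₀) h1
  · intro h0
    -- `F` has unit slope in the direction `ν`
    have h1 := hstrict.hasFDerivAt
    rw [h0] at h1
    have h2 : HasDerivAt (fun t : ℝ => x₀ + t • ν) ν 0 := by
      simpa using ((hasDerivAt_id (0 : ℝ)).smul_const ν).const_add x₀
    have h3 : HasFDerivAt F (0 : Space n →L[ℝ] ℝ) (x₀ + (0 : ℝ) • ν) := by simpa using h1
    have h4 := h3.comp_hasDerivAt (0 : ℝ) h2
    have h5 : (F ∘ fun t : ℝ => x₀ + t • ν) = fun t : ℝ => F x₀ + t := by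
      funext t
      have h6 : (ℝ ∙ ν)ᗮ.orthogonalProjectionOnto ν = 0 :=
        Submodule.orthogonalProjectionOnto_orthogonal_apply_eq_zero
          (Submodule.mem_span_singleton_self ν)
      simp only [hF, Function.comp_apply, map_add, map_smul, h6, smul_zero, add_zero,
          inner_add_right,
        inner_smul_right, real_inner_self_eq_norm_sq, hν]
      ring
    rw [h5] at h4
    have h7 : HasDerivAt (fun t : ℝ => F x₀ + t) 1 0 := by
      simpa using (hasDerivAt_id (0 : ℝ)).const_add (F x₀)
    have h8 := h4.unique h7
    simp at h8

lemma exists_interface_chart (hx₀ : x₀ ∈ regularSet s Ω E) :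
    ∃ (φ : Space n → ℝ) (m : Space n →L[ℝ] ℝ), HasStrictFDerivAt φ m x₀ ∧ φ x₀ = 0 ∧ m ≠ 0 ∧
      ∀ᶠ y in 𝓝 x₀, y ∈ Ω ∩ frontier E → φ y = 0 := by
  obtain ⟨hM, ρ, hρ, α, -, h⟩ := hx₀
  rcases h x₀ ⟨mem_ball_self hρ, hM⟩ with ⟨U, hU, hxU, φ, hφ, hφ0, hφ', hMU⟩ |
    ⟨-, U, hU, hxU, φ, η, hφ, -, hφ0, -, hli, hMU⟩
  · refine ⟨φ, fderiv ℝ φ x₀, (hφ.1.contDiffAt (hU.mem_nhds hxU)).hasStrictFDerivAt one_ne_zero,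
      hφ0, hφ', ?_⟩
    filter_upwards [hU.mem_nhds hxU] with y hyU hy
    have : y ∈ {y ∈ U | φ y = 0} := hMU ▸ ⟨subset_closure hy, hyU⟩
    exact this.2
  · refine ⟨φ, fderiv ℝ φ x₀, (hφ.1.contDiffAt (hU.mem_nhds hxU)).hasStrictFDerivAt one_ne_zero,
      hφ0, hli.ne_zero 0, ?_⟩
    filter_upwards [hU.mem_nhds hxU] with y hyU hy
    have : y ∈ {y ∈ U | φ y = 0 ∧ 0 ≤ η y} := hMU ▸ ⟨subset_closure hy, hyU⟩
    exact this.2.1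

theorem exists_contactChart (hΩ : IsOpen Ω) (hΩ1 : HasC1Boundary Ω)
    (hx₀ : x₀ ∈ regularSet s Ω E ∩ frontier Ω) :
    ∃ F φ l m, ContactChart Ω E x₀ F φ l m := by
  obtain ⟨F, l, h1, h2, h3, h4⟩ := exists_container_chart hΩ hΩ1 hx₀.2
  obtain ⟨φ, m, h5, h6, h7, h8⟩ := exists_interface_chart hx₀.1
  exact ⟨F, φ, l, m, h1, h5, h2, h6, h3, h7, h4, h8⟩

lemma eventually_forall_rescaled {p : Space n → Prop} (hp : ∀ᶠ y in 𝓝 x₀, p y) {x : ℕ → Space n}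
    {r : ℕ → ℝ} (hx : Tendsto x atTop (𝓝 x₀)) (hr : Tendsto r atTop (𝓝 0)) (hr0 : ∀ j, 0 < r j)
    (R : ℝ) : ∀ᶠ j in atTop, ∀ y ∈ ball (0 : Space n) R, p (x j + r j • y) := by
  obtain ⟨δ, hδ, h1⟩ := Metric.eventually_nhds_iff_ball.1 hp
  have h2 : Tendsto (fun j => ‖x j - x₀‖ + r j * R) atTop (𝓝 (‖x₀ - x₀‖ + 0 * R)) :=
    ((hx.sub_const x₀).norm).add (hr.mul_const R)
  rw [sub_self, norm_zero, zero_mul, add_zero] at h2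
  filter_upwards [h2.eventually_lt_const hδ] with j hj y hy
  refine h1 _ ?_
  rw [mem_ball_zero_iff] at hy
  rw [mem_ball, dist_eq_norm, add_sub_right_comm]
  refine (norm_add_le _ _).trans_lt ?_
  rw [norm_smul, Real.norm_eq_abs, abs_of_pos (hr0 j)]
  nlinarith [mul_lt_mul_of_pos_left hy (hr0 j)]

/-- The blow-ups of `Ω` and `E` at points `x j → x₀` of `{φ = 0}` form an interface sequence. -/
theorem ContactChart.interfaceSequence (h : ContactChart Ω E x₀ F φ l m) (hΩ : IsOpen Ω)
    (hE : E ⊆ Ω) (hEn : IsNormalizedIn Ω E) {x : ℕ → Space n} {r : ℕ → ℝ}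
    (hx : Tendsto x atTop (𝓝 x₀)) (hr : Tendsto r atTop (𝓝 0)) (hr0 : ∀ j, 0 < r j)
    (hφ : ∀ j, φ (x j) = 0) (hb : Tendsto (fun j => F (x j) / r j) atTop (𝓝 b)) :
    InterfaceSequence (fun j => blowUp Ω (x j) (r j)) (fun j => blowUp E (x j) (r j))
      (fun j y => F (x j + r j • y) / r j) (fun j y => φ (x j + r j • y) / r j) b l m where
  container_affine := asymptoticallyAffine_of_hasStrictFDerivAt h.container_deriv hx hr hr0 hb
  interface_affine := asymptoticallyAffine_of_hasStrictFDerivAt h.interface_deriv hx hr hr0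
    (by simp [hφ])
  isOpen j := IsOpen.blowUp hΩ _ _
  subset j y hy := hE hy
  mem_iff R _ := by
    filter_upwards [eventually_forall_rescaled h.mem_iff hx hr hr0 R] with j hj y hy
    rw [div_pos_iff_of_pos_right (hr0 j)]
    exact hj y hy
  interface R _ := by
    filter_upwards [eventually_forall_rescaled h.interface hx hr hr0 R] with j hj y hy hy'
    rw [frontier_blowUp _ _ (hr0 j).ne'] at hy'
    rw [hj y hy hy', zero_div]
  normalized j := hEn.blowUp _ (hr0 j)
  container_ne := h.container_ne
  interface_ne := h.interface_ne

end chart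

/-! ### The Lagrange multiplier -/

section multiplier

variable {n : ℕ} {s C σ M M' : ℝ} {a : Space n} {k k' η ζ K₁ K₂ g : Space n → ℝ}
  {A B S T Ω E : Set (Space n)}

lemma CrossBound.union (h : CrossBound A B S M) (h' : CrossBound A B T M') :
    CrossBound A B (S ∪ T) (max M 0 + max M' 0) := by
  intro z
  have hm : 0 ≤ min ‖z‖ 1 := by positivity
  rw [add_mul, ENNReal.ofReal_add (by positivity) (by positivity)]
  have h1 := (h.mono_const (le_max_left M 0)) z
  have h2 := (h'.mono_const (le_max_left M' 0)) z
  refine (measure_mono ?_).trans ((measure_union_le _ _).trans (add_le_add h1 h2))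
  rintro x ⟨hx1, hx2, (hx | hx) | (hx | hx)⟩
  · exact Or.inl ⟨hx1, hx2, Or.inl hx⟩
  · exact Or.inr ⟨hx1, hx2, Or.inl hx⟩
  · exact Or.inl ⟨hx1, hx2, Or.inr hx⟩
  · exact Or.inr ⟨hx1, hx2, Or.inr hx⟩

lemma CrossBound.mono_set (h : CrossBound A B S M) (hTS : T ⊆ S) : CrossBound A B T M := by
  intro z
  refine (measure_mono ?_).trans (h z)
  rintro x ⟨hx1, hx2, hx | hx⟩
  · exact ⟨hx1, hx2, Or.inl (hTS hx)⟩
  · exact ⟨hx1, hx2, Or.inr (hTS hx)⟩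

/-- Smooth profiles supported in a compact subset of `Ω` near which the interfaces of `A` with
`Ω \ A` and with `Ωᶜ` are tame. -/
structure TameProfile {n : ℕ} (Ω A : Set (Space n)) (η : Space n → ℝ) : Prop where
  smooth : ContDiff ℝ ∞ η
  compact : HasCompactSupport η
  support : tsupport η ⊆ Ω
  inner : ∃ M, CrossBound A (Ω \ A) (tsupport η) M
  outer : ∃ M, CrossBound A Ωᶜ (tsupport η) M

/-- The first variation of the capillarity energy of `A` along the vector field `η a`. -/
def energyVariation {n : ℕ} (a : Space n) (K₁ K₂ : Space n → ℝ) (σ : ℝ) (g : Space n → ℝ)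
    (Ω A : Set (Space n)) (η : Space n → ℝ) : ℝ :=
  interactionVariation K₁ (dirDeriv a K₁) A (Ω \ A) η (dirDeriv a η) +
    σ * interactionVariation K₂ (dirDeriv a K₂) A Ωᶜ η (dirDeriv a η) +
    ∫ x in A, (dirDeriv a η x * g x + η x * dirDeriv a g x)

lemma dirDeriv_sub_const_mul (hη : Differentiable ℝ η) (hζ : Differentiable ℝ ζ) (c : ℝ) :
    dirDeriv a (fun x => η x - c * ζ x) = fun x => dirDeriv a η x - c * dirDeriv a ζ x := by
  funext x
  have h1 := (hη x).hasFDerivAt.sub ((hζ x).hasFDerivAt.const_mul c)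
  have h2 : fderiv ℝ (fun x => η x - c * ζ x) x = fderiv ℝ η x - c • fderiv ℝ ζ x := h1.fderiv
  simp [dirDeriv, h2]

lemma interactionVariation_sub_const_mul (hn : 2 ≤ n) (hs : s ∈ Ioo (0 : ℝ) 1)
    (hk : KernelPair s C a k k') {L L' : ℝ} {η' ζ' : Space n → ℝ} (hη : Profile a S L η η')
    (hζ : Profile a T L' ζ ζ') (hA : MeasurableSet A) (hB : MeasurableSet B)
    (hM : CrossBound A B S M) (hM' : CrossBound A B T M') (c : ℝ) :
    interactionVariation k k' A B (fun x => η x - c * ζ x) (fun x => η' x - c * ζ' x) =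
      interactionVariation k k' A B η η' - c * interactionVariation k k' A B ζ ζ' := by
  have h1 := integrable_variationIntegrand hn hs hk hη hA hB hM
  have h2 := integrable_variationIntegrand hn hs hk hζ hA hB hM'
  unfold interactionVariation
  rw [← integral_const_mul, ← integral_sub h1 (h2.const_mul c)]
  congr 1
  funext p
  by_cases hp : p ∈ crossPairs A B
  · simp only [indicator_of_mem hp, variationIntegrand]
    ring
  · simp [indicator_of_notMem hp]

lemma integrable_dirDeriv (hη : ContDiff ℝ ∞ η) (hc : HasCompactSupport η) :
    Integrable (dirDeriv a η) := by
  have h1 : ContDiff ℝ 1 η := hη.of_le (by exact_mod_cast le_top)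
  have h2 : Continuous (dirDeriv a η) := (h1.continuous_fderiv one_ne_zero).clm_apply
      continuous_const
  refine h2.integrable_of_hasCompactSupport ?_
  exact (hc.fderiv ℝ).comp_left (g := fun f : Space n →L[ℝ] ℝ => f a) (by simp)

/-- The Euler-Lagrange equation with a Lagrange multiplier for the volume constraint: a profile `ζ`
which changes the volume to first order compensates for the variation of volume. -/
theorem energyVariation_eq_mul (hn : 2 ≤ n) (hs : s ∈ Ioo (0 : ℝ) 1) (ha : ‖a‖ = 1)
    (hk₁ : KernelPair s C a K₁ (dirDeriv a K₁)) (hk₂ : KernelPair s C a K₂ (dirDeriv a K₂))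
    (h₁0 : ∀ z, z ≠ 0 → 0 ≤ K₁ z) (h₂0 : ∀ z, z ≠ 0 → 0 ≤ K₂ z)
    (hg : ContDiff ℝ 1 g) (hΩo : IsOpen Ω) (hΩb : Bornology.IsBounded Ω)
    (hE : IsVolumeConstrainedCritical K₁ K₂ σ g Ω E)
    (hA : MeasurableSet A) (hAE' : A ⊆ E) (hAE : A =ᵐ[volume] E)
    (hζ : TameProfile Ω A ζ) (hζ0 : ∫ x in A, dirDeriv a ζ x ≠ 0) (hη : TameProfile Ω A η) :
    energyVariation a K₁ K₂ σ g Ω A η = (∫ x in A, dirDeriv a η x) *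
      (energyVariation a K₁ K₂ σ g Ω A ζ / ∫ x in A, dirDeriv a ζ x) := by
  obtain ⟨M₁, hM₁⟩ := hη.inner
  obtain ⟨M₂, hM₂⟩ := hη.outer
  obtain ⟨N₁, hN₁⟩ := hζ.inner
  obtain ⟨N₂, hN₂⟩ := hζ.outer
  have hηd : Differentiable ℝ η := hη.smooth.differentiable (by simp)
  have hζd : Differentiable ℝ ζ := hζ.smooth.differentiable (by simp)
  obtain ⟨L, hL⟩ := exists_profile ha hη.smooth hη.compact hη.compact subset_rfl
  obtain ⟨L', hL'⟩ := exists_profile ha hζ.smooth hζ.compact hζ.compact subset_rfl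
  set c := (∫ x in A, dirDeriv a η x) / ∫ x in A, dirDeriv a ζ x with hc
  have hder := dirDeriv_sub_const_mul (a := a) hηd hζd c
  have hsupp : tsupport (fun x => η x - c * ζ x) ⊆ tsupport η ∪ tsupport ζ := by
    refine closure_minimal ?_ ((isClosed_tsupport η).union (isClosed_tsupport ζ))
    intro x hx
    by_contra hcon
    have h1 : η x = 0 := image_eq_zero_of_notMem_tsupport fun h => hcon (Or.inl h)
    have h2 : ζ x = 0 := image_eq_zero_of_notMem_tsupport fun h => hcon (Or.inr h)
    exact hx (by simp [h1, h2])
  have hcomp : IsCompact (tsupport η ∪ tsupport ζ) :=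
    IsCompact.union hη.compact hζ.compact
  have hiη := integrable_dirDeriv (a := a) hη.smooth hη.compact
  have hiζ := integrable_dirDeriv (a := a) hζ.smooth hζ.compact
  have h0 : ∫ x in A, dirDeriv a (fun x => η x - c * ζ x) x = 0 := by
    rw [hder, integral_sub hiη.integrableOn (hiζ.integrableOn.const_mul c), integral_const_mul, hc,
      div_mul_cancel₀ _ hζ0, sub_self]
  have hEL := weak_eulerLagrange hn hs ha hk₁ hk₂ h₁0 h₂0 hg hΩo hΩb hE hA hAE' hAE
    (hη.smooth.sub (contDiff_const.mul hζ.smooth))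
    (HasCompactSupport.of_support_subset_isCompact hcomp ((subset_tsupport _).trans hsupp)) hcomp hsupp
    (hsupp.trans (union_subset hη.support hζ.support)) h0 (hM₁.union hN₁) (hM₂.union hN₂)
  rw [hder, interactionVariation_sub_const_mul hn hs hk₁ hL hL' hA (hΩo.measurableSet.diff hA) hM₁ hN₁,
    interactionVariation_sub_const_mul hn hs hk₂ hL hL' hA hΩo.measurableSet.compl hM₂ hN₂] at hEL
  have hgc : Continuous (dirDeriv a g) := (hg.continuous_fderiv one_ne_zero).clm_apply
      continuous_const
  have hint : ∀ θ : Space n → ℝ, ContDiff ℝ ∞ θ → HasCompactSupport θ →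
      IntegrableOn (fun x => dirDeriv a θ x * g x + θ x * dirDeriv a g x) A := by
    intro θ hθ hθc
    have h1 : ContDiff ℝ 1 θ := hθ.of_le (by exact_mod_cast le_top)
    have h2 : Continuous (dirDeriv a θ) :=
      (h1.continuous_fderiv one_ne_zero).clm_apply continuous_const
    have h3 : HasCompactSupport (dirDeriv a θ) :=
      (hθc.fderiv ℝ).comp_left (g := fun f : Space n →L[ℝ] ℝ => f a) (by simp)
    exact (((h2.mul hg.continuous).integrable_of_hasCompactSupport h3.mul_right).add
      ((hθ.continuous.mul hgc).integrable_of_hasCompactSupport hθc.mul_right)).integrableOn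
  have hlin : ∫ x in A, ((dirDeriv a η x - c * dirDeriv a ζ x) * g x +
      (η x - c * ζ x) * dirDeriv a g x) =
      (∫ x in A, (dirDeriv a η x * g x + η x * dirDeriv a g x)) -
        c * ∫ x in A, (dirDeriv a ζ x * g x + ζ x * dirDeriv a g x) := by
    rw [← integral_const_mul, ← integral_sub (hint η hη.smooth hη.compact)
      ((hint ζ hζ.smooth hζ.compact).const_mul c)]
    congr 1
    funext x
    ring
  rw [hlin] at hEL
  have hfin : energyVariation a K₁ K₂ σ g Ω A η = c * energyVariation a K₁ K₂ σ g Ω A ζ := by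
    unfold energyVariation
    linarith
  rw [hfin, hc]
  ring

end multiplier

/-! ### Rescaled profiles -/

section rescaled

variable {n : ℕ} {r : ℝ} {a x₀ : Space n} {η f : Space n → ℝ} {A : Set (Space n)}

lemma dirDeriv_rescale (hη : Differentiable ℝ η) (x₀ : Space n) (r : ℝ) :
    dirDeriv a (fun x => η (r⁻¹ • (x - x₀))) = fun x => r⁻¹ * dirDeriv a η (r⁻¹ • (x - x₀)) := by
  funext x
  have h1 : HasFDerivAt (fun x : Space n => r⁻¹ • (x - x₀))
      (r⁻¹ • ContinuousLinearMap.id ℝ (Space n)) x :=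
    ((hasFDerivAt_id x).sub_const x₀).const_smul r⁻¹
  have h2 := (hη (r⁻¹ • (x - x₀))).hasFDerivAt.comp x h1
  have h3 : fderiv ℝ (fun x => η (r⁻¹ • (x - x₀))) x = _ := h2.fderiv
  simp [dirDeriv, h3]

lemma tsupport_rescale (r : ℝ) (η : Space n → ℝ) (x₀ : Space n) :
    tsupport (fun x => η (r⁻¹ • (x - x₀))) ⊆ {x | r⁻¹ • (x - x₀) ∈ tsupport η} := by
  have hcl : IsClosed {x | r⁻¹ • (x - x₀) ∈ tsupport η} :=
    (isClosed_tsupport η).preimage (by fun_prop : Continuous fun x : Space n => r⁻¹ • (x - x₀))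
  exact closure_minimal (fun x hx => subset_tsupport η hx) hcl

lemma hasCompactSupport_rescale (hr : 0 < r) (hη : HasCompactSupport η) (x₀ : Space n) :
    HasCompactSupport (fun x => η (r⁻¹ • (x - x₀))) :=
  hη.comp_homeomorph ((Homeomorph.subRight x₀).trans (Homeomorph.smulOfNeZero r⁻¹ (inv_ne_zero hr.ne')))

lemma integral_rescale (f : Space n → ℝ) (x₀ : Space n) (hr : 0 < r) :
    ∫ x, f (r⁻¹ • (x - x₀)) = r ^ n * ∫ x, f x := by
  rw [integral_sub_right_eq_self (fun x => f (r⁻¹ • x)) x₀,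
    Measure.integral_comp_inv_smul_of_nonneg _ _ hr.le]
  simp

lemma setIntegral_rescale (hA : MeasurableSet A) (f : Space n → ℝ) (x₀ : Space n) (hr : 0 < r) :
    ∫ x in A, f (r⁻¹ • (x - x₀)) = r ^ n * ∫ x in blowUp A x₀ r, f x := by
  rw [← integral_indicator hA, ← integral_indicator (MeasurableSet.blowUp hA x₀ r),
    ← integral_rescale _ x₀ hr]
  congr 1
  funext x
  have hiff : r⁻¹ • (x - x₀) ∈ blowUp A x₀ r ↔ x ∈ A := by
    change x₀ + r • (r⁻¹ • (x - x₀)) ∈ A ↔ x ∈ A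
    rw [smul_inv_smul₀ hr.ne', add_sub_cancel]
  by_cases hx : x ∈ A
  · rw [indicator_of_mem hx, indicator_of_mem (hiff.2 hx)]
  · rw [indicator_of_notMem hx, indicator_of_notMem (mt hiff.1 hx)]

end rescaled

/-! ### Blow-up of the Euler-Lagrange equation -/

section blowup_limit

variable {n : ℕ} {s C σ b : ℝ} {a : Space n} {K₁ K₂ K₁star K₂star k₁' k₂' g η : Space n → ℝ}
  {A Ω E S : Set (Space n)} {x : ℕ → Space n} {r : ℕ → ℝ} {F φ : ℕ → Space n → ℝ}
  {l m : Space n →L[ℝ] ℝ}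

lemma exists_crossBound_blowUp (hr0 : ∀ j, 0 < r j)
    (h : InterfaceSequence (fun j => blowUp Ω (x j) (r j)) (fun j => blowUp E (x j) (r j)) F φ b l m)
    (hAE : A =ᵐ[volume] E) (hS : IsCompact S) (hSH : ∀ y ∈ S, 0 < b + l y) :
    ∃ M, 0 ≤ M ∧ ∀ᶠ j in atTop,
      CrossBound (blowUp A (x j) (r j)) (blowUp (Ω \ A) (x j) (r j)) S M ∧
      CrossBound (blowUp A (x j) (r j)) (blowUp Ωᶜ (x j) (r j)) S M := by
  obtain ⟨M₁, hM₁, h1⟩ := h.exists_crossBound_inner hS hSH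
  obtain ⟨M₂, hM₂, h2⟩ := h.exists_crossBound_outer hS hSH
  refine ⟨max M₁ M₂, le_max_of_le_left hM₁, ?_⟩
  filter_upwards [h1, h2] with j h1 h2
  have e := blowUp_ae_eq hAE (x j) (hr0 j)
  refine ⟨(h1.mono_const (le_max_left _ _)).mono_ae e.le ?_,
    (h2.mono_const (le_max_right _ _)).mono_ae e.le (ae_eq_refl _).le⟩
  exact ((ae_eq_refl (blowUp Ω (x j) (r j))).diff e).le

lemma eventually_tameProfile_rescale (hr0 : ∀ j, 0 < r j)
    (h : InterfaceSequence (fun j => blowUp Ω (x j) (r j)) (fun j => blowUp E (x j) (r j)) F φ b l m)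
    (hAE : A =ᵐ[volume] E) (hη : ContDiff ℝ ∞ η) (hc : HasCompactSupport η)
    (hηH : ∀ y ∈ tsupport η, 0 < b + l y) :
    ∀ᶠ j in atTop, TameProfile Ω A (fun y => η ((r j)⁻¹ • (y - x j))) := by
  obtain ⟨M, hM, h1⟩ := exists_crossBound_blowUp hr0 h hAE hc hηH
  filter_upwards [h1, h.eventually_subset hc hηH] with j h1 h2
  have hsub := tsupport_rescale (r j) η (x j)
  have hblow : blowUp (tsupport fun y => η ((r j)⁻¹ • (y - x j))) (x j) (r j) ⊆ tsupport η := by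
    intro y hy
    have h3 : (r j)⁻¹ • (x j + r j • y - x j) ∈ tsupport η := hsub hy
    rwa [add_sub_cancel_left, inv_smul_smul₀ (hr0 j).ne'] at h3
  refine ⟨?_, hasCompactSupport_rescale (hr0 j) hc _, fun y hy => ?_,
    CrossBound.of_blowUp (x j) (hr0 j) hM (h1.1.mono_set hblow),
    CrossBound.of_blowUp (x j) (hr0 j) hM (h1.2.mono_set hblow)⟩
  · exact hη.comp (contDiff_const_smul _ |>.comp (contDiff_id.sub contDiff_const))
  · have h3 : x j + r j • ((r j)⁻¹ • (y - x j)) ∈ Ω := h2 (hsub hy)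
    rwa [smul_inv_smul₀ (hr0 j).ne', add_sub_cancel] at h3

lemma tendsto_setIntegral_of_ae {B : ℕ → Set (Space n)} {W : Set (Space n)} {f : Space n → ℝ}
    (hf : Integrable f) (hB : ∀ j, MeasurableSet (B j)) (hW : MeasurableSet W)
    (hBW : ∀ᵐ y, ∀ᶠ j in atTop, (y ∈ B j ↔ y ∈ W)) :
    Tendsto (fun j => ∫ y in B j, f y) atTop (𝓝 (∫ y in W, f y)) := by
  simp only [← integral_indicator (hB _), ← integral_indicator hW]
  refine tendsto_integral_of_dominated_convergence (fun y => ‖f y‖)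
    (fun j => (hf.indicator (hB j)).aestronglyMeasurable) hf.norm
    (fun j => Eventually.of_forall fun y => norm_indicator_le_norm_self f y) ?_
  filter_upwards [hBW] with y hy
  refine tendsto_const_nhds.congr' ?_
  filter_upwards [hy] with j hj
  by_cases hyW : y ∈ W
  · rw [indicator_of_mem hyW, indicator_of_mem (hj.2 hyW)]
  · rw [indicator_of_notMem hyW, indicator_of_notMem (mt hj.1 hyW)]

lemma abs_setIntegral_le_integral_abs {f : Space n → ℝ} (hf : Integrable f) :
    |∫ y in A, f y| ≤ ∫ y, |f y| :=
  (abs_integral_le_integral_abs).trans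
    (setIntegral_le_integral hf.abs (Eventually.of_forall fun y => abs_nonneg (f y)))

/-- The lower order terms of the rescaled first variation. -/
lemma abs_potential_term_le (hΩb : Bornology.IsBounded Ω) (hAΩ : A ⊆ Ω) (hA : MeasurableSet A)
    (hg : ContDiff ℝ 1 g) :
    ∃ G, 0 ≤ G ∧ ∀ η : Space n → ℝ, ContDiff ℝ ∞ η → HasCompactSupport η →
      |∫ y in A, (dirDeriv a η y * g y + η y * dirDeriv a g y)| ≤
        G * ((∫ y, |dirDeriv a η y|) + ∫ y, |η y|) := by
  have hgc : Continuous (dirDeriv a g) := (hg.continuous_fderiv one_ne_zero).clm_apply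
      continuous_const
  have hK : IsCompact (closure Ω) := hΩb.isCompact_closure
  obtain ⟨G₁, hG₁⟩ := hK.exists_bound_of_continuousOn hg.continuous.continuousOn
  obtain ⟨G₂, hG₂⟩ := hK.exists_bound_of_continuousOn hgc.continuousOn
  refine ⟨max (max G₁ G₂) 0, le_max_right _ _, fun η hη hc => ?_⟩
  have hi1 := (integrable_dirDeriv (a := a) hη hc).abs
  have hi2 : Integrable (fun y => |η y|) := (hη.continuous.integrable_of_hasCompactSupport hc).abs
  rw [← integral_add hi1 hi2, ← integral_const_mul]
  have hi := (hi1.add hi2).const_mul (max (max G₁ G₂) 0)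
  change ‖∫ y in A, (dirDeriv a η y * g y + η y * dirDeriv a g y)‖ ≤ _
  refine (norm_integral_le_of_norm_le hi.integrableOn (ae_restrict_of_forall_mem hA fun y hy => ?_)).trans
    (setIntegral_le_integral hi (Eventually.of_forall fun y => ?_))
  · have h1 := (hG₁ y (subset_closure (hAΩ hy))).trans
      ((le_max_left G₁ G₂).trans (le_max_left _ 0))
    have h2 := (hG₂ y (subset_closure (hAΩ hy))).trans
      ((le_max_right G₁ G₂).trans (le_max_left _ 0))
    rw [Real.norm_eq_abs] at h1 h2 ⊢
    refine (abs_add_le _ _).trans ?_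
    rw [abs_mul, abs_mul, Pi.add_apply, mul_add]
    have e1 := mul_le_mul_of_nonneg_left h1 (abs_nonneg (dirDeriv a η y))
    have e2 := mul_le_mul_of_nonneg_left h2 (abs_nonneg (η y))
    linarith
  · exact mul_nonneg (le_max_right _ _) (add_nonneg (abs_nonneg _) (abs_nonneg _))

/-- The blow-up limit of a critical set is in equilibrium: if the blow-ups of `E` converge to the
intersection of the limit container `{b + l > 0}` with `{⟪a, ·⟫ > 0}`, then the equilibrium density
vanishes along the limit interface. The interaction terms scale with the power `n - s - 1`, whereas
the potential and the volume constraint scale with the power `n - 1` and disappear. -/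
theorem blowUp_flatBalance_eq_zero (hn : 2 ≤ n) (hs : s ∈ Ioo (0 : ℝ) 1) (ha : ‖a‖ = 1)
    (hk₁ : KernelPair s C a K₁ (dirDeriv a K₁)) (hk₂ : KernelPair s C a K₂ (dirDeriv a K₂))
    (hk₁s : KernelPair s C a K₁star k₁') (hk₂s : KernelPair s C a K₂star k₂')
    (hlim₁ : AdmitsBlowUpLimit s K₁ K₁star) (hlim₂ : AdmitsBlowUpLimit s K₂ K₂star)
    (hlim₁' : ∀ z, z ≠ 0 → Tendsto (fun r : ℝ => r ^ ((n : ℝ) + s + 1) * dirDeriv a K₁ (r • z))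
      (𝓝[>] 0) (𝓝 (k₁' z)))
    (hlim₂' : ∀ z, z ≠ 0 → Tendsto (fun r : ℝ => r ^ ((n : ℝ) + s + 1) * dirDeriv a K₂ (r • z))
      (𝓝[>] 0) (𝓝 (k₂' z)))
    (h₁0 : ∀ z, z ≠ 0 → 0 ≤ K₁ z) (h₂0 : ∀ z, z ≠ 0 → 0 ≤ K₂ z)
    (hg : ContDiff ℝ 1 g) (hΩo : IsOpen Ω) (hΩb : Bornology.IsBounded Ω)
    (hE : IsVolumeConstrainedCritical K₁ K₂ σ g Ω E)
    (hr : Tendsto r atTop (𝓝 0)) (hr0 : ∀ j, 0 < r j)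
    (h : InterfaceSequence (fun j => blowUp Ω (x j) (r j)) (fun j => blowUp E (x j) (r j)) F φ b l m)
    (hconv : ∀ᵐ y : Space n, ∀ᶠ j in atTop,
      (y ∈ blowUp E (x j) (r j) ↔ 0 < b + l y ∧ 0 < ⟪a, y⟫))
    {v : Space n} (hv : 0 < b + l v) (hva : ⟪a, v⟫ = 0) :
    flatBalance K₁star K₂star σ a {y | 0 < b + l y} v = 0 := by
  obtain ⟨A, hAE', hA, hAE⟩ := hE.measurable.exists_measurable_subset_ae_eq
  set H : Set (Space n) := {y | 0 < b + l y} with hH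
  have hHo : IsOpen H := isOpen_lt continuous_const (by fun_prop)
  have hW : MeasurableSet (H ∩ upperHalf a) := hHo.measurableSet.inter measurableSet_upperHalf
  have hAm : ∀ j, MeasurableSet (blowUp A (x j) (r j)) := fun j => MeasurableSet.blowUp hA _ _
  have hBm : ∀ j, MeasurableSet (blowUp (Ω \ A) (x j) (r j)) := fun j =>
    MeasurableSet.blowUp (hΩo.measurableSet.diff hA) _ _
  have hCm : ∀ j, MeasurableSet (blowUp Ωᶜ (x j) (r j)) := fun j =>
    MeasurableSet.blowUp hΩo.measurableSet.compl _ _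
  have hAl : ∀ᵐ y : Space n, ∀ᶠ j in atTop, (y ∈ blowUp A (x j) (r j) ↔ y ∈ H ∩ upperHalf a) := by
    have h1 : ∀ᵐ y : Space n, ∀ j, (y ∈ blowUp A (x j) (r j) ↔ y ∈ blowUp E (x j) (r j)) :=
      ae_all_iff.2 fun j => (blowUp_ae_eq hAE (x j) (hr0 j)).mem_iff
    filter_upwards [h1, hconv] with y hy1 hy2
    filter_upwards [hy2] with j hj
    rw [hy1 j, hj]
    rfl
  have hBl : ∀ᵐ y : Space n, ∀ᶠ j in atTop,
      (y ∈ blowUp (Ω \ A) (x j) (r j) ↔ y ∈ H \ (H ∩ upperHalf a)) := by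
    filter_upwards [hAl, h.ae_eventually_mem_container] with y hy1 hy2
    filter_upwards [hy1, hy2] with j h1 h2
    exact and_congr h2 (not_congr h1)
  have hCl : ∀ᵐ y : Space n, ∀ᶠ j in atTop, (y ∈ blowUp Ωᶜ (x j) (r j) ↔ y ∈ Hᶜ) := by
    filter_upwards [h.ae_eventually_mem_container] with y hy2
    filter_upwards [hy2] with j h2
    exact not_congr h2
  have hr' : Tendsto r atTop (𝓝[>] 0) :=
    tendsto_nhdsWithin_iff.2 ⟨hr, Eventually.of_forall hr0⟩
  -- a rescaled profile which changes the volume of `E` at first order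
  obtain ⟨ζ, hζ, hζc, hζH, hζ0⟩ := exists_volume_changing_profile ha hHo hv hva
  obtain ⟨J, hJ, hJ0⟩ : ∃ J, TameProfile Ω A (fun y => ζ ((r J)⁻¹ • (y - x J))) ∧
      ∫ y in A, dirDeriv a (fun y => ζ ((r J)⁻¹ • (y - x J))) y ≠ 0 := by
    have h1 := tendsto_setIntegral_of_ae (integrable_dirDeriv (a := a) hζ hζc) hAm hW hAl
    obtain ⟨J, h2, h3⟩ := ((h1.eventually_ne hζ0).and
      (eventually_tameProfile_rescale hr0 h hAE hζ hζc hζH)).exists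
    refine ⟨J, h3, ?_⟩
    rw [dirDeriv_rescale (hζ.differentiable (by simp)), integral_const_mul,
      setIntegral_rescale hA _ _ (hr0 J)]
    have := (hr0 J).ne'
    positivity
  set Λ := energyVariation a K₁ K₂ σ g Ω A (fun y => ζ ((r J)⁻¹ • (y - x J))) /
    ∫ y in A, dirDeriv a (fun y => ζ ((r J)⁻¹ • (y - x J))) y with hΛ
  obtain ⟨G, hG, hGb⟩ := abs_potential_term_le (a := a) hΩb (hAE'.trans hE.subset) hA hg
  refine flatBalance_eq_zero hn hs ha hHo hk₁s hk₂s (fun η hη hc hηH => ?_) hv hva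
  obtain ⟨M, hM, hcross⟩ := exists_crossBound_blowUp hr0 h hAE hc hηH
  obtain ⟨L, hL⟩ := exists_profile ha hη hc hc subset_rfl
  have hSm : MeasurableSet (tsupport η) := (isClosed_tsupport η).measurableSet
  have hHW : MeasurableSet (H \ (H ∩ upperHalf a)) := hHo.measurableSet.diff hW
  refine ⟨⟨M, CrossBound.of_tendsto hAm hBm hSm hW hHW hAl hBl (hcross.mono fun j hj => hj.1)⟩,
    ⟨M, CrossBound.of_tendsto hAm hCm hSm hW hHo.measurableSet.compl hAl hCl
      (hcross.mono fun j hj => hj.2)⟩, ?_⟩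
  have t1 := tendsto_interactionVariation hn hs (fun j => hk₁.rescale (hr0 j)) hk₁s
    (fun z hz => (hlim₁ z hz).comp hr') (fun z hz => (hlim₁' z hz).comp hr') hL hAm hBm hW hHW hAl hBl
    (hcross.mono fun j hj => hj.1)
  have t2 := tendsto_interactionVariation hn hs (fun j => hk₂.rescale (hr0 j)) hk₂s
    (fun z hz => (hlim₂ z hz).comp hr') (fun z hz => (hlim₂' z hz).comp hr') hL hAm hCm hW
    hHo.measurableSet.compl hAl hCl (hcross.mono fun j hj => hj.2)
  refine tendsto_nhds_unique (t1.add (t2.const_mul σ)) ?_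
  set P := ∫ y, |dirDeriv a η y| with hP
  set Q := ∫ y, |η y| with hQ
  have hbound : ∀ᶠ j in atTop, ‖interactionVariation
      (fun z => r j ^ ((n : ℝ) + s) * K₁ (r j • z))
      (fun z => r j ^ ((n : ℝ) + s + 1) * dirDeriv a K₁ (r j • z))
      (blowUp A (x j) (r j)) (blowUp (Ω \ A) (x j) (r j)) η (dirDeriv a η) +
      σ * interactionVariation (fun z => r j ^ ((n : ℝ) + s) * K₂ (r j • z))
      (fun z => r j ^ ((n : ℝ) + s + 1) * dirDeriv a K₂ (r j • z))
      (blowUp A (x j) (r j)) (blowUp Ωᶜ (x j) (r j)) η (dirDeriv a η)‖ ≤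
      r j ^ s * ((|Λ| + G) * P + G * (r j * Q)) := by
    filter_upwards [eventually_tameProfile_rescale hr0 h hAE hη hc hηH] with j hj
    have hrj := hr0 j
    set ηj : Space n → ℝ := fun y => η ((r j)⁻¹ • (y - x j)) with hηj
    have hder : dirDeriv a ηj = fun y => (r j)⁻¹ * dirDeriv a η ((r j)⁻¹ • (y - x j)) :=
      dirDeriv_rescale (hη.differentiable (by simp)) _ _
    have hEL := energyVariation_eq_mul hn hs ha hk₁ hk₂ h₁0 h₂0 hg hΩo hΩb hE hA hAE' hAE hJ hJ0 hj
    rw [← hΛ, energyVariation] at hEL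
    have hP' : ∫ y, |dirDeriv a ηj y| = (r j)⁻¹ * (r j ^ n * P) := by
      rw [hder]
      simp only [abs_mul, abs_of_pos (inv_pos.2 hrj)]
      rw [integral_const_mul, integral_rescale (fun y => |dirDeriv a η y|) _ hrj]
    have hQ' : ∫ y, |ηj y| = r j ^ n * Q := integral_rescale (fun y => |η y|) _ hrj
    have b1 := hGb ηj hj.smooth hj.compact
    have b2 := abs_setIntegral_le_integral_abs (A := A) (integrable_dirDeriv (a := a) hj.smooth hj.compact)
    rw [hP'] at b1 b2
    rw [hQ'] at b1
    rw [hder, interactionVariation_rescale (x j) hrj, interactionVariation_rescale (x j) hrj,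
      ← hder] at hEL
    set I₁ := interactionVariation
      (fun z => r j ^ ((n : ℝ) + s) * K₁ (r j • z))
      (fun z => r j ^ ((n : ℝ) + s + 1) * dirDeriv a K₁ (r j • z))
      (blowUp A (x j) (r j)) (blowUp (Ω \ A) (x j) (r j)) η (dirDeriv a η)
    set I₂ := interactionVariation (fun z => r j ^ ((n : ℝ) + s) * K₂ (r j • z))
      (fun z => r j ^ ((n : ℝ) + s + 1) * dirDeriv a K₂ (r j • z))
      (blowUp A (x j) (r j)) (blowUp Ωᶜ (x j) (r j)) η (dirDeriv a η)
    set T₁ := ∫ y in A, (dirDeriv a ηj y * g y + ηj y * dirDeriv a g y)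
    set T₂ := ∫ y in A, dirDeriv a ηj y
    set q := r j ^ ((n : ℝ) - s - 1) with hq
    have hqpos : 0 < q := Real.rpow_pos_of_pos hrj _
    have e1 : (r j)⁻¹ * r j ^ n = q * r j ^ s := by
      rw [hq, ← Real.rpow_add hrj, ← Real.rpow_natCast, ← Real.rpow_neg_one, ← Real.rpow_add hrj]
      congr 1; ring
    have e2 : r j ^ n = q * r j ^ s * r j := by
      rw [← e1]; field_simp
    have e3 : q * (I₁ + σ * I₂) = T₂ * Λ - T₁ := by linarith
    have e4 : q * |I₁ + σ * I₂| ≤ q * (r j ^ s * ((|Λ| + G) * P + G * (r j * Q))) := by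
      calc q * |I₁ + σ * I₂| = |T₂ * Λ - T₁| := by rw [← e3, abs_mul, abs_of_pos hqpos]
        _ ≤ |T₂| * |Λ| + |T₁| := by rw [← abs_mul]; exact abs_sub _ _
        _ ≤ ((r j)⁻¹ * (r j ^ n * P)) * |Λ| + G * ((r j)⁻¹ * (r j ^ n * P) + r j ^ n * Q) := by
          gcongr
        _ = _ := by
          rw [← mul_assoc, e1, e2]
          ring
    exact le_of_mul_le_mul_left e4 hqpos
  have hzero : Tendsto (fun j => r j ^ s * ((|Λ| + G) * P + G * (r j * Q))) atTop (𝓝 0) := by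
    have h1 : Tendsto (fun j => r j ^ s) atTop (𝓝 0) := by
      have := (Real.continuousAt_rpow_const 0 s (Or.inr hs.1.le)).tendsto.comp hr
      rwa [Real.zero_rpow hs.1.ne'] at this
    have h2 := h1.mul ((tendsto_const_nhds (x := (|Λ| + G) * P)).add ((hr.mul_const Q).const_mul G))
    rwa [zero_mul] at h2
  exact squeeze_zero_norm' hbound hzero

end blowup_limit

/-! ### Half-spaces and wedges -/

section halfspaces

variable {n : ℕ}

/-- An almost everywhere limit along a sequence of scales agrees with the blow-up limit in
`L¹_loc`. -/
lemma BlowUpConverges.ae_eq {A G G' : Set (Space n)} {x₀ : Space n} {r : ℕ → ℝ}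
    (hG : BlowUpConverges A x₀ G) (hr : Tendsto r atTop (𝓝[>] 0))
    (hG' : ∀ᵐ z : Space n, ∀ᶠ j in atTop, (z ∈ blowUp A x₀ (r j) ↔ z ∈ G')) :
    G =ᵐ[volume] G' := by
  have hN : ∀ N : ℕ, ∀ᵐ z : Space n, z ∈ closedBall (0 : Space n) N → (z ∈ G ↔ z ∈ G') := by
    intro N
    have h1 := (hG (closedBall (0 : Space n) N) (isCompact_closedBall _ _)).comp hr
    obtain ⟨ε, hε, hsum⟩ := ENNReal.exists_pos_sum_of_countable' (one_ne_zero (α := ℝ≥0∞)) ℕ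
    obtain ⟨k, hk, h2⟩ := extraction_forall_of_eventually
      (P := fun i j => volume (symmDiff (blowUp A x₀ (r j)) G ∩ closedBall (0 : Space n) N) < ε i)
      fun i => h1.eventually_lt_const (hε i)
    have h3 : (∑' i, volume (symmDiff (blowUp A x₀ (r (k i))) G ∩ closedBall (0 : Space n) N)) ≠ ⊤ :=
      ((ENNReal.tsum_le_tsum fun i => (h2 i).le).trans_lt (hsum.trans ENNReal.one_lt_top)).ne
    filter_upwards [ae_eventually_notMem h3, hG'] with z hz hz' hzN
    obtain ⟨i, h4, h5⟩ := (hz.and (hk.tendsto_atTop.eventually hz')).exists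
    rw [← h5]
    by_contra hcon
    refine h4 ⟨?_, hzN⟩
    rw [mem_symmDiff]
    tauto
  filter_upwards [ae_all_iff.2 hN] with z hz
  obtain ⟨N, hN⟩ := exists_nat_ge ‖z‖
  exact propext (hz N (mem_closedBall_zero_iff.2 hN))

/-- Convex open sets which agree almost everywhere are equal. -/
lemma eq_of_ae_eq_of_convex {U V : Set (Space n)} (hU : IsOpen U) (hV : IsOpen V)
    (hUc : Convex ℝ U) (hVc : Convex ℝ V) (h : U =ᵐ[volume] V) : U = V := by
  have key : ∀ {U V : Set (Space n)}, IsOpen U → IsOpen V → Convex ℝ V → U =ᵐ[volume] V → U ⊆ V := by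
    intro U V hU hV hVc h
    have h1 : U ⊆ closure V := by
      have h2 : IsOpen (U \ closure V) := hU.sdiff isClosed_closure
      have h3 : volume (U \ closure V) = 0 :=
        measure_mono_null (sdiff_subset_sdiff_right subset_closure) (ae_eq_set.1 h).1
      exact sdiff_eq_empty.1 ((h2.measure_eq_zero_iff volume).1 h3)
    rcases V.eq_empty_or_nonempty with rfl | hne
    · simpa using h1
    · calc U ⊆ interior (closure V) := interior_maximal h1 hU
        _ = interior V := hVc.interior_closure_eq_interior_of_nonempty_interior
            (by rwa [hV.interior_eq])
        _ = V := hV.interior_eq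
  exact Subset.antisymm (key hU hV hVc h) (key hV hU hUc h.symm)

lemma IsOpenHalfSpace.isOpen {H : Set (Space n)} (hH : IsOpenHalfSpace H) : IsOpen H := by
  obtain ⟨p, -, c, rfl⟩ := hH
  exact isOpen_lt continuous_const (by fun_prop)

lemma IsOpenHalfSpace.convex {H : Set (Space n)} (hH : IsOpenHalfSpace H) : Convex ℝ H := by
  obtain ⟨p, -, c, rfl⟩ := hH
  exact convex_halfSpace_gt (innerSL ℝ p).toLinearMap.isLinear c

lemma convex_upperHalf (a : Space n) : Convex ℝ (upperHalf a) :=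
  convex_halfSpace_gt (innerSL ℝ a).toLinearMap.isLinear 0

lemma exists_apply_eq_one {m : Space n →L[ℝ] ℝ} (hm : m ≠ 0) : ∃ e, m e = 1 := by
  obtain ⟨e, he⟩ : ∃ e, m e ≠ 0 := by
    by_contra! h
    exact hm (ContinuousLinearMap.ext h)
  exact ⟨(m e)⁻¹ • e, by simp [he]⟩

/-- A nonzero linear functional is a positive multiple of the product with a unit vector. -/
lemma exists_unit_vector {m : Space n →L[ℝ] ℝ} (hm : m ≠ 0) :
    ∃ (a : Space n) (c : ℝ), ‖a‖ = 1 ∧ 0 < c ∧ ∀ z, m z = c * ⟪a, z⟫ := by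
  set p := (InnerProductSpace.toDual ℝ (Space n)).symm m with hp
  have h1 : ∀ z, m z = ⟪p, z⟫ := fun z => by
    rw [hp, InnerProductSpace.toDual_symm_apply]
  have hp0 : p ≠ 0 := by
    intro h0
    exact hm (ContinuousLinearMap.ext fun z => by rw [h1, h0, inner_zero_left]; rfl)
  have hpn : 0 < ‖p‖ := norm_pos_iff.2 hp0
  refine ⟨‖p‖⁻¹ • p, ‖p‖, by rw [norm_smul, norm_inv, norm_norm, inv_mul_cancel₀ hpn.ne'], hpn,
    fun z => ?_⟩
  rw [h1, real_inner_smul_left, mul_inv_cancel_left₀ hpn.ne']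

lemma mem_angularSector_pi_iff (hn : 2 ≤ n) {y : Space n} :
    y ∈ angularSector hn 0 Real.pi ↔ 0 < y ⟨n - 1, by omega⟩ := by
  constructor
  · rintro ⟨β, hβ, ρ, hρ, -, h2⟩
    rw [h2]
    exact mul_pos hρ (Real.sin_pos_of_mem_Ioo hβ)
  · intro h
    set w : ℂ := ⟨y ⟨0, by omega⟩, y ⟨n - 1, by omega⟩⟩ with hw
    have him : 0 < w.im := h
    have hw0 : w ≠ 0 := fun h0 => by rw [h0] at him; simp at him
    have h1 : 0 ≤ w.arg := Complex.arg_nonneg_iff.2 him.le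
    have h2 : w.arg ≠ 0 := fun h0 => him.ne' (Complex.arg_eq_zero_iff.1 h0).2
    exact ⟨w.arg, ⟨lt_of_le_of_ne h1 h2.symm, Complex.arg_lt_pi_iff.2 (Or.inr him.ne')⟩, ‖w‖,
      norm_pos_iff.2 hw0, (Complex.norm_mul_cos_arg w).symm, (Complex.norm_mul_sin_arg w).symm⟩

/-- The angle of a wedge cut out by two linearly independent half-spaces is strictly between `0` and
`π`: the wedge is neither empty nor a half-space. -/
lemma angle_mem_Ioo (hn : 2 ≤ n) {l : Space n →L[ℝ] ℝ} {a e : Space n} (ha : ‖a‖ = 1)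
    (hle : 0 < l e) (hae : ⟪a, e⟫ = 0) {H V : Set (Space n)}
    (hW : H ∩ V = {y | 0 < l y} ∩ upperHalf a) {θ : ℝ} (hθ : IsAngleBetween hn H V θ) :
    θ ∈ Ioo 0 Real.pi := by
  obtain ⟨⟨h0, hpi⟩, R, hR⟩ := hθ
  rw [hW] at hR
  have haa : ⟪a, a⟫ = 1 := by rw [real_inner_self_eq_norm_sq, ha, one_pow]
  set κ := l e / (2 * (|l a| + 1)) with hκ
  have hκ0 : 0 < κ := by positivity
  have hκl : κ * |l a| ≤ l e / 2 := by
    rw [hκ, div_mul_eq_mul_div, div_le_div_iff₀ (by positivity) two_pos]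
    nlinarith [abs_nonneg (l a)]
  have hκa := abs_le.1 (show |κ * l a| ≤ l e / 2 by rw [abs_mul, abs_of_pos hκ0]; exact hκl)
  have hw : e + κ • a ∈ {y | 0 < l y} ∩ upperHalf a := by
    refine ⟨?_, ?_⟩
    · change 0 < l (e + κ • a)
      rw [map_add, map_smul, smul_eq_mul]
      linarith [hκa.1]
    · change 0 < ⟪a, e + κ • a⟫
      rw [inner_add_right, real_inner_smul_right, hae, haa]
      linarith
  refine ⟨lt_of_le_of_ne h0 fun h => ?_, lt_of_le_of_ne hpi fun h => ?_⟩
  · have h1 : R (e + κ • a) ∈ angularSector hn 0 θ := hR ▸ mem_image_of_mem R hw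
    obtain ⟨β, hβ, -⟩ := h1
    rw [← h] at hβ
    exact absurd (hβ.1.trans hβ.2) (lt_irrefl _)
  · rw [h] at hR
    -- the points of the opposite quadrants are mapped to the boundary of the half-space
    have hvan : ∀ x, 0 < l x → ⟪a, x⟫ < 0 → (R x) ⟨n - 1, by omega⟩ = 0 := by
      intro x hx1 hx2
      have hnot : ∀ y, y ∉ {y | 0 < l y} ∩ upperHalf a → ¬ 0 < (R y) ⟨n - 1, by omega⟩ := by
        intro y hy hpos
        rw [← mem_angularSector_pi_iff hn, ← hR] at hpos
        obtain ⟨y', hy', hyy⟩ := hpos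
        rw [R.injective hyy] at hy'
        exact hy hy'
      have h1 := hnot x fun hx => lt_asymm hx2 hx.2
      have h2 := hnot (-x) fun hx => by
        have h3 : 0 < l (-x) := hx.1
        rw [map_neg] at h3
        linarith
      rw [map_neg, PiLp.neg_apply] at h2
      linarith
    have hneg : ∀ t : ℝ, 1 ≤ t → (R (t • e - κ • a)) ⟨n - 1, by omega⟩ = 0 := by
      intro t ht
      refine hvan _ ?_ ?_
      · rw [map_sub, map_smul, map_smul, smul_eq_mul, smul_eq_mul]
        nlinarith [hκa.2]
      · rw [inner_sub_right, real_inner_smul_right, real_inner_smul_right, hae, haa]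
        linarith
    have h1 := hneg 1 le_rfl
    have h2 := hneg 2 one_le_two
    have h3 : R (e + κ • a) ∈ angularSector hn 0 Real.pi := hR ▸ mem_image_of_mem R hw
    rw [mem_angularSector_pi_iff] at h3
    simp only [map_sub, map_add, map_smul, PiLp.sub_apply, PiLp.add_apply, PiLp.smul_apply,
      smul_eq_mul, one_mul] at h1 h2 h3
    linarith

end halfspaces

/-! ### Paths leaving the interface -/

section paths

variable {n : ℕ} {b : ℝ} {l m : Space n →L[ℝ] ℝ} {Ω E : ℕ → Set (Space n)}
  {F φ : ℕ → Space n → ℝ} {y : ℕ → Space n} {u : Space n}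

/-- Directions pointing strictly into the limit container do not leave the containers. -/
lemma InterfaceSequence.eventually_path (h : InterfaceSequence Ω E F φ b l m)
    (hy1 : ∀ j, ‖y j‖ ≤ 1) (hy : ∀ j, y j ∈ Ω j) (hu : 0 < l u) :
    (∀ᶠ j in atTop, ∀ t ∈ Icc (0 : ℝ) 1, y j + t • u ∈ Ω j) ∧
      ∀ᶠ j in atTop, l u / 2 ≤ b + l (y j + u) := by
  have hR : 0 < ‖u‖ + 2 := by positivity
  have hball : ∀ j, ∀ t ∈ Icc (0 : ℝ) 1, y j + t • u ∈ ball (0 : Space n) (‖u‖ + 2) := by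
    intro j t ht
    have h1 : ‖t • u‖ ≤ ‖u‖ := by
      rw [norm_smul, Real.norm_eq_abs, abs_of_nonneg ht.1]
      exact mul_le_of_le_one_left (norm_nonneg _) ht.2
    rw [mem_ball_zero_iff]
    linarith [norm_add_le (y j) (t • u), hy1 j]
  have h0 : ∀ j, y j ∈ ball (0 : Space n) (‖u‖ + 2) := fun j => by
    simpa using hball j 0 ⟨le_rfl, zero_le_one⟩
  constructor
  · filter_upwards [h.mem_iff _ hR,
      h.container_affine.oscillation _ hR (l u / (‖u‖ + 1)) (by positivity)] with j h1 h2 t ht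
    have h3 := (h1 _ (h0 j)).1 (hy j)
    have h4 := h2 _ (hball j t ht) _ (h0 j)
    rw [add_sub_cancel_left, map_smul, smul_eq_mul, norm_smul, Real.norm_eq_abs,
      abs_of_nonneg ht.1] at h4
    have h5 : l u / (‖u‖ + 1) * (t * ‖u‖) ≤ t * l u := by
      rw [div_mul_eq_mul_div, div_le_iff₀ (by positivity)]
      nlinarith [mul_nonneg hu.le ht.1]
    exact (h1 _ (hball j t ht)).2 (by linarith [(abs_le.1 h4).1])
  · filter_upwards [h.mem_iff _ hR, h.container_affine.uniform hR (half_pos hu)] with j h1 h2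
    have h3 := (h1 _ (h0 j)).1 (hy j)
    have h4 := (abs_le.1 (h2 _ (h0 j))).2
    rw [map_add]
    linarith

/-- Segments in the limit container are eventually contained in the containers. -/
lemma InterfaceSequence.eventually_path_zero (h : InterfaceSequence Ω E F φ b l m)
    (hb : 0 < b) (hu : |l u| ≤ b / 2) :
    (∀ᶠ j in atTop, ∀ t ∈ Icc (0 : ℝ) 1, (0 : Space n) + t • u ∈ Ω j) ∧
      b / 2 ≤ b + l (0 + u) := by
  have hu' := abs_le.1 hu
  refine ⟨?_, by rw [zero_add]; linarith⟩
  have hK : IsCompact ((fun t : ℝ => (0 : Space n) + t • u) '' Icc 0 1) :=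
    isCompact_Icc.image (by fun_prop)
  filter_upwards [h.eventually_subset hK (by
    rintro _ ⟨t, ht, rfl⟩
    change 0 < b + l (0 + t • u)
    rw [zero_add, map_smul, smul_eq_mul]
    nlinarith [ht.1, ht.2])] with j hj t ht
  exact hj ⟨t, ht, rfl⟩

end paths

/-! ### Blow-ups at a regular contact point -/

section contact

variable {n : ℕ} {s lam σ b : ℝ} {ϱ : ℝ≥0∞} {K₁ K₂ K₁star K₂star g : Space n → ℝ}
  {Ω E : Set (Space n)} {x₀ : Space n} {F φ : Space n → ℝ} {l m : Space n →L[ℝ] ℝ}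

/-- Along a subsequence, the blow-ups of a critical set at points of `{φ = 0}` converge to a wedge
which is in equilibrium. -/
theorem exists_equilibrium_blowUp (hn : 2 ≤ n) (hs : s ∈ Ioo (0 : ℝ) 1) (hlam : 1 ≤ lam)
    (hK₁ : IsSmoothKernel 2 n s lam ϱ K₁) (hK₂ : IsSmoothKernel 2 n s lam ϱ K₂)
    (hlim₁ : AdmitsBlowUpLimit s K₁ K₁star) (hlim₂ : AdmitsBlowUpLimit s K₂ K₂star)
    (hstar₁ : IsAnisotropicKernel s K₁star) (hstar₂ : IsAnisotropicKernel s K₂star)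
    (hg : ContDiff ℝ 1 g) (hΩ : IsOpen Ω) (hΩb : Bornology.IsBounded Ω)
    (hE : IsVolumeConstrainedCritical K₁ K₂ σ g Ω E) {x : ℕ → Space n} {r : ℕ → ℝ}
    (hr : Tendsto r atTop (𝓝 0)) (hr0 : ∀ j, 0 < r j) {F φ : ℕ → Space n → ℝ}
    (h : InterfaceSequence (fun j => blowUp Ω (x j) (r j)) (fun j => blowUp E (x j) (r j)) F φ b l m)
    {y : ℕ → Space n} (hy1 : ∀ j, ‖y j‖ ≤ 1)
    (hy : ∀ j, y j ∈ blowUp Ω (x j) (r j) ∩ frontier (blowUp E (x j) (r j)))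
    {u u' : Space n} (hu : 0 < m u) (hu' : m u' < 0) {δ : ℝ} (hδ : 0 < δ)
    (hpath : ∀ᶠ j in atTop, ∀ t ∈ Icc (0 : ℝ) 1, y j + t • u ∈ blowUp Ω (x j) (r j))
    (hpath' : ∀ᶠ j in atTop, ∀ t ∈ Icc (0 : ℝ) 1, y j + t • u' ∈ blowUp Ω (x j) (r j))
    (hend : ∀ᶠ j in atTop, δ ≤ b + l (y j + u)) (hend' : ∀ᶠ j in atTop, δ ≤ b + l (y j + u')) :
    ∃ (a : Space n) (c : ℝ), ‖a‖ = 1 ∧ c ≠ 0 ∧ (∀ z, m z = c * ⟪a, z⟫) ∧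
      (∃ k : ℕ → ℕ, StrictMono k ∧ ∀ᵐ z : Space n, ∀ᶠ i in atTop,
        (z ∈ blowUp E (x (k i)) (r (k i)) ↔ 0 < b + l z ∧ 0 < ⟪a, z⟫)) ∧
      ∀ v, 0 < b + l v → ⟪a, v⟫ = 0 → flatBalance K₁star K₂star σ a {z | 0 < b + l z} v = 0 := by
  obtain ⟨m', hm', k, hk, hconv⟩ :=
    h.exists_subseq_tendsto hy1 hy hu hu' hδ hpath hpath' hend hend'
  have hm'0 : m' ≠ 0 := by
    rcases hm' with rfl | rfl
    · exact h.interface_ne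
    · exact neg_ne_zero.2 h.interface_ne
  obtain ⟨a, c, ha, hc, hac⟩ := exists_unit_vector hm'0
  have hconv' : ∀ᵐ z : Space n, ∀ᶠ i in atTop,
      (z ∈ blowUp E (x (k i)) (r (k i)) ↔ 0 < b + l z ∧ 0 < ⟪a, z⟫) := by
    filter_upwards [hconv] with z hz
    filter_upwards [hz] with i hi
    rw [hi, hac, mul_pos_iff_of_pos_left hc]
  have hm : ∃ c', c' ≠ 0 ∧ ∀ z, m z = c' * ⟪a, z⟫ := by
    rcases hm' with rfl | rfl
    · exact ⟨c, hc.ne', hac⟩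
    · refine ⟨-c, neg_ne_zero.2 hc.ne', fun z => ?_⟩
      have := hac z
      rw [neg_apply] at this
      linarith
  obtain ⟨c', hc', hac'⟩ := hm
  obtain ⟨k₁', hk₁', hk₁l⟩ := hK₁.exists_limit_pair hs hlam hlim₁ hstar₁ ha
  obtain ⟨k₂', hk₂', hk₂l⟩ := hK₂.exists_limit_pair hs hlam hlim₂ hstar₂ ha
  refine ⟨a, c', ha, hc', hac', ⟨k, hk, hconv'⟩, fun v hv hva => ?_⟩
  exact blowUp_flatBalance_eq_zero hn hs ha (hK₁.kernelPair ha) (hK₂.kernelPair ha) hk₁' hk₂' hlim₁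
    hlim₂ hk₁l hk₂l hK₁.nonneg hK₂.nonneg hg hΩ hΩb hE (hr.comp hk.tendsto_atTop)
    (fun i => hr0 (k i)) (h.comp hk) hconv' hv hva

/-- Points of the interface approaching the contact point. -/
lemma ContactChart.exists_seq (hc : ContactChart Ω E x₀ F φ l m)
    (hx₀ : x₀ ∈ closure (Ω ∩ frontier E)) : ∃ p : ℕ → Space n, Tendsto p atTop (𝓝 x₀) ∧
      ∀ j, p j ∈ Ω ∩ frontier E ∧ φ (p j) = 0 ∧ 0 < F (p j) := by
  obtain ⟨p, hp, hlim⟩ := mem_closure_iff_seq_limit.1 hx₀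
  obtain ⟨N, hN⟩ := eventually_atTop.1 (hlim.eventually (hc.mem_iff.and hc.interface))
  refine ⟨fun j => p (j + N), hlim.comp (tendsto_add_atTop_nat N), fun j => ?_⟩
  have h1 := hN (j + N) (Nat.le_add_left _ _)
  exact ⟨hp _, h1.2 (hp _), h1.1.1 (hp _).1⟩

/-- The interface meets the boundary of the container transversally. Otherwise the blow-ups at the
scale of the distance from the boundary would produce a limit interface parallel to the boundary of
the limit container, and then the equilibrium density has a sign, because `|σ| K₂ < K₁`. -/
theorem ContactChart.exists_transversal (hc : ContactChart Ω E x₀ F φ l m) (hn : 2 ≤ n)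
    (hs : s ∈ Ioo (0 : ℝ) 1) (hlam : 1 ≤ lam)
    (hK₁ : IsSmoothKernel 2 n s lam ϱ K₁) (hK₂ : IsSmoothKernel 2 n s lam ϱ K₂)
    (hlim₁ : AdmitsBlowUpLimit s K₁ K₁star) (hlim₂ : AdmitsBlowUpLimit s K₂ K₂star)
    (hstar₁ : IsAnisotropicKernel s K₁star) (hstar₂ : IsAnisotropicKernel s K₂star)
    {ε₀ : ℝ} (hε₀ : 0 < ε₀)
    (hσ : ∀ ζ ∈ ball (0 : Space n) ε₀ \ {0}, |σ| * K₂ ζ ≤ (1 - ε₀) * K₁ ζ)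
    (hg : ContDiff ℝ 1 g) (hΩ : IsOpen Ω) (hΩb : Bornology.IsBounded Ω)
    (hE : IsVolumeConstrainedCritical K₁ K₂ σ g Ω E) (hEn : IsNormalizedIn Ω E)
    (hx₀ : x₀ ∈ closure (Ω ∩ frontier E)) : ∃ e, m e = 0 ∧ 0 < l e := by
  by_contra! hpar
  have hpar' : ∀ e, m e = 0 → l e = 0 := by
    intro e he
    refine le_antisymm (hpar e he) ?_
    have := hpar (-e) (by rw [map_neg, he, neg_zero])
    rw [map_neg] at this
    linarith
  obtain ⟨p, hp, hpp⟩ := hc.exists_seq hx₀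
  have hr : Tendsto (fun j => F (p j)) atTop (𝓝 0) := by
    have := hc.container_deriv.continuousAt.tendsto.comp hp
    rwa [hc.container_zero] at this
  have hI := hc.interfaceSequence (b := 1) hΩ hE.subset hEn hp hr (fun j => (hpp j).2.2)
    (fun j => (hpp j).2.1)
    (tendsto_const_nhds.congr fun j => (div_self (hpp j).2.2.ne').symm)
  obtain ⟨e, he⟩ := exists_apply_eq_one hc.interface_ne
  set κ := 1 / (2 * (|l e| + 1)) with hκ
  have hκ0 : 0 < κ := by positivity
  have hκl : |κ * l e| ≤ 1 / 2 := by
    rw [abs_mul, abs_of_pos hκ0, hκ, div_mul_eq_mul_div, div_le_div_iff₀ (by positivity) two_pos]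
    linarith [abs_nonneg (l e)]
  obtain ⟨q1, q2⟩ := hI.eventually_path_zero (u := κ • e) one_pos
    (by rwa [map_smul, smul_eq_mul])
  obtain ⟨q1', q2'⟩ := hI.eventually_path_zero (u := -(κ • e)) one_pos
    (by rwa [map_neg, map_smul, smul_eq_mul, abs_neg])
  obtain ⟨a, c, ha, hc0, hmc, -, hbal⟩ := exists_equilibrium_blowUp hn hs hlam hK₁ hK₂ hlim₁ hlim₂
    hstar₁ hstar₂ hg hΩ hΩb hE hr (fun j => (hpp j).2.2) hI (y := fun _ => 0) (by simp)
    (fun j => by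
      rw [frontier_blowUp _ _ (hpp j).2.2.ne']
      constructor
      · change p j + F (p j) • (0 : Space n) ∈ Ω
        rw [smul_zero, add_zero]; exact (hpp j).1.1
      · change p j + F (p j) • (0 : Space n) ∈ frontier E
        rw [smul_zero, add_zero]; exact (hpp j).1.2)
    (u := κ • e) (u' := -(κ • e)) (by rw [map_smul, he, smul_eq_mul, mul_one]; exact hκ0)
    (by rw [map_neg, map_smul, he, smul_eq_mul, mul_one]; linarith) (δ := 1 / 2) (by norm_num)
    q1 q1' (Eventually.of_forall fun _ => q2) (Eventually.of_forall fun _ => q2')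
  have h0 := hbal 0 (by simp) (by simp)
  obtain ⟨k₁', hk₁', -⟩ := hK₁.exists_limit_pair hs hlam hlim₁ hstar₁ ha
  obtain ⟨k₂', hk₂', -⟩ := hK₂.exists_limit_pair hs hlam hlim₂ hstar₂ ha
  -- `l` is a multiple of `⟪a, ·⟫`
  have hla : ∀ z, l z = l e * c * ⟪a, z⟫ := by
    intro z
    have h1 := hpar' (z - m z • e) (by rw [map_sub, map_smul, he, smul_eq_mul, mul_one, sub_self])
    rw [map_sub, map_smul, smul_eq_mul, hmc] at h1
    linarith
  have hHo : IsOpen {z | 0 < 1 + l z} := isOpen_lt continuous_const (by fun_prop)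
  refine flatBalance_ne_zero hn hs hHo hk₁' hk₂' (v := 0)
    (show 0 < 1 + l 0 by simp) hε₀ (fun z hz => limit_kernel_le hε₀ hlim₁ hlim₂ hσ hz)
    (fun z hz => hstar₁.pos hz) (fun z hz => (hstar₂.pos hz).le) ?_ ?_ h0
  · obtain ⟨f, hf⟩ := exists_apply_eq_one hc.container_ne
    have hopen : IsOpen {z | 1 + l z < 0} := isOpen_lt (by fun_prop) continuous_const
    refine (hopen.measure_pos volume ⟨(-2 : ℝ) • f, ?_⟩).trans_le (measure_mono fun z hz hz' =>
      lt_asymm (show 1 + l z < 0 from hz) hz')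
    change 1 + l ((-2 : ℝ) • f) < 0
    rw [map_smul, hf, smul_eq_mul]
    norm_num
  · have hle0 : l e ≠ 0 := by
      intro h1
      refine hc.container_ne (ContinuousLinearMap.ext fun z => ?_)
      rw [hla z, h1, zero_mul, zero_mul]; rfl
    have hHc : ∀ z ∈ {z | 0 < 1 + l z}ᶜ, l e * c * ⟪a, z⟫ < 0 := by
      intro z hz
      have h1 : ¬ 0 < 1 + l z := hz
      rw [hla] at h1
      linarith
    rcases lt_or_gt_of_ne (mul_ne_zero hle0 hc0) with hsign | hsign
    · right
      intro z hz
      exact sideSign_of_mem (show 0 < ⟪a, z⟫ by nlinarith [hHc z hz])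
    · left
      intro z hz
      exact sideSign_of_notMem fun h1 => by
        have h2 : 0 < ⟪a, z⟫ := h1
        nlinarith [hHc z hz]

/-- At a regular contact point, the blow-up of the critical set is a wedge cut out by two linearly
independent half-spaces, which is in equilibrium. -/
theorem ContactChart.exists_wedge (hc : ContactChart Ω E x₀ F φ l m) (hn : 2 ≤ n)
    (hs : s ∈ Ioo (0 : ℝ) 1) (hlam : 1 ≤ lam)
    (hK₁ : IsSmoothKernel 2 n s lam ϱ K₁) (hK₂ : IsSmoothKernel 2 n s lam ϱ K₂)
    (hlim₁ : AdmitsBlowUpLimit s K₁ K₁star) (hlim₂ : AdmitsBlowUpLimit s K₂ K₂star)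
    (hstar₁ : IsAnisotropicKernel s K₁star) (hstar₂ : IsAnisotropicKernel s K₂star)
    (hg : ContDiff ℝ 1 g) (hΩ : IsOpen Ω) (hΩb : Bornology.IsBounded Ω)
    (hE : IsVolumeConstrainedCritical K₁ K₂ σ g Ω E) (hEn : IsNormalizedIn Ω E)
    (hx₀ : x₀ ∈ closure (Ω ∩ frontier E)) {e : Space n} (hme : m e = 0) (hle : 0 < l e)
    {H V : Set (Space n)} (hH : IsOpenHalfSpace H) (hV : IsOpenHalfSpace V)
    (hΩH : BlowUpConverges Ω x₀ H) (hEHV : BlowUpConverges E x₀ (H ∩ V)) :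
    ∃ a : Space n, ‖a‖ = 1 ∧ ⟪a, e⟫ = 0 ∧ H = {z | 0 < l z} ∧ H ∩ V = H ∩ upperHalf a ∧
      ∀ v ∈ H, ⟪a, v⟫ = 0 → flatBalance K₁star K₂star σ a H v = 0 := by
  obtain ⟨p, hp, hpp⟩ := hc.exists_seq hx₀
  have hr : Tendsto (fun j => ‖p j - x₀‖) atTop (𝓝 0) :=
    tendsto_iff_norm_sub_tendsto_zero.1 hp
  have hr0 : ∀ j, 0 < ‖p j - x₀‖ := fun j => by
    refine norm_pos_iff.2 (sub_ne_zero.2 fun h => (hpp j).2.2.ne' ?_)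
    rw [h, hc.container_zero]
  have hr' : Tendsto (fun j => ‖p j - x₀‖) atTop (𝓝[>] 0) :=
    tendsto_nhdsWithin_iff.2 ⟨hr, Eventually.of_forall hr0⟩
  have hI := hc.interfaceSequence (b := 0) hΩ hE.subset hEn (x := fun _ => x₀) tendsto_const_nhds hr
    hr0 (fun _ => hc.interface_zero) (by simp [hc.container_zero])
  set y : ℕ → Space n := fun j => ‖p j - x₀‖⁻¹ • (p j - x₀) with hydef
  have hxy : ∀ j, x₀ + ‖p j - x₀‖ • y j = p j := fun j => by
    rw [hydef]
    simp only
    rw [smul_inv_smul₀ (hr0 j).ne', add_sub_cancel]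
  have hy1 : ∀ j, ‖y j‖ ≤ 1 := fun j => by
    rw [hydef]
    simp only
    rw [norm_smul, norm_inv, norm_norm, inv_mul_cancel₀ (hr0 j).ne']
  have hyΩ : ∀ j, y j ∈ blowUp Ω x₀ ‖p j - x₀‖ := fun j => by
    change x₀ + ‖p j - x₀‖ • y j ∈ Ω
    rw [hxy]; exact (hpp j).1.1
  have hy : ∀ j, y j ∈ blowUp Ω x₀ ‖p j - x₀‖ ∩ frontier (blowUp E x₀ ‖p j - x₀‖) := fun j => by
    refine ⟨hyΩ j, ?_⟩
    rw [frontier_blowUp _ _ (hr0 j).ne']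
    change x₀ + ‖p j - x₀‖ • y j ∈ frontier E
    rw [hxy]; exact (hpp j).1.2
  obtain ⟨f, hf⟩ := exists_apply_eq_one hc.interface_ne
  set κ := l e / (2 * (|l f| + 1)) with hκ
  have hκ0 : 0 < κ := by positivity
  have hκl : |κ * l f| ≤ l e / 2 := by
    rw [abs_mul, abs_of_pos hκ0, hκ, div_mul_eq_mul_div, div_le_div_iff₀ (by positivity) two_pos]
    nlinarith [abs_nonneg (l f)]
  have hκl' := abs_le.1 hκl
  have hlu : l e / 2 ≤ l (e + κ • f) := by rw [map_add, map_smul, smul_eq_mul]; linarith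
  have hlu' : l e / 2 ≤ l (e - κ • f) := by rw [map_sub, map_smul, smul_eq_mul]; linarith
  obtain ⟨q1, q2⟩ := hI.eventually_path hy1 hyΩ (u := e + κ • f) (by linarith)
  obtain ⟨q1', q2'⟩ := hI.eventually_path hy1 hyΩ (u := e - κ • f) (by linarith)
  obtain ⟨a, c, ha, hc0, hmc, ⟨k, hk, hconv⟩, hbal⟩ := exists_equilibrium_blowUp hn hs hlam hK₁ hK₂
    hlim₁ hlim₂ hstar₁ hstar₂ hg hΩ hΩb hE hr hr0 hI hy1 hy
    (u := e + κ • f) (u' := e - κ • f)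
    (by rw [map_add, map_smul, hme, hf, smul_eq_mul, mul_one, zero_add]; exact hκ0)
    (by rw [map_sub, map_smul, hme, hf, smul_eq_mul, mul_one]; linarith)
    (δ := l e / 4) (by linarith) q1 q1'
    (q2.mono fun j hj => by linarith) (q2'.mono fun j hj => by linarith)
  simp only [zero_add] at hconv hbal
  have hHl : H = {z | 0 < l z} := by
    refine eq_of_ae_eq_of_convex hH.isOpen (isOpen_lt continuous_const (by fun_prop)) hH.convex
      (convex_halfSpace_gt l.toLinearMap.isLinear 0) (hΩH.ae_eq hr' ?_)
    filter_upwards [hI.ae_eventually_mem_container] with z hz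
    filter_upwards [hz] with j hj
    rw [hj, zero_add]
  have hHV : H ∩ V = H ∩ upperHalf a := by
    refine eq_of_ae_eq_of_convex (hH.isOpen.inter hV.isOpen) (hH.isOpen.inter isOpen_upperHalf)
      (hH.convex.inter hV.convex) (hH.convex.inter (convex_upperHalf a))
      (hEHV.ae_eq (hr'.comp hk.tendsto_atTop) ?_)
    filter_upwards [hconv] with z hz
    filter_upwards [hz] with j hj
    rw [hHl]
    exact hj
  refine ⟨a, ha, ?_, hHl, hHV, fun v hv hva => ?_⟩
  · have := hmc e
    rw [hme] at this
    exact (mul_eq_zero.1 this.symm).resolve_left hc0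
  · rw [hHl] at hv ⊢
    exact hbal v hv hva

/-- Inside `H`, the boundary of `V` is the hyperplane orthogonal to `a`. -/
lemma inner_eq_zero_of_mem_frontier {a v : Space n} {H V : Set (Space n)} (hH : IsOpen H)
    (hHV : H ∩ V = H ∩ upperHalf a) (hv : v ∈ H ∩ frontier V) : ⟪a, v⟫ = 0 := by
  have h1 : v ∈ frontier (V ∩ H) ∩ H := by
    rw [frontier_inter_open_inter hH]; exact ⟨hv.2, hv.1⟩
  rw [inter_comm V H, hHV, inter_comm H, frontier_inter_open_inter hH] at h1
  have h2 := frontier_lt_subset_eq (f := fun _ : Space n => (0 : ℝ)) (g := fun x => ⟪a, x⟫)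
    continuous_const (by fun_prop) h1.1
  exact Eq.symm h2

end contact

end Capillarity

end

theorem theorem1p6 {n : ℕ} (hn : 2 ≤ n)
    (s : ℝ) (hs : s ∈ Ioo (0 : ℝ) 1) (lam : ℝ) (hlam : 1 ≤ lam) (ϱ : ℝ≥0∞) (hϱ : 0 < ϱ)
    (σ : ℝ) (K₁ K₂ K₁star K₂star : Space n → ℝ)
    (hK₁ : IsSmoothKernel 2 n s lam ϱ K₁) (hK₂ : IsSmoothKernel 2 n s lam ϱ K₂)
    (hlim₁ : AdmitsBlowUpLimit s K₁ K₁star) (hlim₂ : AdmitsBlowUpLimit s K₂ K₂star)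
    (hstar₁ : IsAnisotropicKernel s K₁star) (hstar₂ : IsAnisotropicKernel s K₂star)
    (hσ : ∃ ε₀ ∈ Ioo (0 : ℝ) 1, ∀ ζ ∈ ball (0 : Space n) ε₀ \ {0},
      |σ| * K₂ ζ ≤ (1 - ε₀) * K₁ ζ)
    (g : Space n → ℝ) (hg : ContDiff ℝ 1 g)
    (Ω : Set (Space n)) (hΩ : IsOpen Ω) (hΩb : Bornology.IsBounded Ω) (hΩ1 : HasC1Boundary Ω)
    (E : Set (Space n)) (hE : IsVolumeConstrainedCritical K₁ K₂ σ g Ω E)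
    (hEn : IsNormalizedIn Ω E)
    (x₀ : Space n) (hx₀ : x₀ ∈ regularSet s Ω E ∩ frontier Ω)
    (H V : Set (Space n)) (hH : IsOpenHalfSpace H) (hV : IsOpenHalfSpace V)
    (hΩH : BlowUpConverges Ω x₀ H) (hEHV : BlowUpConverges E x₀ (H ∩ V))
    (θ : ℝ) (hθ : IsAngleBetween hn H V θ) :
    θ ∈ Ioo 0 Real.pi ∧
      ∀ v ∈ H ∩ frontier V, ∃ h : ℝ,
        HasNonlocalMeanCurvature K₁star (H ∩ V) v h ∧
        IntegrableOn (fun z => K₁star (v - z)) Hᶜ ∧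
        IntegrableOn (fun z => K₂star (v - z)) Hᶜ ∧
        h - (∫ z in Hᶜ, K₁star (v - z)) + σ * (∫ z in Hᶜ, K₂star (v - z)) = 0 := by
  obtain ⟨ε₀, hε₀, hσ⟩ := hσ
  obtain ⟨F, φ, l, m, hc⟩ := exists_contactChart hΩ hΩ1 hx₀
  obtain ⟨e, hme, hle⟩ := hc.exists_transversal hn hs hlam hK₁ hK₂ hlim₁ hlim₂ hstar₁ hstar₂ hε₀.1 hσ
    hg hΩ hΩb hE hEn hx₀.1.1
  obtain ⟨a, ha, hae, hHl, hHV, hbal⟩ := hc.exists_wedge hn hs hlam hK₁ hK₂ hlim₁ hlim₂ hstar₁ hstar₂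
    hg hΩ hΩb hE hEn hx₀.1.1 hme hle hH hV hΩH hEHV
  refine ⟨angle_mem_Ioo hn ha hle hae (by rw [hHV, hHl]) hθ, fun v hv => ?_⟩
  have hva := inner_eq_zero_of_mem_frontier hH.isOpen hHV hv
  obtain ⟨k₁', hk₁', -⟩ := hK₁.exists_limit_pair hs hlam hlim₁ hstar₁ ha
  obtain ⟨k₂', hk₂', -⟩ := hK₂.exists_limit_pair hs hlam hlim₂ hstar₂ ha
  rw [hHV]
  exact nonlocalMeanCurvature_of_flatBalance hn hs ha hH.isOpen hk₁' hk₂' hv.1 hva (hbal v hv.1 hva)
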